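/- **Conventions.** Let $3\le k\le\infty$. A $C^k$ submanifold $\mathcal M\subset\mathbb R^n$ of codimension $c$ is a set that is locally the zero set of a $C^k$ submersion to $\mathbb R^c$; put $d=n-c$. It carries the induced Riemannian metric, with Riemannian distance $d_g$ and exponential map $\exp(x,v)=\gamma_v(1)$, where $\gamma_v$ is the geodesic of $\mathcal M$ (a $C^2$ curve in $\mathcal M$ with $\gamma''\perp T\mathcal M$) with $\gamma_v(0)=x$, $\gamma_v'(0)=v$. A *retraction of order $i$* ($1\le i<k$) on $\mathcal M$ is a $C^{k-1}$ map $R:U\to\mathcal M$, where $U$ is an open subset of $T\mathcal M$ containing all zero tangent vectors, such that for all $(x,v)\in T\mathcal M$, $\exp(x,tv)$ is defined for $t$ near $0$ and $d_g(R(x,tv),\exp(x,tv))=o(|t|^i)$ as $t\to0$. A *normal foliation* of class $C^{k-1}$ of an open neighbourhood $D\subset\mathbb R^n$ of $\mathcal M$ is a $C^{k-1}$ foliation of $D$ whose leaves are connected $c$-dimensional submanifolds $\mathscr F_p$, $p\in\mathcal M$, that partition $D$, with $p\in\mathscr F_p$ and $T_p\mathscr F_p=(T_p\mathcal M)^\perp$;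 here foliation means that locally the leaves are unions of fibres of $C^{k-1}$ submersions to $\mathbb R^d$. Its canonical projection $\pi:D\to\mathcal M$ is given by $x\in\mathscr F_{\pi(x)}$, and the retraction that it induces is $R_{\mathscr F}(x,v)=\pi(x+v)$, defined for all $(x,v)\in T\mathcal M$ with $x+v\in D$. For $F:\mathbb R^n\to\mathbb R^c$ with Jacobian $J$, let $N_F(x)=x-J(x)^\dagger F(x)$ ($\dagger$ the Moore–Penrose inverse) and $N_F^\infty(x)=\lim_{m\to\infty}N_F^m(x)$. **Theorem.** 1. Let $\mathcal M$ be a $C^k$ submanifold of $\mathbb R^n$ and $\mathscr F$ a normal foliation of class $C^{k-1}$ of a neighbourhood of $\mathcal M$. Then $R_{\mathscr F}$ is a retraction of order $2$ on $\mathcal M$. 2. This includes Newton retraction. Let $F\in C^k(\mathbb R^n,\mathbb R^c)$ have $0$ as a regular value, and let $\mathcal M=F^{-1}(0)$. Then there is an open neighbourhood $D$ of $\mathcal M$ on which $N_F^\infty$ is defined as a $C^{k-1}$ map $D\to\mathcal M$ and whose partition into the sets $\{x\in D: N_F^\infty(x)=p\}$, $p\in\mathcal M$, is a normal foliation of class $C^{k-1}$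 with canonical projection $N_F^\infty$. Moreover, for every open neighbourhood $D$ of $\mathcal M$ on which $N_F^\infty$ is defined as a $C^{k-1}$ map $D\to\mathcal M$, the Newton retraction $R_N(x,v)=N_F^\infty(x+v)$, defined for all $(x,v)\in T\mathcal M$ with $x+v\in D$, is a retraction of order $2$ on $\mathcal M$. 3. The order is sharp. Let $F(x)=\|x\|^2-1$ on $\mathbb R^2$, so that $\mathcal M=F^{-1}(0)$ is the unit circle. Then $N_F^\infty$ is a $C^\infty$ map from $D=\mathbb R^2\setminus\{0\}$ to $\mathcal M$, and its fibres form a normal foliation of $D$ of class $C^\infty$. The Newton retraction $R_N$ is defined on all of $T\mathcal M$, is a retraction of order $2$, and equals the projective retraction: $R_N(x,v)$ is the unique point of $\mathcal M$ closest to $x+v$. For every $(x,v)\in T\mathcal M$ with $v\ne0$, however, $d_g(R_N(x,tv),\exp(x,tv))$ is not $o(|t|^3)$ as $t\to0$. -/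

import Mathlib

open Set Filter Topology MeasureTheory
open scoped ENNReal

noncomputable section

namespace SubmanifoldRetraction

/-- The Euclidean space of dimension `n`. -/
abbrev Eucl (n : ℕ) := EuclideanSpace ℝ (Fin n)

section Submanifolds

variable {E : Type*} [NormedAddCommGroup E] [InnerProductSpace ℝ E]

/-- `S` is an (embedded, not necessarily connected, compact or closed) `C^k` submanifold of
codimension `c`: locally it is the zero set of a `C^k` submersion to `ℝ^c`. -/
def IsSubmanifold (k : ℕ∞) (c : ℕ) (S : Set E) : Prop :=
  ∀ x ∈ S, ∃ (W : Set E) (G : E → Eucl c), IsOpen W ∧ x ∈ W ∧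
    ContDiffOn ℝ (k : WithTop ℕ∞) G W ∧
    (∀ y ∈ W, Function.Surjective (fderiv ℝ G y)) ∧
    S ∩ W = {y ∈ W | G y = 0}

/-- The tangent space of `S` at `p`: the velocities at `p` of curves in `S` through `p`.  (For a
submanifold these velocities already form a linear subspace; the span makes it one by
definition.) -/
def tangentSpaceAt (S : Set E) (p : E) : Submodule ℝ E :=
  Submodule.span ℝ {v | ∃ γ : ℝ → E, (∀ᶠ t in 𝓝 (0 : ℝ), γ t ∈ S) ∧ γ 0 = p ∧ HasDerivAt γ v 0}

/-- The tangent bundle of `S`, as the set of pairs (foot point, tangent vector). -/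
def tangentBundleOf (S : Set E) : Set (E × E) :=
  {z | z.1 ∈ S ∧ z.2 ∈ tangentSpaceAt S z.1}

/-- `γ` is a `C¹` path in `S` from `x` to `y`, parametrized by `[0, 1]`. -/
structure IsPathIn (S : Set E) (x y : E) (γ : ℝ → E) : Prop where
  contDiffOn : ContDiffOn ℝ 1 γ (Icc 0 1)
  mem : ∀ t ∈ Icc (0 : ℝ) 1, γ t ∈ S
  source : γ 0 = x
  target : γ 1 = y

/-- The Riemannian distance of `S` with the metric induced by the ambient inner product: the
infimum of the lengths of the paths in `S` (it is `∞` between different components). -/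
def riemannianDist (S : Set E) (x y : E) : ℝ≥0∞ :=
  ⨅ (γ : ℝ → E) (_ : IsPathIn S x y γ),
    ∫⁻ t in Icc (0 : ℝ) 1, ‖derivWithin γ (Icc 0 1) t‖ₑ

/-- `γ` is a geodesic of `S` on the interval `(a, b)`: its intrinsic acceleration, the tangential
part of `γ''`, vanishes. -/
structure IsGeodesicOn (S : Set E) (γ : ℝ → E) (a b : ℝ) : Prop where
  contDiffOn : ContDiffOn ℝ 2 γ (Ioo a b)
  mem : ∀ t ∈ Ioo a b, γ t ∈ S
  acceleration : ∀ t ∈ Ioo a b, deriv (deriv γ) t ∈ (tangentSpaceAt S (γ t))ᗮ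

/-- `y = γ(1)` for a geodesic `γ` of `S` with initial location `x` and initial velocity `v`. -/
def IsExp (S : Set E) (x v y : E) : Prop :=
  ∃ (γ : ℝ → E) (a b : ℝ), a < 0 ∧ 1 < b ∧ IsGeodesicOn S γ a b ∧
    γ 0 = x ∧ deriv γ 0 = v ∧ γ 1 = y

/-- The domain of the exponential map. -/
def expDomain (S : Set E) : Set (E × E) :=
  {z | z ∈ tangentBundleOf S ∧ ∃ y, IsExp S z.1 z.2 y}

open Classical in
/-- The exponential map `exp(x, v) = γ_v(1)` of `S` (with the dummy value `x` outside of
`expDomain S`). -/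
def expMap (S : Set E) (z : E × E) : E :=
  if h : ∃ y, IsExp S z.1 z.2 y then h.choose else z.1

/-- `R(x, t v) = exp(x, t v) + o(t^i)` as `t → 0`, in the Riemannian distance. -/
def AgreesWithExp (S : Set E) (R : E × E → E) (i : ℕ) (x v : E) : Prop :=
  Tendsto (fun t : ℝ => riemannianDist S (R (x, t • v)) (expMap S (x, t • v)) /
    ENNReal.ofReal (|t| ^ i)) (𝓝[≠] 0) (𝓝 0)

/-- `R`, with domain `U`, is a retraction of order `i` on the `C^k` submanifold `S`. -/
structure IsRetractionOfOrder (k : ℕ∞) (i : ℕ) (S : Set E) (U : Set (E × E))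
    (R : E × E → E) : Prop where
  one_le : 1 ≤ i
  lt : (i : ℕ∞) < k
  /-- The domain is an open subset of the tangent bundle. -/
  isOpen : ∃ O : Set (E × E), IsOpen O ∧ U = O ∩ tangentBundleOf S
  zero_mem : ∀ x ∈ S, (x, 0) ∈ U
  mapsTo : MapsTo R U S
  contDiffOn : ContDiffOn ℝ ((k - 1 : ℕ∞) : WithTop ℕ∞) R U
  /-- The exponential map is defined near every zero tangent vector. -/
  exp_defined : ∀ x ∈ S, ∀ v ∈ tangentSpaceAt S x, ∀ᶠ t in 𝓝 (0 : ℝ), (x, t • v) ∈ expDomain S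
  agrees : ∀ x ∈ S, ∀ v ∈ tangentSpaceAt S x, AgreesWithExp S R i x v

/-- The tangent vectors `(x, v)` of `S` with `x + v ∈ D`, i.e. `E⁻¹(D)` for the Euclidean
exponential map `E(x, v) = x + v`. -/
def retractionDomain (S D : Set E) : Set (E × E) :=
  {z ∈ tangentBundleOf S | z.1 + z.2 ∈ D}

/-- The map `(x, v) ↦ P(x + v)`. -/
def inducedRetraction (P : E → E) : E × E → E := fun z => P (z.1 + z.2)

/-- The set of points of `S` closest to `y`. -/
def closestPoints (S : Set E) (y : E) : Set E :=
  {p ∈ S | ∀ q ∈ S, dist y p ≤ dist y q}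

/-- The sets `leaf p`, `p ∈ M`, are the leaves of a normal foliation of class `C^r` of the
neighbourhood `D` of the submanifold `M` of dimension `d` and codimension `c`. -/
structure IsNormalFoliation (r : ℕ∞) (d c : ℕ) (M D : Set E) (leaf : E → Set E) : Prop where
  isOpen : IsOpen D
  subset : M ⊆ D
  /-- The leaves partition `D`. -/
  iUnion_eq : ⋃ p ∈ M, leaf p = D
  disjoint : ∀ p ∈ M, ∀ q ∈ M, p ≠ q → Disjoint (leaf p) (leaf q)
  /-- The leaves are connected submanifolds of dimension `c`, i.e. of codimension `d`. -/
  connected : ∀ p ∈ M, IsConnected (leaf p)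
  submanifold : ∀ p ∈ M, IsSubmanifold r d (leaf p)
  /-- The leaves are locally the fibres of `C^r` submersions to `ℝ^d` (foliation charts): each
  leaf is, in a neighbourhood of any point of `D`, a union of such fibres. -/
  chart : ∀ x ∈ D, ∃ (W : Set E) (s : E → Eucl d), IsOpen W ∧ x ∈ W ∧ W ⊆ D ∧
    ContDiffOn ℝ (r : WithTop ℕ∞) s W ∧
    (∀ y ∈ W, Function.Surjective (fderiv ℝ s y)) ∧
    ∀ y ∈ W, ∀ z ∈ W, s y = s z → ∀ p ∈ M, y ∈ leaf p → z ∈ leaf p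
  /-- The leaf of `p` meets `M` orthogonally at `p`. -/
  mem_leaf : ∀ p ∈ M, p ∈ leaf p
  orthogonal : ∀ p ∈ M, tangentSpaceAt (leaf p) p = (tangentSpaceAt M p)ᗮ

/-- `P` is the canonical projection `D → M` of the partition: `x ∈ leaf (P x)`. -/
def IsCanonicalProjection (M D : Set E) (leaf : E → Set E) (P : E → E) : Prop :=
  ∀ x ∈ D, P x ∈ M ∧ x ∈ leaf (P x)

end Submanifolds

section Newton

variable {n c : ℕ}

/-- The four Penrose equations: `B` is the Moore-Penrose inverse of `A`. -/
structure IsMoorePenrose (A : Eucl n →L[ℝ] Eucl c) (B : Eucl c →L[ℝ] Eucl n) : Prop where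
  aba : A ∘L B ∘L A = A
  bab : B ∘L A ∘L B = B
  ab_selfAdjoint : ContinuousLinearMap.adjoint (A ∘L B) = A ∘L B
  ba_selfAdjoint : ContinuousLinearMap.adjoint (B ∘L A) = B ∘L A

open Classical in
/-- The Moore-Penrose inverse (which always exists and is unique). -/
def moorePenrose (A : Eucl n →L[ℝ] Eucl c) : Eucl c →L[ℝ] Eucl n :=
  if h : ∃ B, IsMoorePenrose A B then h.choose else 0

/-- The zero set of `F`. -/
def zeroSet (F : Eucl n → Eucl c) : Set (Eucl n) := {x | F x = 0}

/-- The Newton map `N_F(x) = x - J(x)† F(x)`. -/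
def newtonMap (F : Eucl n → Eucl c) (x : Eucl n) : Eucl n :=
  x - moorePenrose (fderiv ℝ F x) (F x)

/-- The Newton limit map: the limit of the iterates of the Newton map (a dummy value where they
do not converge). -/
def newtonLimit (F : Eucl n → Eucl c) (x : Eucl n) : Eucl n :=
  limUnder atTop (fun m : ℕ => (newtonMap F)^[m] x)

/-- `D` is an open neighbourhood of `M = F⁻¹(0)` on which the Newton limit map is defined, as a
`C^r` map `D → M`. -/
structure IsNewtonDomain (r : ℕ∞) (F : Eucl n → Eucl c) (D : Set (Eucl n)) : Prop where
  isOpen : IsOpen D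
  subset : zeroSet F ⊆ D
  tendsto : ∀ x ∈ D, Tendsto (fun m : ℕ => (newtonMap F)^[m] x) atTop (𝓝 (newtonLimit F x))
  mapsTo : MapsTo (newtonLimit F) D (zeroSet F)
  contDiffOn : ContDiffOn ℝ (r : WithTop ℕ∞) (newtonLimit F) D

/-- The set of points of `D` that Newton's method takes to `p`. -/
def newtonLeaf (F : Eucl n → Eucl c) (D : Set (Eucl n)) (p : Eucl n) : Set (Eucl n) :=
  {x ∈ D | newtonLimit F x = p}

/-- Newton retraction `R_N(x, v) = N_F^∞(x + v)`. -/
def newtonRetraction (F : Eucl n → Eucl c) : Eucl n × Eucl n → Eucl n :=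
  inducedRetraction (newtonLimit F)

/-- The constraint function `‖x‖² - 1` of the unit circle in the plane. -/
def circleConstraint (x : Eucl 2) : Eucl 1 := !₂[‖x‖ ^ 2 - 1]

end Newton

end SubmanifoldRetraction

end

open SubmanifoldRetraction

/-! The heart is a statement about a `C²` map `P : D → M` that fixes `M` pointwise and whose
derivative at each `p ∈ M` kills the normal vectors (`IsNormalProjection`). If `γ` is a geodesic of
`M`, then `P ∘ γ = γ`; differentiating twice gives `γ'' = D²P(γ)(γ', γ') + DP(γ) γ''`, and the last
term vanishes because `γ''` is normal. The curve `s ↦ P(x + s w)` has second derivative `D²P(x + s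
w)(w, w)`. For tangent `w` both curves start at `x` with velocity `w`, and their second derivatives
differ by `o(‖w‖²)` since `D²P` is continuous and `γ'` stays close to `w`. Integrating twice gives
order 2 in the ambient norm (`norm_exp_sub_le`). The Riemannian distance is locally at most a
multiple of the ambient one, because `P` maps segments to paths in `M` (`riemannianDist_le`).

It remains to produce such maps `P`. For a normal foliation the issue is the smoothness of the
canonical projection. At `p ∈ M` a foliation chart and a defining function of `M` together are local
coordinates, by orthogonality, and express `P` smoothly; elsewhere smoothness is carried along the
connected leaf from plaque to plaque (`contDiffOn_projection`).

For Newton's method, the identity `J J† = 1` gives `F(N x) = B(x) F(x)` with `B = 0` on the zero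
set, so `F` decays geometrically and the iterates converge locally uniformly. The tangent map of `N`
is an iteration of the same form on the tangent bundle; induction on the order therefore makes all
derivatives converge (`contDiffAt_limit_iterate`). The limit map kills normal vectors since `N^∞ ∘ N
= N^∞` and `DN(p)` is the orthogonal projection onto the tangent space. Its fibres form a foliation
near `M` by the inverse function theorem (`exists_foliationChart`).

On the circle Newton's method preserves rays and runs Heron's iteration for `√1` on the radius, so
the limit is `x / ‖x‖`. With `τ = t‖v‖`, the components along `v / ‖v‖` of the exponential map and
of the retraction are `sin τ` and `τ / √(1 + τ²)`, which differ by `τ³/3 + o(τ³)`. -/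

namespace SubmanifoldRetraction

/-! ### The right inverse of a surjection and its smooth dependence on the map. -/

section PseudoInverse

variable {E V : Type*} [NormedAddCommGroup E] [InnerProductSpace ℝ E] [CompleteSpace E]
  [NormedAddCommGroup V] [InnerProductSpace ℝ V] [CompleteSpace V]

/-- The right inverse `A* (A A*)⁻¹` of a surjective linear map `A`. -/
noncomputable def rightPinv (A : E →L[ℝ] V) : V →L[ℝ] E :=
  ContinuousLinearMap.adjoint A ∘L (A ∘L ContinuousLinearMap.adjoint A).inverse

theorem rightPinv_mem_orthogonal (A : E →L[ℝ] V) (v : V) :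
    rightPinv A v ∈ (LinearMap.ker (A : E →ₗ[ℝ] V))ᗮ := by
  rw [Submodule.mem_orthogonal]
  intro u hu
  have hu : A u = 0 := hu
  simp [rightPinv, ContinuousLinearMap.adjoint_inner_right, hu]

variable [FiniteDimensional ℝ V]

/-- If `A A* v = 0`, then `‖A* v‖² = 0`; writing `v = A x` gives `‖v‖² = ⟨A* v, x⟩ = 0`. An
injective endomorphism of a finite-dimensional space is bijective. -/
theorem isInvertible_comp_adjoint {A : E →L[ℝ] V} (hA : Function.Surjective A) :
    (A ∘L ContinuousLinearMap.adjoint A).IsInvertible := by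
  have hinj : Function.Injective (A ∘L ContinuousLinearMap.adjoint A) := by
    rw [injective_iff_map_eq_zero]
    intro v hv
    have h1 : inner ℝ (ContinuousLinearMap.adjoint A v) (ContinuousLinearMap.adjoint A v) = 0 := by
      rw [ContinuousLinearMap.adjoint_inner_left]
      simp only [ContinuousLinearMap.comp_apply] at hv
      rw [hv, inner_zero_right]
    have h2 : ContinuousLinearMap.adjoint A v = 0 := inner_self_eq_zero.mp h1
    obtain ⟨x, rfl⟩ := hA v
    rw [← inner_self_eq_zero (𝕜 := ℝ), ← ContinuousLinearMap.adjoint_inner_left, h2, inner_zero_left]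
  have hsurj : Function.Surjective (A ∘L ContinuousLinearMap.adjoint A) :=
    (LinearMap.injective_iff_surjective
      (f := ((A ∘L ContinuousLinearMap.adjoint A : V →L[ℝ] V) : V →ₗ[ℝ] V))).1 hinj
  exact ⟨(LinearEquiv.ofBijective
    ((A ∘L ContinuousLinearMap.adjoint A : V →L[ℝ] V) : V →ₗ[ℝ] V)
      ⟨hinj, hsurj⟩).toContinuousLinearEquiv, by ext; rfl⟩

theorem comp_rightPinv {A : E →L[ℝ] V} (hA : Function.Surjective A) :
    A ∘L rightPinv A = ContinuousLinearMap.id ℝ V := by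
  obtain ⟨e, he⟩ := isInvertible_comp_adjoint hA
  ext v
  have : (A ∘L ContinuousLinearMap.adjoint A)
      ((A ∘L ContinuousLinearMap.adjoint A).inverse v) = v := by
    rw [← he, ContinuousLinearMap.inverse_equiv]; simp
  simpa [rightPinv] using this

theorem apply_rightPinv {A : E →L[ℝ] V} (hA : Function.Surjective A) (v : V) :
    A (rightPinv A v) = v := by
  simpa using DFunLike.congr_fun (comp_rightPinv hA) v

theorem rightPinv_apply_of_mem_orthogonal {A : E →L[ℝ] V} (hA : Function.Surjective A) {w : E}
    (hw : w ∈ (LinearMap.ker (A : E →ₗ[ℝ] V))ᗮ) : rightPinv A (A w) = w := by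
  have h1 : rightPinv A (A w) - w ∈ (LinearMap.ker (A : E →ₗ[ℝ] V))ᗮ :=
    Submodule.sub_mem _ (rightPinv_mem_orthogonal A _) hw
  have h2 : rightPinv A (A w) - w ∈ LinearMap.ker (A : E →ₗ[ℝ] V) := by
    simp [apply_rightPinv hA]
  have := (Submodule.mem_orthogonal _ _).1 h1 _ h2
  exact sub_eq_zero.1 (inner_self_eq_zero.mp this)

theorem contDiffAt_rightPinv {A : E →L[ℝ] V} (hA : Function.Surjective A) {n : WithTop ℕ∞} :
    ContDiffAt ℝ n (rightPinv : (E →L[ℝ] V) → V →L[ℝ] E) A := by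
  have hadj : ContDiff ℝ n (fun A : E →L[ℝ] V => ContinuousLinearMap.adjoint A) := by
    have : IsBoundedLinearMap ℝ (fun A : E →L[ℝ] V => ContinuousLinearMap.adjoint A) :=
      IsLinearMap.with_bound ⟨fun x y => map_add _ x y, fun c x => by simp⟩ 1
        (fun x => by simp)
    exact this.contDiff
  obtain ⟨e, he⟩ := isInvertible_comp_adjoint hA
  have hinv : ContDiffAt ℝ n (ContinuousLinearMap.inverse : (V →L[ℝ] V) → V →L[ℝ] V)
      (A ∘L ContinuousLinearMap.adjoint A) := by
    rw [← he]; exact contDiffAt_map_inverse e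
  have h2 : ContDiffAt ℝ n (fun A : E →L[ℝ] V => A ∘L ContinuousLinearMap.adjoint A) A :=
    contDiffAt_id.clm_comp hadj.contDiffAt
  exact hadj.contDiffAt.clm_comp (ContDiffAt.comp A (g := ContinuousLinearMap.inverse) hinv h2)

/-- For `B` near `A` the composite of `B` with the right inverse of `A` is near the identity, hence
a unit, and this yields a right inverse of `B`. -/
theorem isOpen_surjective : IsOpen {A : E →L[ℝ] V | Function.Surjective A} := by
  rw [isOpen_iff_mem_nhds]
  intro A hA
  have h1 : ContinuousAt (fun B : E →L[ℝ] V => B ∘L rightPinv A) A := by fun_prop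
  have h2 : {C : V →L[ℝ] V | IsUnit C} ∈ 𝓝 (A ∘L rightPinv A) := by
    rw [comp_rightPinv hA]
    exact Units.isOpen.mem_nhds isUnit_one
  filter_upwards [h1 h2] with B hB v
  obtain ⟨u, hu⟩ := hB
  refine ⟨rightPinv A ((↑u⁻¹ : V →L[ℝ] V) v), ?_⟩
  have : (B ∘L rightPinv A) ((↑u⁻¹ : V →L[ℝ] V) v) = v := by
    change (fun B => B ∘L rightPinv A) B _ = v
    rw [← hu, ← mul_apply_eq_comp, Units.mul_inv]; rfl
  simpa using this

end PseudoInverse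

/-! ### For surjective maps the Moore–Penrose inverse is the right inverse above. -/

section MoorePenrose

variable {n c : ℕ}

theorem IsMoorePenrose.unique {A : Eucl n →L[ℝ] Eucl c} {B C : Eucl c →L[ℝ] Eucl n}
    (hB : IsMoorePenrose A B) (hC : IsMoorePenrose A C) : B = C := by
  have h1 : A ∘L B = A ∘L C := by
    calc A ∘L B = (A ∘L C ∘L A) ∘L B := by rw [hC.aba]
      _ = (A ∘L C) ∘L (A ∘L B) := rfl
      _ = ContinuousLinearMap.adjoint (A ∘L C) ∘L ContinuousLinearMap.adjoint (A ∘L B) := by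
          rw [hB.ab_selfAdjoint, hC.ab_selfAdjoint]
      _ = ContinuousLinearMap.adjoint ((A ∘L B ∘L A) ∘L C) := by
          rw [← ContinuousLinearMap.adjoint_comp]; rfl
      _ = A ∘L C := by rw [hB.aba, hC.ab_selfAdjoint]
  have h2 : B ∘L A = C ∘L A := by
    calc B ∘L A = B ∘L (A ∘L C ∘L A) := by rw [hC.aba]
      _ = (B ∘L A) ∘L (C ∘L A) := rfl
      _ = ContinuousLinearMap.adjoint (B ∘L A) ∘L ContinuousLinearMap.adjoint (C ∘L A) := by
          rw [hB.ba_selfAdjoint, hC.ba_selfAdjoint]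
      _ = ContinuousLinearMap.adjoint (C ∘L (A ∘L B ∘L A)) := by
          rw [← ContinuousLinearMap.adjoint_comp]; rfl
      _ = C ∘L A := by rw [hB.aba, hC.ba_selfAdjoint]
  calc B = B ∘L A ∘L B := hB.bab.symm
    _ = B ∘L (A ∘L C) := by rw [h1]
    _ = (B ∘L A) ∘L C := rfl
    _ = (C ∘L A) ∘L C := by rw [h2]
    _ = C := hC.bab

theorem isMoorePenrose_rightPinv {A : Eucl n →L[ℝ] Eucl c} (hA : Function.Surjective A) :
    IsMoorePenrose A (rightPinv A) := by
  have h := comp_rightPinv hA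
  refine ⟨?_, ?_, ?_, ?_⟩
  · rw [← ContinuousLinearMap.comp_assoc, h, ContinuousLinearMap.id_comp]
  · rw [h, ContinuousLinearMap.comp_id]
  · rw [h]; exact ContinuousLinearMap.adjoint_id
  · refine ((ContinuousLinearMap.eq_adjoint_iff _ _).2 fun x y => ?_).symm
    have hx : ∀ x y, inner ℝ (rightPinv A (A x)) y = inner ℝ (rightPinv A (A x)) (rightPinv A (A y)) := by
      intro x y
      rw [← sub_eq_zero, ← inner_sub_right]
      refine (Submodule.mem_orthogonal' _ _).1 (rightPinv_mem_orthogonal A (A x)) _ ?_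
      simp [apply_rightPinv hA]
    simp only [ContinuousLinearMap.comp_apply]
    rw [hx, real_inner_comm, ← hx, real_inner_comm]

theorem moorePenrose_eq_rightPinv {A : Eucl n →L[ℝ] Eucl c} (hA : Function.Surjective A) :
    moorePenrose A = rightPinv A := by
  have h : ∃ B, IsMoorePenrose A B := ⟨_, isMoorePenrose_rightPinv hA⟩
  rw [moorePenrose, dif_pos h]
  exact h.choose_spec.unique (isMoorePenrose_rightPinv hA)

end MoorePenrose

/-! ### Tangent spaces and how derivatives act on them. -/

section Tangent

variable {E V : Type*} [NormedAddCommGroup E] [InnerProductSpace ℝ E]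
  [NormedAddCommGroup V] [NormedSpace ℝ V]

theorem velocity_mem_tangentSpaceAt {S : Set E} {γ : ℝ → E} {s : ℝ} {v : E}
    (hS : ∀ᶠ t in 𝓝 s, γ t ∈ S) (hv : HasDerivAt γ v s) : v ∈ tangentSpaceAt S (γ s) := by
  refine Submodule.subset_span ⟨fun t => γ (s + t), ?_, by simp, ?_⟩
  · have : Tendsto (fun t : ℝ => s + t) (𝓝 0) (𝓝 s) := by
      simpa using (continuous_const.add continuous_id).tendsto (x := (0 : ℝ)) (f := fun t => s + t)
    exact this.eventually hS
  · have := HasDerivAt.comp_const_add (x := (0 : ℝ)) s (f := γ) (f' := v) (by simpa using hv)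
    simpa using this

/-- A map that is constant on `S` near `p` has a derivative that kills the tangent vectors. -/
theorem apply_eq_zero_of_mem_tangentSpaceAt {S : Set E} {p v : E} {f : E → V} {f' : E →L[ℝ] V}
    (hf : HasFDerivAt f f' p) (hc : ∀ᶠ y in 𝓝 p, y ∈ S → f y = f p)
    (hv : v ∈ tangentSpaceAt S p) : f' v = 0 := by
  suffices tangentSpaceAt S p ≤ LinearMap.ker (f' : E →ₗ[ℝ] V) from this hv
  refine Submodule.span_le.2 ?_
  rintro w ⟨γ, hγ, h0, hd⟩
  have h1 : HasDerivAt (f ∘ γ) (f' w) 0 := by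
    subst h0; exact hf.comp_hasDerivAt 0 hd
  have h2 : f ∘ γ =ᶠ[𝓝 0] fun _ => f p := by
    have : Tendsto γ (𝓝 0) (𝓝 p) := by simpa [h0] using hd.continuousAt.tendsto
    filter_upwards [hγ, this.eventually hc] with t ht ht'
    exact ht' ht
  exact h1.unique ((hasDerivAt_const (0 : ℝ) (f p)).congr_of_eventuallyEq h2)

/-- A map that is the identity on `S` near `p` has a derivative that fixes the tangent vectors. -/
theorem apply_eq_self_of_mem_tangentSpaceAt {S : Set E} {p v : E} {f : E → E} {f' : E →L[ℝ] E}
    (hf : HasFDerivAt f f' p) (hc : ∀ᶠ y in 𝓝 p, y ∈ S → f y = y) (hp : p ∈ S)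
    (hv : v ∈ tangentSpaceAt S p) : f' v = v := by
  have h := apply_eq_zero_of_mem_tangentSpaceAt (f := fun y => f y - y)
    (f' := f' - ContinuousLinearMap.id ℝ E) (hf.sub (hasFDerivAt_id p))
    (hc.mono fun y hy hS => by rw [hy hS, hc.self_of_nhds hp, sub_self, sub_self]) hv
  simpa [sub_eq_zero] using h

variable [CompleteSpace E]

/-- The implicit function theorem realizes each kernel vector as the velocity of a curve in the
level set; hence the span in the definition of the tangent space adds nothing. -/
theorem tangentSpaceAt_eq_ker [FiniteDimensional ℝ V] {S : Set E} {p : E} {G : E → V} {G' : E →L[ℝ] V}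
    (hG : HasStrictFDerivAt G G' p) (hs : Function.Surjective G')
    (hS : ∀ᶠ y in 𝓝 p, (y ∈ S ↔ G y = G p)) :
    tangentSpaceAt S p = LinearMap.ker (G' : E →ₗ[ℝ] V) := by
  refine le_antisymm (fun v hv => apply_eq_zero_of_mem_tangentSpaceAt hG.hasFDerivAt
    (hS.mono fun y hy => hy.1) hv) fun v hv => ?_
  have hr : (G' : E →ₗ[ℝ] V).range = ⊤ := LinearMap.range_eq_top.2 hs
  set φ := HasStrictFDerivAt.implicitFunction G G' hG hr (G p) with hφ
  have hφ' := HasStrictFDerivAt.to_implicitFunction hG hr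
  have hφ0 : φ 0 = p := by
    exact HasStrictFDerivAt.implicitFunction_apply_image hG hr
  let w : LinearMap.ker (G' : E →ₗ[ℝ] V) := ⟨v, hv⟩
  have hd : HasDerivAt (fun t : ℝ => t • w) w 0 := by
    simpa using (hasDerivAt_id (0 : ℝ)).smul_const w
  have h1 : HasDerivAt (fun t : ℝ => φ (t • w)) v 0 := by
    have := HasFDerivAt.comp_hasDerivAt (f := fun t : ℝ => t • w) (l := φ) 0
      (by simpa using hφ'.hasFDerivAt) hd
    exact this
  have h0 : φ ((0 : ℝ) • w) = p := by rw [zero_smul]; exact hφ0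
  refine Submodule.subset_span ⟨fun t => φ (t • w), ?_, h0, h1⟩
  have ht : Tendsto (fun t : ℝ => φ (t • w)) (𝓝 0) (𝓝 p) := by
    simpa [hφ0] using h1.continuousAt.tendsto
  have ht2 : Tendsto (fun t : ℝ => (G p, t • w)) (𝓝 0) (𝓝 (G p, 0)) := by
    have : ContinuousAt (fun t : ℝ => (G p, t • w)) 0 := by fun_prop
    simpa [ContinuousAt] using this
  filter_upwards [ht.eventually hS,
    ht2.eventually (HasStrictFDerivAt.map_implicitFunction_eq hG hr)] with t h1 h2
  exact h1.2 h2

theorem tangentSpaceAt_eq_ker_fderiv {k : ℕ∞} {c : ℕ} {S W : Set E} {G : E → Eucl c}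
    (hW : IsOpen W) (hG : ContDiffOn ℝ (k : WithTop ℕ∞) G W) (hk : 1 ≤ k)
    (hs : ∀ y ∈ W, Function.Surjective (fderiv ℝ G y)) (hS : S ∩ W = {y ∈ W | G y = 0})
    {p : E} (hp : p ∈ S) (hpW : p ∈ W) :
    tangentSpaceAt S p = LinearMap.ker (fderiv ℝ G p : E →ₗ[ℝ] Eucl c) := by
  have hp0 : G p = 0 := (hS.subset ⟨hp, hpW⟩ : p ∈ {y ∈ W | G y = 0}).2
  refine tangentSpaceAt_eq_ker (((hG.contDiffAt (hW.mem_nhds hpW)).hasStrictFDerivAt ?_)) (hs p hpW) ?_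
  · intro h
    have : k = 0 := by exact_mod_cast h
    simp [this] at hk
  · filter_upwards [hW.mem_nhds hpW] with y hy
    have := Set.ext_iff.1 hS y
    simp only [mem_inter_iff, hy, and_true, mem_ofPred_eq, true_and] at this
    rw [this, hp0]

end Tangent

/-! ### Geodesics: constant speed, local existence and the domain of the exponential map. -/

section Geodesics

variable {E : Type*} [NormedAddCommGroup E] [InnerProductSpace ℝ E]

theorem IsGeodesicOn.hasDerivAt {S : Set E} {γ : ℝ → E} {a b s : ℝ} (h : IsGeodesicOn S γ a b)
    (hs : s ∈ Ioo a b) : HasDerivAt γ (deriv γ s) s :=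
  ((h.contDiffOn.contDiffAt (isOpen_Ioo.mem_nhds hs)).differentiableAt (by simp)).hasDerivAt

theorem IsGeodesicOn.hasDerivAt_deriv {S : Set E} {γ : ℝ → E} {a b s : ℝ}
    (h : IsGeodesicOn S γ a b) (hs : s ∈ Ioo a b) :
    HasDerivAt (deriv γ) (deriv (deriv γ) s) s := by
  have h1 := ((contDiffOn_succ_iff_deriv_of_isOpen (n := 1) isOpen_Ioo).1
    (by simpa [one_add_one_eq_two] using h.contDiffOn)).2.2
  exact ((h1.contDiffAt (isOpen_Ioo.mem_nhds hs)).differentiableAt (by simp)).hasDerivAt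

theorem IsGeodesicOn.deriv_mem {S : Set E} {γ : ℝ → E} {a b s : ℝ}
    (h : IsGeodesicOn S γ a b) (hs : s ∈ Ioo a b) : deriv γ s ∈ tangentSpaceAt S (γ s) :=
  velocity_mem_tangentSpaceAt (eventually_of_mem (isOpen_Ioo.mem_nhds hs) h.mem) (h.hasDerivAt hs)

/-- Geodesics have constant speed. -/
theorem IsGeodesicOn.norm_deriv_eq {S : Set E} {γ : ℝ → E} {a b s t : ℝ}
    (h : IsGeodesicOn S γ a b) (hs : s ∈ Ioo a b) (ht : t ∈ Ioo a b) :
    ‖deriv γ s‖ = ‖deriv γ t‖ := by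
  have hd : ∀ u ∈ Ioo a b, HasDerivAt (fun u => ‖deriv γ u‖ ^ 2) 0 u := by
    intro u hu
    have h1 := (h.hasDerivAt_deriv hu).norm_sq
    rwa [(Submodule.mem_orthogonal _ _).1 (h.acceleration u hu) _ (h.deriv_mem hu), mul_zero] at h1
  have h2 := isOpen_Ioo.is_const_of_deriv_eq_zero isPreconnected_Ioo
    (fun u hu => (hd u hu).differentiableAt.differentiableWithinAt)
    (fun u hu => (hd u hu).deriv) hs ht
  exact (sq_eq_sq₀ (norm_nonneg _) (norm_nonneg _)).1 h2

variable [CompleteSpace E]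

/-- The geodesic equation in the ambient space is `γ'' = -J† D²G(γ)(γ', γ')`: the right-hand side is
normal, and it is the choice for which `(G ∘ γ)'' = 0`. The initial data give `(G ∘ γ)' = 0` and `G
∘ γ = 0` at time `0`, so the solution stays in `S`. Since `G` is `C³`, the vector field is `C¹` and
Picard–Lindelöf applies. -/
theorem exists_isGeodesicOn {k : ℕ∞} {c : ℕ} {S : Set E} (hk : 3 ≤ k) (hS : IsSubmanifold k c S)
    {x v : E} (hx : x ∈ S) (hv : v ∈ tangentSpaceAt S x) :
    ∃ ε > 0, ∃ γ : ℝ → E, IsGeodesicOn S γ (-ε) ε ∧ γ 0 = x ∧ deriv γ 0 = v := by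
  obtain ⟨W, G, hW, hxW, hG, hsurj, hSW⟩ := hS x hx
  have hk1 : (1 : ℕ∞) ≤ k := le_trans (by norm_num) hk
  have hT : ∀ p ∈ S, p ∈ W → tangentSpaceAt S p = LinearMap.ker (fderiv ℝ G p : E →ₗ[ℝ] Eucl c) :=
    fun p hp hpW => tangentSpaceAt_eq_ker_fderiv hW hG hk1 hsurj hSW hp hpW
  have hG3 : ∀ y ∈ W, ContDiffAt ℝ 3 G y := fun y hy =>
    (hG.contDiffAt (hW.mem_nhds hy)).of_le
      (show ((3 : ℕ∞) : WithTop ℕ∞) ≤ k from WithTop.coe_le_coe.2 hk)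
  have hG2 : ∀ y ∈ W, ContDiffAt ℝ 2 (fderiv ℝ G) y := fun y hy =>
    (hG3 y hy).fderiv_right (by norm_num)
  have hG1 : ∀ y ∈ W, ContDiffAt ℝ 1 (fderiv ℝ (fderiv ℝ G)) y := fun y hy =>
    (hG2 y hy).fderiv_right (by norm_num)
  let f : E × E → E × E := fun z =>
    (z.2, -(rightPinv (fderiv ℝ G z.1) (fderiv ℝ (fderiv ℝ G) z.1 z.2 z.2)))
  have hf : ∀ z : E × E, z.1 ∈ W → ContDiffAt ℝ 1 f z := by
    intro z hz
    have hfst : ContDiffAt ℝ 1 (fun z : E × E => z.1) z := contDiffAt_fst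
    have hsnd : ContDiffAt ℝ 1 (fun z : E × E => z.2) z := contDiffAt_snd
    have h1 : ContDiffAt ℝ 1 (fun z : E × E => rightPinv (fderiv ℝ G z.1)) z :=
      ContDiffAt.comp (g := rightPinv) z (contDiffAt_rightPinv (hsurj _ hz))
        (ContDiffAt.comp (g := fderiv ℝ G) z ((hG2 _ hz).of_le (by norm_num)) hfst)
    have h2 : ContDiffAt ℝ 1 (fun z : E × E => fderiv ℝ (fderiv ℝ G) z.1) z :=
      ContDiffAt.comp (g := fderiv ℝ (fderiv ℝ G)) z (hG1 _ hz) hfst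
    exact hsnd.prodMk ((h1.clm_apply ((h2.clm_apply hsnd).clm_apply hsnd)).neg)
  obtain ⟨r, hr, ε₀, hε₀, hα⟩ :=
    (hf (x, v) hxW).exists_forall_mem_closedBall_exists_eq_forall_mem_Ioo_hasDerivAt 0
  obtain ⟨α, hα0, hα⟩ := hα (x, v) (Metric.mem_closedBall_self hr.le)
  have hcont : ContinuousAt (fun t => (α t).1) 0 :=
    (hα 0 (by simp [hε₀])).continuousAt.fst
  have hnear : ∀ᶠ t in 𝓝 (0 : ℝ), (α t).1 ∈ W ∧ t ∈ Ioo (0 - ε₀) (0 + ε₀) :=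
    (hcont.eventually (hW.eventually_mem (by simpa [hα0] using hxW))).and
      (isOpen_Ioo.eventually_mem (by simp [hε₀]))
  obtain ⟨ε, hε, hball⟩ := Metric.eventually_nhds_iff_ball.1 hnear
  have hI : Metric.ball (0 : ℝ) ε = Ioo (-ε) ε := by simp [Real.ball_eq_Ioo]
  rw [hI] at hball
  have hd : ∀ t ∈ Ioo (-ε) ε, HasDerivAt α (f (α t)) t := fun t ht => hα t (hball t ht).2
  have hd1 : ∀ t ∈ Ioo (-ε) ε, HasDerivAt (fun t => (α t).1) (α t).2 t := fun t ht => (hd t ht).fst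
  have hd2 : ∀ t ∈ Ioo (-ε) ε, HasDerivAt (fun t => (α t).2)
      (-(rightPinv (fderiv ℝ G (α t).1) (fderiv ℝ (fderiv ℝ G) (α t).1 (α t).2 (α t).2))) t :=
    fun t ht => (hd t ht).snd
  have h0 : (0 : ℝ) ∈ Ioo (-ε) ε := by simp [hε]
  have hdG1 : ∀ t ∈ Ioo (-ε) ε, HasDerivAt (fun t => G (α t).1) (fderiv ℝ G (α t).1 (α t).2) t :=
    fun t ht => ((hG3 _ (hball t ht).1).differentiableAt (by simp)).hasFDerivAt.comp_hasDerivAt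
      t (hd1 t ht)
  have hdG2 : ∀ t ∈ Ioo (-ε) ε, HasDerivAt (fun t => fderiv ℝ G (α t).1 (α t).2) 0 t := by
    intro t ht
    have h1 : HasDerivAt (fun t => fderiv ℝ G (α t).1) (fderiv ℝ (fderiv ℝ G) (α t).1 (α t).2) t :=
      ((hG2 _ (hball t ht).1).differentiableAt (by simp)).hasFDerivAt.comp_hasDerivAt t (hd1 t ht)
    have h2 := h1.clm_apply (hd2 t ht)
    simpa [apply_rightPinv (hsurj _ (hball t ht).1)] using h2
  have hc1 : ∀ t ∈ Ioo (-ε) ε, fderiv ℝ G (α t).1 (α t).2 = 0 := by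
    intro t ht
    rw [isOpen_Ioo.is_const_of_deriv_eq_zero isPreconnected_Ioo
      (fun u hu => (hdG2 u hu).differentiableAt.differentiableWithinAt)
      (fun u hu => (hdG2 u hu).deriv) ht h0, hα0]
    rw [hT x hx hxW] at hv
    exact hv
  have hc0 : ∀ t ∈ Ioo (-ε) ε, G (α t).1 = 0 := by
    intro t ht
    rw [isOpen_Ioo.is_const_of_deriv_eq_zero isPreconnected_Ioo
      (fun u hu => (hdG1 u hu).differentiableAt.differentiableWithinAt)
      (fun u hu => (hdG1 u hu).deriv.trans (hc1 u hu)) ht h0, hα0]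
    exact (hSW.subset ⟨hx, hxW⟩ : x ∈ {y ∈ W | G y = 0}).2
  have hmem : ∀ t ∈ Ioo (-ε) ε, (α t).1 ∈ S := fun t ht =>
    (hSW.superset (show (α t).1 ∈ {y ∈ W | G y = 0} from ⟨(hball t ht).1, hc0 t ht⟩)).1
  have hderiv : EqOn (deriv fun t => (α t).1) (fun t => (α t).2) (Ioo (-ε) ε) :=
    fun t ht => (hd1 t ht).deriv
  have hα1 : ContDiffOn ℝ 1 α (Ioo (-ε) ε) := by
    rw [show (1 : WithTop ℕ∞) = 0 + 1 from rfl, contDiffOn_succ_iff_deriv_of_isOpen isOpen_Ioo]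
    refine ⟨fun t ht => (hd t ht).differentiableAt.differentiableWithinAt, by simp, ?_⟩
    rw [contDiffOn_zero]
    refine ContinuousOn.congr (f := fun t => f (α t)) (fun t ht => ?_) (fun t ht => (hd t ht).deriv)
    exact (ContinuousAt.comp (g := f) (hf _ (hball t ht).1).continuousAt
      (hd t ht).continuousAt).continuousWithinAt
  refine ⟨ε, hε, fun t => (α t).1, ⟨?_, hmem, fun t ht => ?_⟩, by simp [hα0], ?_⟩
  · rw [show (2 : WithTop ℕ∞) = 1 + 1 from (one_add_one_eq_two).symm,
      contDiffOn_succ_iff_deriv_of_isOpen isOpen_Ioo]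
    exact ⟨fun t ht => (hd1 t ht).differentiableAt.differentiableWithinAt, by simp,
      hα1.snd.congr hderiv⟩
  · have h1 : deriv (deriv fun t => (α t).1) t = deriv (fun t => (α t).2) t :=
      (hderiv.eventuallyEq_of_mem (isOpen_Ioo.mem_nhds ht)).deriv_eq
    rw [h1, (hd2 t ht).deriv, hT _ (hmem t ht) (hball t ht).1]
    exact Submodule.neg_mem _ (rightPinv_mem_orthogonal _ _)
  · rw [hderiv h0]; simp [hα0]

theorem eventually_mem_expDomain {k : ℕ∞} {c : ℕ} {S : Set E} (hk : 3 ≤ k)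
    (hS : IsSubmanifold k c S) {x v : E} (hx : x ∈ S) (hv : v ∈ tangentSpaceAt S x) :
    ∀ᶠ t in 𝓝 (0 : ℝ), (x, t • v) ∈ expDomain S := by
  obtain ⟨ε, hε, γ, hγ, h0, h1⟩ := exists_isGeodesicOn hk hS hx hv
  filter_upwards [Metric.ball_mem_nhds (0 : ℝ) (half_pos hε)] with t ht
  rw [mem_ball_zero_iff, Real.norm_eq_abs] at ht
  have hmaps : ∀ s ∈ Ioo (-2 : ℝ) 2, t * s ∈ Ioo (-ε) ε := by
    intro s hs
    -- Since `|t| < ε / 2`, the reparametrized geodesic `s ↦ γ (t s)` lives on `(-2, 2)`, which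
    -- contains the time `1`.
    rw [mem_Ioo, ← abs_lt] at hs ⊢
    rw [abs_mul]
    nlinarith [abs_nonneg t, abs_nonneg s]
  have hd : ∀ s, deriv (fun s => γ (t * s)) s = t • deriv γ (t * s) := deriv_comp_mul_left t γ
  refine ⟨⟨hx, Submodule.smul_mem _ _ hv⟩, γ t, fun s => γ (t * s), -2, 2, by norm_num, by norm_num,
    ⟨?_, fun s hs => hγ.mem _ (hmaps s hs), fun s hs => ?_⟩, by simp [h0], by simp [hd, h1], by simp⟩
  · exact hγ.contDiffOn.comp (by fun_prop) hmaps
  · have h2 : deriv (deriv fun s => γ (t * s)) s = t • t • deriv (deriv γ) (t * s) := by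
      rw [funext hd]
      have := deriv_comp_mul_left t (deriv γ) s
      rw [deriv_fun_const_smul_field, this]
    rw [h2]
    exact Submodule.smul_mem _ _ (Submodule.smul_mem _ _ (hγ.acceleration _ (hmaps s hs)))

omit [CompleteSpace E] in
theorem isExp_expMap {S : Set E} {z : E × E} (hz : z ∈ expDomain S) :
    IsExp S z.1 z.2 (expMap S z) := by
  rw [expMap, dif_pos hz.2]
  exact hz.2.choose_spec

end Geodesics

/-! ### Normal projections agree with the exponential map to second order. -/

section Projection

variable {E : Type*} [NormedAddCommGroup E] [InnerProductSpace ℝ E]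

/-- Used with `A`, `B` the second derivatives of the projection at two points near `x`, `C` the one
at `x`, and `g` the velocity of a geodesic that starts with velocity `w`; the constant speed
supplies the equality of norms. -/
theorem norm_bilin_sub_le {A B : E →L[ℝ] E →L[ℝ] E} (C : E →L[ℝ] E →L[ℝ] E) {g w : E}
    (hg : ‖g‖ = ‖w‖) : ‖A g g - B w w‖ ≤
      (‖A - C‖ + ‖B - C‖) * ‖w‖ ^ 2 + 2 * (‖C‖ * ‖g - w‖ * ‖w‖) := by
  have e : A g g - B w w = (A - C) g g - (B - C) w w + (C (g - w) g + C w (g - w)) := by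
    simp only [sub_apply, map_sub]; abel
  have n1 := ContinuousLinearMap.le_opNorm₂ (A - C) g g
  have n2 := ContinuousLinearMap.le_opNorm₂ (B - C) w w
  have n3 := ContinuousLinearMap.le_opNorm₂ C (g - w) g
  have n4 := ContinuousLinearMap.le_opNorm₂ C w (g - w)
  have m1 := norm_sub_le ((A - C) g g) ((B - C) w w)
  have m2 := norm_add_le (C (g - w) g) (C w (g - w))
  rw [hg] at n1 n3
  rw [e]
  refine (norm_add_le _ _).trans ?_
  linarith

/-- `P : D → S` is a `C²` retraction onto `S` whose derivatives at the points of `S` kill the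
normal vectors. -/
structure IsNormalProjection (S D : Set E) (P : E → E) : Prop where
  isOpen : IsOpen D
  subset : S ⊆ D
  mapsTo : MapsTo P D S
  eq_self : ∀ p ∈ S, P p = p
  contDiffOn : ContDiffOn ℝ 2 P D
  fderiv_orthogonal : ∀ p ∈ S, ∀ w ∈ (tangentSpaceAt S p)ᗮ, fderiv ℝ P p w = 0

namespace IsNormalProjection

variable {S D : Set E} {P : E → E} (h : IsNormalProjection S D P)
include h

theorem hasFDerivAt {y : E} (hy : y ∈ D) : HasFDerivAt P (fderiv ℝ P y) y :=
  ((h.contDiffOn.contDiffAt (h.isOpen.mem_nhds hy)).differentiableAt (by simp)).hasFDerivAt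

theorem contDiffAt_fderiv {y : E} (hy : y ∈ D) : ContDiffAt ℝ 1 (fderiv ℝ P) y :=
  (h.contDiffOn.contDiffAt (h.isOpen.mem_nhds hy)).fderiv_right (by norm_num [one_add_one_eq_two])

theorem hasFDerivAt_fderiv {y : E} (hy : y ∈ D) :
    HasFDerivAt (fderiv ℝ P) (fderiv ℝ (fderiv ℝ P) y) y :=
  ((h.contDiffAt_fderiv hy).differentiableAt (by simp)).hasFDerivAt

theorem continuousAt_fderiv_fderiv {y : E} (hy : y ∈ D) :
    ContinuousAt (fderiv ℝ (fderiv ℝ P)) y :=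
  ((h.contDiffAt_fderiv hy).fderiv_right (m := 0) (by norm_num)).continuousAt

theorem fderiv_apply_tangent {p v : E} (hp : p ∈ S) (hv : v ∈ tangentSpaceAt S p) :
    fderiv ℝ P p v = v :=
  apply_eq_self_of_mem_tangentSpaceAt (h.hasFDerivAt (h.subset hp))
    (Eventually.of_forall h.eq_self) hp hv

/-- The geodesic equation in terms of the second derivative of the projection. -/
theorem deriv_deriv_eq {γ : ℝ → E} {a b s : ℝ} (hγ : IsGeodesicOn S γ a b) (hs : s ∈ Ioo a b) :
    deriv (deriv γ) s = fderiv ℝ (fderiv ℝ P) (γ s) (deriv γ s) (deriv γ s) := by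
  have h1 : ∀ u ∈ Ioo a b, HasDerivAt (fun t => P (γ t)) (fderiv ℝ P (γ u) (deriv γ u)) u :=
    fun u hu => (h.hasFDerivAt (h.subset (hγ.mem u hu))).comp_hasDerivAt u (hγ.hasDerivAt hu)
  have h2 : ∀ u ∈ Ioo a b, deriv γ u = fderiv ℝ P (γ u) (deriv γ u) := by
    intro u hu
    refine ((h1 u hu).congr_of_eventuallyEq ?_).unique (hγ.hasDerivAt hu) |>.symm
    filter_upwards [isOpen_Ioo.mem_nhds hu] with t ht
    exact (h.eq_self _ (hγ.mem t ht)).symm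
  have h3 : HasDerivAt (fun u => fderiv ℝ P (γ u) (deriv γ u))
      (fderiv ℝ (fderiv ℝ P) (γ s) (deriv γ s) (deriv γ s) +
        fderiv ℝ P (γ s) (deriv (deriv γ) s)) s :=
    ((h.hasFDerivAt_fderiv (h.subset (hγ.mem s hs))).comp_hasDerivAt s
      (hγ.hasDerivAt hs)).clm_apply (hγ.hasDerivAt_deriv hs)
  rw [h.fderiv_orthogonal _ (hγ.mem s hs) _ (hγ.acceleration s hs), add_zero] at h3
  refine ((h3.congr_of_eventuallyEq ?_).unique (hγ.hasDerivAt_deriv hs)).symm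
  filter_upwards [isOpen_Ioo.mem_nhds hs] with t ht using h2 t ht

/-- The projection of `x + w` agrees with the exponential map to second order. -/
theorem norm_exp_sub_le {x : E} (hx : x ∈ S) {ε : ℝ} (hε : 0 < ε) :
    ∃ η > 0, ∀ w y : E, ‖w‖ < η → IsExp S x w y →
      ‖y - x‖ ≤ ‖w‖ ∧ ‖y - P (x + w)‖ ≤ ε * ‖w‖ ^ 2 := by
  set C := fderiv ℝ (fderiv ℝ P) with hC
  have hxD := h.subset hx
  have hcont : ContinuousAt C x := h.continuousAt_fderiv_fderiv hxD
  have hcont0 : Tendsto (fun y => ‖C y - C x‖) (𝓝 x) (𝓝 0) :=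
    (tendsto_iff_norm_sub_tendsto_zero (E := E →L[ℝ] E →L[ℝ] E)).1 hcont
  obtain ⟨δ, hδ, hball⟩ := Metric.eventually_nhds_iff_ball.1
    ((h.isOpen.eventually_mem hxD).and
      (hcont0.eventually_lt_const (show 0 < min (ε / 4) 1 by positivity)))
  have hCx : ∀ y ∈ Metric.ball x δ, ‖C y - C x‖ ≤ ε / 4 ∧ ‖C y - C x‖ ≤ 1 := by
    intro y hy
    have := (hball y hy).2
    exact ⟨this.le.trans (min_le_left _ _), this.le.trans (min_le_right _ _)⟩
  set K := ‖C x‖ + 1 with hK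
  have hK0 : 0 < K := by positivity
  have hCK : ∀ y ∈ Metric.ball x δ, ‖C y‖ ≤ K := fun y hy => by
    have := norm_add_le (C x) (C y - C x)
    rw [add_sub_cancel] at this
    linarith [(hCx y hy).2]
  -- The bound `δ` keeps the geodesic and the segment in the ball. There the variation of `C` costs
  -- at most `(ε/4 + ε/4) ‖w‖²`; the second bound makes the term `2 K² ‖w‖³`, caused by the turning
  -- of the velocity, at most `(ε/2) ‖w‖²`.
  refine ⟨min δ (ε / (4 * K ^ 2)), by positivity, ?_⟩
  rintro w y hw ⟨γ, a, b, ha, hb, hγ, h0, h1, rfl⟩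
  have hwδ : ‖w‖ < δ := hw.trans_le (min_le_left _ _)
  have hwK : 2 * K ^ 2 * ‖w‖ ≤ ε / 2 := by
    have := (hw.trans_le (min_le_right _ _)).le
    rw [le_div_iff₀ (by positivity)] at this
    linarith
  have hI : ∀ s ∈ Icc (0 : ℝ) 1, s ∈ Ioo a b := fun s hs => ⟨ha.trans_le hs.1, hs.2.trans_lt hb⟩
  have hI0 : (0 : ℝ) ∈ Icc (0 : ℝ) 1 := by simp
  have hI1 : (1 : ℝ) ∈ Icc (0 : ℝ) 1 := by simp
  have hsp : ∀ s ∈ Icc (0 : ℝ) 1, ‖deriv γ s‖ = ‖w‖ := fun s hs => by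
    rw [hγ.norm_deriv_eq (hI s hs) (hI 0 hI0), h1]
  have hγx : ∀ s ∈ Icc (0 : ℝ) 1, ‖γ s - x‖ ≤ ‖w‖ := by
    intro s hs
    have := norm_image_sub_le_of_norm_deriv_le_segment'
      (fun u hu => (hγ.hasDerivAt (hI u hu)).hasDerivWithinAt)
      (fun u hu => (hsp u (Ico_subset_Icc_self hu)).le) s hs
    rw [h0, sub_zero] at this
    exact this.trans (mul_le_of_le_one_right (norm_nonneg _) hs.2)
  have hγb : ∀ s ∈ Icc (0 : ℝ) 1, γ s ∈ Metric.ball x δ := fun s hs => by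
    rw [mem_ball_iff_norm]; exact (hγx s hs).trans_lt hwδ
  have hlb : ∀ s ∈ Icc (0 : ℝ) 1, x + s • w ∈ Metric.ball x δ := fun s hs => by
    rw [mem_ball_iff_norm, add_sub_cancel_left, norm_smul, Real.norm_of_nonneg hs.1]
    exact (mul_le_of_le_one_left (norm_nonneg _) hs.2).trans_lt hwδ
  have hγw : ∀ s ∈ Icc (0 : ℝ) 1, ‖deriv γ s - w‖ ≤ K * ‖w‖ ^ 2 := by
    intro s hs
    have := norm_image_sub_le_of_norm_deriv_le_segment' (C := K * ‖w‖ ^ 2)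
      (fun u hu => (hγ.hasDerivAt_deriv (hI u hu)).hasDerivWithinAt)
      (fun u hu => by
        have hu := Ico_subset_Icc_self hu
        rw [h.deriv_deriv_eq hγ (hI u hu)]
        refine (ContinuousLinearMap.le_opNorm₂ _ _ _).trans ?_
        rw [hsp u hu, mul_assoc, ← sq]
        exact mul_le_mul_of_nonneg_right (hCK _ (hγb u hu)) (by positivity)) s hs
    rw [h1, sub_zero] at this
    exact this.trans (mul_le_of_le_one_right (by positivity) hs.2)
  have hline : ∀ s : ℝ, HasDerivAt (fun s : ℝ => x + s • w) w s := fun s => by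
    simpa using ((hasDerivAt_id s).smul_const w).const_add x
  have hd1 : ∀ s ∈ Icc (0 : ℝ) 1, HasDerivAt (fun s => γ s - P (x + s • w))
      (deriv γ s - fderiv ℝ P (x + s • w) w) s := fun s hs =>
    (hγ.hasDerivAt (hI s hs)).sub
      ((h.hasFDerivAt (hball _ (hlb s hs)).1).comp_hasDerivAt s (hline s))
  have hd2 : ∀ s ∈ Icc (0 : ℝ) 1, HasDerivAt (fun s => deriv γ s - fderiv ℝ P (x + s • w) w)
      (C (γ s) (deriv γ s) (deriv γ s) - C (x + s • w) w w) s := by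
    intro s hs
    have h2 : HasDerivAt (fun s : ℝ => fderiv ℝ P (x + s • w)) (C (x + s • w) w) s :=
      (h.hasFDerivAt_fderiv (hball _ (hlb s hs)).1).comp_hasDerivAt s (hline s)
    have h3 : HasDerivAt (fun s : ℝ => fderiv ℝ P (x + s • w) w) (C (x + s • w) w w) s := by
      simpa using h2.clm_apply (hasDerivAt_const s w)
    rw [← h.deriv_deriv_eq hγ (hI s hs)]
    exact (hγ.hasDerivAt_deriv (hI s hs)).sub h3
  -- The second derivatives of `γ s` and `P (x + s w)` are close; the two integrations that follow
  -- start from equal initial velocities (because `DP(x) w = w` for tangent `w`) and equal initial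
  -- points.
  have hb2 : ∀ s ∈ Icc (0 : ℝ) 1,
      ‖C (γ s) (deriv γ s) (deriv γ s) - C (x + s • w) w w‖ ≤ ε * ‖w‖ ^ 2 := by
    intro s hs
    refine (norm_bilin_sub_le (C x) (hsp s hs)).trans ?_
    have m1 := mul_le_mul_of_nonneg_right (add_le_add (hCx _ (hγb s hs)).1 (hCx _ (hlb s hs)).1)
      (sq_nonneg ‖w‖)
    have m2 : ‖C x‖ * ‖deriv γ s - w‖ * ‖w‖ ≤ K * (K * ‖w‖ ^ 2) * ‖w‖ := by
      gcongr
      · linarith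
      · exact hγw s hs
    have m3 := mul_le_mul_of_nonneg_right hwK (sq_nonneg ‖w‖)
    linarith
  have hb1 : ∀ s ∈ Icc (0 : ℝ) 1, ‖deriv γ s - fderiv ℝ P (x + s • w) w‖ ≤ ε * ‖w‖ ^ 2 := by
    intro s hs
    have hw : w ∈ tangentSpaceAt S x := by
      rw [← h1, ← h0]; exact hγ.deriv_mem (hI 0 hI0)
    have := norm_image_sub_le_of_norm_deriv_le_segment'
      (fun u hu => (hd2 u hu).hasDerivWithinAt)
      (fun u hu => hb2 u (Ico_subset_Icc_self hu)) s hs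
    simp only [h1, zero_smul, add_zero, h.fderiv_apply_tangent hx hw, sub_self, sub_zero] at this
    exact this.trans (mul_le_of_le_one_right (by positivity) hs.2)
  refine ⟨hγx 1 hI1, ?_⟩
  have := norm_image_sub_le_of_norm_deriv_le_segment'
    (fun u hu => (hd1 u hu).hasDerivWithinAt)
    (fun u hu => hb1 u (Ico_subset_Icc_self hu)) 1 hI1
  simpa [h0, h.eq_self x hx] using this

/-- The image under `P` of the segment from `p` to `q` is a path in `S`, and near `x` the map `P`
stretches lengths by at most `‖DP(x)‖ + 1`. -/
theorem riemannianDist_le {x : E} (hx : x ∈ S) :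
    ∃ K ≥ 0, ∃ δ > 0, ∀ p ∈ S, ∀ q ∈ S, p ∈ Metric.ball x δ → q ∈ Metric.ball x δ →
      riemannianDist S p q ≤ ENNReal.ofReal (K * ‖q - p‖) := by
  have hxD := h.subset hx
  obtain ⟨δ, hδ, hball⟩ := Metric.eventually_nhds_iff_ball.1
    ((h.isOpen.eventually_mem hxD).and
      ((h.contDiffAt_fderiv hxD).continuousAt.norm.eventually_le_const (lt_add_one _)))
  refine ⟨‖fderiv ℝ P x‖ + 1, by positivity, δ, hδ, fun p hp q hq hpx hqx => ?_⟩
  set c : ℝ → E := fun t => p + t • (q - p) with hc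
  have hcb : ∀ t ∈ Icc (0 : ℝ) 1, c t ∈ Metric.ball x δ := fun t ht =>
    (convex_ball x δ).add_smul_sub_mem hpx hqx ht
  have hcd : ∀ t, HasDerivAt c (q - p) t := fun t => by
    simpa [hc] using ((hasDerivAt_id t).smul_const (q - p)).const_add p
  have hpath : IsPathIn S p q fun t => P (c t) := by
    refine ⟨?_, fun t ht => h.mapsTo (hball _ (hcb t ht)).1, by simp [hc, h.eq_self p hp],
      by simp [hc, h.eq_self q hq]⟩
    exact (h.contDiffOn.of_le (by norm_num)).comp (by fun_prop) fun t ht => (hball _ (hcb t ht)).1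
  refine (iInf₂_le _ hpath).trans ?_
  calc ∫⁻ t in Icc (0 : ℝ) 1, ‖derivWithin (fun t => P (c t)) (Icc 0 1) t‖ₑ
      ≤ ∫⁻ t in Icc (0 : ℝ) 1, ENNReal.ofReal ((‖fderiv ℝ P x‖ + 1) * ‖q - p‖) := by
        refine setLIntegral_mono measurable_const fun t ht => ?_
        have hd : HasDerivAt (fun t => P (c t)) (fderiv ℝ P (c t) (q - p)) t :=
          (h.hasFDerivAt (hball _ (hcb t ht)).1).comp_hasDerivAt t (hcd t)
        rw [hd.hasDerivWithinAt.derivWithin (uniqueDiffOn_Icc_zero_one t ht), ← ofReal_norm]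
        refine ENNReal.ofReal_le_ofReal ((ContinuousLinearMap.le_opNorm _ _).trans ?_)
        exact mul_le_mul_of_nonneg_right (hball _ (hcb t ht)).2 (norm_nonneg _)
    _ = ENNReal.ofReal ((‖fderiv ℝ P x‖ + 1) * ‖q - p‖) := by simp

theorem agreesWithExp {x v : E} (hx : x ∈ S)
    (hexp : ∀ᶠ t in 𝓝 (0 : ℝ), (x, t • v) ∈ expDomain S) :
    AgreesWithExp S (inducedRetraction P) 2 x v := by
  obtain ⟨K, hK, δ, hδ, hdist⟩ := h.riemannianDist_le hx
  rw [AgreesWithExp, ENNReal.tendsto_nhds_zero]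
  intro ε hε
  obtain ⟨r, hr0, hr⟩ := ENNReal.lt_iff_exists_real_btwn.1 hε
  have hrpos : 0 < r := by simpa using hr.1
  -- Chosen so that `K (ε' ‖t v‖²) ≤ r t²`; the summand `1` excludes a zero denominator. The real
  -- number `r` replaces `ε`, which may be infinite.
  set ε' := r / (K * ‖v‖ ^ 2 + 1) with hε'
  have hε'pos : 0 < ε' := by positivity
  obtain ⟨η, hη, hest⟩ := h.norm_exp_sub_le hx hε'pos
  have hcontv : Tendsto (fun t : ℝ => t • v) (𝓝 0) (𝓝 0) := by
    have : ContinuousAt (fun t : ℝ => t • v) 0 := by fun_prop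
    simpa [ContinuousAt] using this
  have hxD := h.subset hx
  have hcontx : Tendsto (fun t : ℝ => x + t • v) (𝓝 0) (𝓝 x) := by
    simpa using hcontv.const_add x
  have hPx : Tendsto (fun t : ℝ => P (x + t • v)) (𝓝 0) (𝓝 x) := by
    have := (h.hasFDerivAt hxD).continuousAt.tendsto.comp hcontx
    rwa [h.eq_self x hx] at this
  have hev : ∀ᶠ t in 𝓝 (0 : ℝ), t ≠ 0 → riemannianDist S (inducedRetraction P (x, t • v))
      (expMap S (x, t • v)) / ENNReal.ofReal (|t| ^ 2) ≤ ε := by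
    filter_upwards [hexp, hcontv.norm.eventually_lt_const (by simpa using hη),
      hcontv.norm.eventually_lt_const (by simpa using hδ), hPx (Metric.ball_mem_nhds x hδ),
      hcontx (h.isOpen.mem_nhds hxD)] with t hexp h1 h2 h3 h4 h0
    have hE : IsExp S x (t • v) _ := isExp_expMap hexp
    set y := expMap S (x, t • v) with hy
    obtain ⟨e1, e2⟩ := hest _ _ h1 hE
    have hyS : y ∈ S := by
      obtain ⟨γ, a, b, ha, hb, hγ, -, -, hyγ⟩ := hE
      rw [← hyγ]; exact hγ.mem 1 ⟨by linarith, hb⟩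
    have hd := hdist _ (h.mapsTo h4) _ hyS h3 (by
      rw [mem_ball_iff_norm]; exact e1.trans_lt h2)
    have ht : 0 < |t| ^ 2 := by positivity
    refine (ENNReal.div_le_div_right (c := ENNReal.ofReal (|t| ^ 2)) (b := ENNReal.ofReal (r * |t| ^ 2))
      (hd.trans ?_)).trans ?_
    · refine ENNReal.ofReal_le_ofReal ?_
      calc K * ‖y - P (x + t • v)‖ ≤ K * (ε' * ‖t • v‖ ^ 2) := by gcongr
        _ = ε' * (K * ‖v‖ ^ 2) * |t| ^ 2 := by rw [norm_smul, Real.norm_eq_abs]; ring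
        _ ≤ ε' * (K * ‖v‖ ^ 2 + 1) * |t| ^ 2 := by gcongr; linarith
        _ = r * |t| ^ 2 := by rw [hε', div_mul_cancel₀]; positivity
    · rw [ENNReal.ofReal_mul hrpos.le, ENNReal.mul_div_cancel_right (by simpa using h0)
        ENNReal.ofReal_ne_top]
      exact hr.2.le
  exact eventually_nhdsWithin_of_eventually_nhds (hev.mono fun t ht => ht) |>.mp
    (eventually_mem_nhdsWithin.mono fun t ht h' => h' ht)

theorem isRetractionOfOrder [CompleteSpace E] {k : ℕ∞} {c : ℕ} (hk : 3 ≤ k)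
    (hS : IsSubmanifold k c S) (hP : ContDiffOn ℝ ((k - 1 : ℕ∞) : WithTop ℕ∞) P D) :
    IsRetractionOfOrder k 2 S (retractionDomain S D) (inducedRetraction P) where
  one_le := by norm_num
  lt := lt_of_lt_of_le (by norm_num) hk
  isOpen := by
    refine ⟨(fun z : E × E => z.1 + z.2) ⁻¹' D, h.isOpen.preimage (by fun_prop), ?_⟩
    ext z; exact and_comm
  zero_mem := fun x hx => ⟨⟨hx, Submodule.zero_mem _⟩, by simpa using h.subset hx⟩
  mapsTo := fun z hz => h.mapsTo hz.2
  contDiffOn := hP.comp (contDiff_fst.add contDiff_snd).contDiffOn fun z hz => hz.2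
  exp_defined := fun x hx v hv => eventually_mem_expDomain hk hS hx hv
  agrees := fun x hx v hv => h.agreesWithExp hx (eventually_mem_expDomain hk hS hx hv)

end IsNormalProjection

end Projection

/-! ### Smoothness of integrals in a parameter. -/

section ParametricIntegral

theorem eventually_forall_Icc {E : Type*} [TopologicalSpace E] {p : E × ℝ → Prop} {x : E}
    (h : ∀ t ∈ Icc (0 : ℝ) 1, ∀ᶠ z in 𝓝 (x, t), p z) :
    ∀ᶠ y in 𝓝 x, ∀ t ∈ Icc (0 : ℝ) 1, p (y, t) :=
  isCompact_Icc.eventually_forall_of_forall_eventually h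

theorem eventually_norm_le_of_continuousAt {E G : Type*} [TopologicalSpace E]
    [NormedAddCommGroup G] {g : E × ℝ → G} {x : E}
    (h : ∀ t ∈ Icc (0 : ℝ) 1, ContinuousAt g (x, t)) :
    ∃ C, ∀ᶠ y in 𝓝 x, ∀ t ∈ Icc (0 : ℝ) 1, ‖g (y, t)‖ ≤ C := by
  have hc : ContinuousOn (fun t => g (x, t)) (Icc 0 1) := fun t ht =>
    (ContinuousAt.comp (g := g) (f := fun t => (x, t)) (h t ht)
      (by fun_prop)).continuousWithinAt
  obtain ⟨C, hC⟩ := isCompact_Icc.exists_bound_of_continuousOn hc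
  exact ⟨C + 1, eventually_forall_Icc fun t ht =>
    (h t ht).norm.eventually_le_const ((hC t ht).trans_lt (lt_add_one C))⟩

/-- An integral of a `C^r` function over `[0, 1]` is `C^r` in the parameter. -/
theorem contDiffAt_intervalIntegral (r : ℕ) : ∀ {E G : Type} [NormedAddCommGroup E]
    [NormedSpace ℝ E] [NormedAddCommGroup G] [NormedSpace ℝ G] (g : E × ℝ → G) (x₀ : E),
    (∀ t ∈ Icc (0 : ℝ) 1, ContDiffAt ℝ r g (x₀, t)) →
      ContDiffAt ℝ r (fun x => ∫ t in (0 : ℝ)..1, g (x, t)) x₀ := by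
  have huI : Set.uIoc (0 : ℝ) 1 ⊆ Icc 0 1 := by
    rw [uIoc_of_le zero_le_one]; exact Ioc_subset_Icc_self
  have hcomp : ∀ {E G : Type} [NormedAddCommGroup E] [NormedAddCommGroup G] {g : E × ℝ → G} {x : E},
      (∀ t ∈ Icc (0 : ℝ) 1, ContinuousAt g (x, t)) →
      ContinuousOn (fun t => g (x, t)) (Icc 0 1) := fun h t ht =>
    (ContinuousAt.comp (g := _) (f := fun t => (_, t)) (h t ht)
      (by fun_prop)).continuousWithinAt
  have hmeas : ∀ {E G : Type} [NormedAddCommGroup E] [NormedAddCommGroup G] {g : E × ℝ → G} {x : E},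
      (∀ t ∈ Icc (0 : ℝ) 1, ContinuousAt g (x, t)) →
      AEStronglyMeasurable (fun t => g (x, t)) (volume.restrict (Set.uIoc 0 1)) := fun h =>
    ((hcomp h).mono huI).aestronglyMeasurable measurableSet_uIoc
  induction r with
  | zero =>
    intro E G _ _ _ _ g x₀ hg
    have hev : ∀ᶠ y in 𝓝 x₀, ∀ t ∈ Icc (0 : ℝ) 1, ContDiffAt ℝ (0 : ℕ) g (y, t) :=
      eventually_forall_Icc fun t ht => (hg t ht).eventually (by simp)
    rw [Nat.cast_zero, contDiffAt_zero]
    refine ⟨_, hev.eventually_nhds, fun x hx => ContinuousAt.continuousWithinAt ?_⟩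
    have hc : ∀ᶠ y in 𝓝 x, ∀ t ∈ Icc (0 : ℝ) 1, ContinuousAt g (y, t) :=
      Eventually.mono hx fun y hy t ht => (hy t ht).continuousAt
    obtain ⟨C, hC⟩ := eventually_norm_le_of_continuousAt hc.self_of_nhds
    refine intervalIntegral.continuousAt_of_dominated_interval (bound := fun _ => C)
      (hc.mono fun y hy => hmeas hy)
      (hC.mono fun y hy => ae_of_all _ fun t ht => hy t (huI ht)) (by simp)
      (ae_of_all _ fun t ht => ?_)
    exact ContinuousAt.comp (g := g) (f := fun y => (y, t))
      (hc.self_of_nhds t (huI ht)) (by fun_prop)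
  | succ r ih =>
    intro E G _ _ _ _ g x₀ hg
    have hev : ∀ᶠ y in 𝓝 x₀, ∀ t ∈ Icc (0 : ℝ) 1, ContDiffAt ℝ ((r + 1 : ℕ)) g (y, t) :=
      eventually_forall_Icc fun t ht => (hg t ht).eventually (by simp)
    -- The partial derivative in the parameter takes values in a new space; this is why the
    -- induction quantifies over all spaces.
    let g' : E × ℝ → E →L[ℝ] G := fun z => fderiv ℝ g z ∘L ContinuousLinearMap.inl ℝ E ℝ
    have hg' : ∀ z, ContDiffAt ℝ ((r + 1 : ℕ)) g z → ContDiffAt ℝ r g' z := fun z hz =>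
      (hz.fderiv_right (by simp)).clm_comp contDiffAt_const
    push_cast
    rw [contDiffAt_succ_iff_hasFDerivAt]
    refine ⟨fun x => ∫ t in (0 : ℝ)..1, g' (x, t), ⟨_, hev.eventually_nhds, fun x hx => ?_⟩,
      ih g' x₀ fun t ht => hg' _ (hg t ht)⟩
    have hx' : ∀ᶠ y in 𝓝 x, ∀ t ∈ Icc (0 : ℝ) 1, ContDiffAt ℝ ((r + 1 : ℕ)) g (y, t) := hx
    obtain ⟨C, hC⟩ := eventually_norm_le_of_continuousAt (g := g') (x := x)
      fun t ht => (hg' _ (hx'.self_of_nhds t ht)).continuousAt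
    refine intervalIntegral.hasFDerivAt_integral_of_dominated_of_fderiv_le
      (F := fun x t => g (x, t)) (F' := fun x t => g' (x, t)) (bound := fun _ => C)
      (hC.and hx') (hx'.mono fun y hy => hmeas fun t ht => (hy t ht).continuousAt) ?_
      (hmeas fun t ht => (hg' _ (hx'.self_of_nhds t ht)).continuousAt)
      (ae_of_all _ fun t ht y hy => hy.1 t (huI ht)) (by simp)
      (ae_of_all _ fun t ht y hy => ?_)
    · exact ContinuousOn.intervalIntegrable (by
        rw [uIcc_of_le zero_le_one]
        exact hcomp fun t ht => (hx'.self_of_nhds t ht).continuousAt)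
    · have h1 : HasFDerivAt g (fderiv ℝ g (y, t)) (y, t) :=
        ((hy.2 t (huI ht)).differentiableAt (by simp)).hasFDerivAt
      exact h1.comp y (hasFDerivAt_prodMk_left y t)

end ParametricIntegral

/-! ### Uniform convergence of Newton-like iterations. -/

section AttractingFixedPoints

theorem contDiffAt_iterate {E : Type*} [NormedAddCommGroup E] [NormedSpace ℝ E] {N : E → E} {x : E}
    {r : WithTop ℕ∞} (h : ∀ m : ℕ, ContDiffAt ℝ r N (N^[m] x)) (m : ℕ) :
    ContDiffAt ℝ r (N^[m]) x := by
  induction m with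
  | zero => exact contDiffAt_id
  | succ m ih =>
    rw [Function.iterate_succ']
    exact (h m).comp x ih

/-- Turns estimates on short tangent vectors into an estimate of the operator norm, by homogeneity.
-/
theorem norm_le_of_forall_ball {E G : Type*} [NormedAddCommGroup E] [NormedSpace ℝ E]
    [NormedAddCommGroup G] [NormedSpace ℝ G] {f : E →L[ℝ] G} {ρ C : ℝ} (hρ : 0 < ρ) (hC : 0 ≤ C)
    (h : ∀ ξ ∈ Metric.ball (0 : E) ρ, ‖f ξ‖ ≤ C) : ‖f‖ ≤ 2 * C / ρ := by
  refine f.opNorm_le_bound (by positivity) fun ξ => ?_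
  rcases eq_or_ne ξ 0 with rfl | hξ
  · simp
  have hn : 0 < ‖ξ‖ := norm_pos_iff.2 hξ
  have h1 := h ((ρ / (2 * ‖ξ‖)) • ξ) (by
    rw [mem_ball_zero_iff, norm_smul, Real.norm_of_nonneg (by positivity)]
    field_simp
    linarith)
  rw [map_smul, norm_smul, Real.norm_of_nonneg (by positivity)] at h1
  calc ‖f ξ‖ = (2 * ‖ξ‖ / ρ) * (ρ / (2 * ‖ξ‖) * ‖f ξ‖) := by field_simp
    _ ≤ (2 * ‖ξ‖ / ρ) * C := by gcongr
    _ = 2 * C / ρ * ‖ξ‖ := by ring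

/-- If the iteration `N x = x - A x (F x)` satisfies `F (N x) = B x (F x)` and `F` and `B` vanish
at `x₀`, then the iterates stay near `x₀` and converge uniformly near `x₀`. -/
theorem exists_tendstoUniformlyOn_iterate {E V : Type*} [NormedAddCommGroup E] [NormedSpace ℝ E]
    [CompleteSpace E] [NormedAddCommGroup V] [NormedSpace ℝ V] {F : E → V} {A : E → V →L[ℝ] E}
    {B : E → V →L[ℝ] V} {x₀ : E} (hF : ContinuousAt F x₀) (hA : ContinuousAt A x₀)
    (hB : ContinuousAt B x₀) (hF0 : F x₀ = 0) (hB0 : B x₀ = 0)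
    (hFB : ∀ᶠ x in 𝓝 x₀, F (x - A x (F x)) = B x (F x)) {O : Set E} (hO : O ∈ 𝓝 x₀) :
    ∃ U : Set E, IsOpen U ∧ x₀ ∈ U ∧
      (∀ x ∈ U, ∀ m : ℕ, (fun x => x - A x (F x))^[m] x ∈ O) ∧
      (∀ x ∈ U, Tendsto (fun m : ℕ => F ((fun x => x - A x (F x))^[m] x)) atTop (𝓝 0)) ∧
      ∃ P : E → E, TendstoUniformlyOn (fun m : ℕ => (fun x => x - A x (F x))^[m]) P atTop U := by
  set N : E → E := fun x => x - A x (F x) with hN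
  set K := ‖A x₀‖ + 1 with hK
  have hK0 : 0 < K := by positivity
  obtain ⟨δ, hδ, hball⟩ := Metric.eventually_nhds_iff_ball.1 (hFB.and
    ((hA.norm.eventually_le_const (lt_add_one ‖A x₀‖)).and
      ((hB.norm.eventually_le_const (show ‖B x₀‖ < 1 / 2 by simp [hB0])).and hO)))
  -- With this bound on `F x` the total displacement `2 K ‖F x‖` is less than `δ / 2`, so an orbit
  -- that starts within `δ / 2` of `x₀` remains in the `δ`-ball.
  have hnear : ∀ᶠ x in 𝓝 x₀, ‖F x‖ < δ / (4 * K) ∧ x ∈ Metric.ball x₀ (δ / 2) :=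
    (hF.norm.eventually_lt_const (show ‖F x₀‖ < δ / (4 * K) by simp [hF0]; positivity)).and
      (Metric.ball_mem_nhds _ (half_pos hδ))
  obtain ⟨U, hU, hUo, hxU⟩ := eventually_nhds_iff.1 hnear
  -- The four claims need each other: staying in the ball gives `‖B‖ ≤ 1/2`, so `F` is halved at
  -- each step; the steps are then geometric, and their sum bounds the displacement, which keeps the
  -- orbit in the ball.
  have key : ∀ x ∈ U, ∀ m : ℕ, ‖N^[m] x - x‖ ≤ 2 * K * ‖F x‖ * (1 - (1 / 2) ^ m) ∧
      ‖F (N^[m] x)‖ ≤ (1 / 2) ^ m * ‖F x‖ ∧ N^[m] x ∈ Metric.ball x₀ δ ∧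
      ‖N^[m + 1] x - N^[m] x‖ ≤ K * ‖F x‖ * (1 / 2) ^ m := by
    intro x hx
    obtain ⟨hx1, hx2⟩ := hU x hx
    rw [lt_div_iff₀ (by positivity)] at hx1
    rw [mem_ball_iff_norm] at hx2
    have hmem : ∀ m : ℕ, ‖N^[m] x - x‖ ≤ 2 * K * ‖F x‖ * (1 - (1 / 2) ^ m) →
        N^[m] x ∈ Metric.ball x₀ δ := by
      intro m hm
      rw [mem_ball_iff_norm]
      have h1 := norm_add_le (N^[m] x - x) (x - x₀)
      rw [sub_add_sub_cancel] at h1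
      have h2 : 2 * K * ‖F x‖ * (1 - (1 / 2) ^ m) ≤ 2 * K * ‖F x‖ :=
        mul_le_of_le_one_right (by positivity) (by
          have : (0 : ℝ) ≤ (1 / 2) ^ m := by positivity
          linarith)
      nlinarith
    have hstep : ∀ m : ℕ, N^[m] x ∈ Metric.ball x₀ δ → ‖F (N^[m] x)‖ ≤ (1 / 2) ^ m * ‖F x‖ →
        ‖N^[m + 1] x - N^[m] x‖ ≤ K * ‖F x‖ * (1 / 2) ^ m := by
      intro m h1 h2
      rw [Function.iterate_succ_apply']
      simp only [hN, sub_sub_cancel_left, norm_neg]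
      refine (ContinuousLinearMap.le_opNorm _ _).trans ?_
      have := mul_le_mul (hball _ h1).2.1 h2 (norm_nonneg _) hK0.le
      exact this.trans (le_of_eq (by ring))
    intro m
    induction m with
    | zero =>
      have h0 : ‖N^[0] x - x‖ ≤ 2 * K * ‖F x‖ * (1 - (1 / 2) ^ 0) := by simp
      have h1 : ‖F (N^[0] x)‖ ≤ (1 / 2) ^ 0 * ‖F x‖ := by simp
      exact ⟨h0, h1, hmem 0 h0, hstep 0 (hmem 0 h0) h1⟩
    | succ m ih =>
      obtain ⟨i1, i2, i3, i4⟩ := ih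
      have h0 : ‖N^[m + 1] x - x‖ ≤ 2 * K * ‖F x‖ * (1 - (1 / 2) ^ (m + 1)) := by
        have h1 := norm_add_le (N^[m + 1] x - N^[m] x) (N^[m] x - x)
        rw [sub_add_sub_cancel] at h1
        rw [pow_succ]
        linarith
      have h1 : ‖F (N^[m + 1] x)‖ ≤ (1 / 2) ^ (m + 1) * ‖F x‖ := by
        rw [Function.iterate_succ_apply']
        have e : F (N (N^[m] x)) = B (N^[m] x) (F (N^[m] x)) := (hball _ i3).1
        rw [e]
        refine (ContinuousLinearMap.le_opNorm _ _).trans ?_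
        have := mul_le_mul (hball _ i3).2.2.1 i2 (norm_nonneg _) (by norm_num)
        exact this.trans (le_of_eq (by ring))
      exact ⟨h0, h1, hmem _ h0, hstep _ (hmem _ h0) h1⟩
  have hP : ∀ x ∈ U, ∃ y, Tendsto (fun m : ℕ => N^[m] x) atTop (𝓝 y) ∧
      ∀ m : ℕ, dist (N^[m] x) y ≤ K * ‖F x‖ * (1 / 2) ^ m / (1 - 1 / 2) := by
    intro x hx
    have hle : ∀ m : ℕ, dist (N^[m] x) (N^[m + 1] x) ≤ K * ‖F x‖ * (1 / 2) ^ m := fun m => by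
      rw [dist_comm, dist_eq_norm]; exact (key x hx m).2.2.2
    obtain ⟨y, hy⟩ := cauchySeq_tendsto_of_complete
      (cauchySeq_of_le_geometric (1 / 2) (K * ‖F x‖) (by norm_num) hle)
    exact ⟨y, hy, dist_le_of_le_geometric_of_tendsto (1 / 2) _ (by norm_num) hle hy⟩
  choose! P hP1 hP2 using hP
  refine ⟨U, hUo, hxU, fun x hx m => (hball _ (key x hx m).2.2.1).2.2.2, fun x hx => ?_, P, ?_⟩
  · refine squeeze_zero_norm (fun m => (key x hx m).2.1) ?_
    simpa using (tendsto_pow_atTop_nhds_zero_of_lt_one (by norm_num : (0 : ℝ) ≤ 1 / 2)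
      (by norm_num)).mul_const ‖F x‖
  · rw [Metric.tendstoUniformlyOn_iff]
    intro ε hε
    have hlim : Tendsto (fun m : ℕ => δ / 2 * (1 / 2 : ℝ) ^ m) atTop (𝓝 0) := by
      simpa using (tendsto_pow_atTop_nhds_zero_of_lt_one (by norm_num : (0 : ℝ) ≤ 1 / 2)
        (by norm_num)).const_mul (δ / 2)
    filter_upwards [hlim.eventually_lt_const hε] with m hm x hx
    rw [dist_comm]
    refine (hP2 x hx m).trans_lt (lt_of_le_of_lt ?_ hm)
    have h1 := (hU x hx).1.le
    rw [le_div_iff₀ (by positivity)] at h1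
    have : (0 : ℝ) ≤ (1 / 2) ^ m := by positivity
    have h2 : K * ‖F x‖ * 2 ≤ δ / 2 := by linarith
    calc K * ‖F x‖ * (1 / 2) ^ m / (1 - 1 / 2) = (K * ‖F x‖ * 2) * (1 / 2) ^ m := by ring
      _ ≤ δ / 2 * (1 / 2) ^ m := by gcongr

end AttractingFixedPoints

/-! ### Smoothness of the limit, by passing to the tangent map. -/

section AttractingFixedPointsSmooth

theorem iterate_tangentMap {E : Type*} [NormedAddCommGroup E] [NormedSpace ℝ E] {N : E → E}
    {T : E × E → E × E} {x : E} (ξ : E)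
    (hN : ∀ m : ℕ, DifferentiableAt ℝ N (N^[m] x))
    (hT : ∀ m : ℕ, ∀ ξ, T (N^[m] x, ξ) = (N (N^[m] x), fderiv ℝ N (N^[m] x) ξ)) (m : ℕ) :
    DifferentiableAt ℝ (N^[m]) x ∧ T^[m] (x, ξ) = (N^[m] x, fderiv ℝ (N^[m]) x ξ) := by
  induction m with
  | zero => simp [differentiableAt_id]
  | succ m ih =>
    rw [Function.iterate_succ']
    refine ⟨(hN m).comp x ih.1, ?_⟩
    rw [Function.iterate_succ_apply', ih.2, hT, fderiv_comp x (hN m) ih.1]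
    rfl

/-- Let the iteration `N x = x - A x (F x)` satisfy `F (N x) = B x (F x)`, where `F` and `B` vanish
at `x₀`.  If `A`, `B` and `F` are `C^r`, then so is the limit of the iterates.  The proof is by
induction on `r`: the tangent map of `N` has the same form as `N`. -/
theorem contDiffAt_limit_iterate (r : ℕ) : ∀ {E V : Type} [NormedAddCommGroup E] [NormedSpace ℝ E]
    [FiniteDimensional ℝ E] [NormedAddCommGroup V] [NormedSpace ℝ V] {F : E → V}
    {A : E → V →L[ℝ] E} {B : E → V →L[ℝ] V} {x₀ : E}, ContDiffAt ℝ r F x₀ → ContDiffAt ℝ r A x₀ →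
    ContDiffAt ℝ r B x₀ → F x₀ = 0 → B x₀ = 0 → (∀ᶠ x in 𝓝 x₀, F (x - A x (F x)) = B x (F x)) →
    ∃ U ∈ 𝓝 x₀, ∃ P : E → E, ContDiffAt ℝ r P x₀ ∧
      TendstoUniformlyOn (fun m : ℕ => (fun x => x - A x (F x))^[m]) P atTop U := by
  induction r with
  | zero =>
    intro E V _ _ _ _ _ F A B x₀ hF hA hB hF0 hB0 hFB
    have := FiniteDimensional.complete ℝ E
    set N : E → E := fun x => x - A x (F x) with hN
    have hNs : ∀ᶠ x in 𝓝 x₀, ContDiffAt ℝ (0 : ℕ) N x := by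
      filter_upwards [hF.eventually (by simp), hA.eventually (by simp)] with x h1 h2
      exact contDiffAt_id.sub (h2.clm_apply h1)
    obtain ⟨U, hUo, hxU, hUO, -, P, hP⟩ := exists_tendstoUniformlyOn_iterate hF.continuousAt
      hA.continuousAt hB.continuousAt hF0 hB0 hFB hNs
    refine ⟨U, hUo.mem_nhds hxU, P, ?_, hP⟩
    rw [Nat.cast_zero, contDiffAt_zero]
    refine ⟨U, hUo.mem_nhds hxU, hP.continuousOn (Frequently.of_forall fun m x hx => ?_)⟩
    have hx' : ∀ m : ℕ, ContDiffAt ℝ (0 : ℕ) N (N^[m] x) := fun m => hUO x hx m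
    exact (contDiffAt_iterate hx' m).continuousAt.continuousWithinAt
  | succ r ih =>
    intro E V _ _ _ _ _ F A B x₀ hF hA hB hF0 hB0 hFB
    have := FiniteDimensional.complete ℝ E
    set N : E → E := fun x => x - A x (F x) with hN
    have hle : ((r : ℕ) : WithTop ℕ∞) ≤ ((r + 1 : ℕ) : WithTop ℕ∞) := by
      exact_mod_cast Nat.le_succ r
    have hle' : ((r : ℕ) : WithTop ℕ∞) + 1 ≤ ((r + 1 : ℕ) : WithTop ℕ∞) := by simp
    -- The data of the tangent map `T(x, ξ) = (N x, DN(x) ξ)`. Differentiating `A x (F x)` in the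
    -- direction `ξ` makes `A'` block triangular, with `A x` on the diagonal and `DA(x) ξ` below it;
    -- likewise `B'`. One derivative is lost, and the terms with `ξ` vanish at `(x₀, 0)`, so the
    -- induction hypothesis applies there.
    let F' : E × E → V × V := fun z => (F z.1, fderiv ℝ F z.1 z.2)
    let A' : E × E → V × V →L[ℝ] E × E := fun z =>
      ContinuousLinearMap.inl ℝ E E ∘L (A z.1 ∘L ContinuousLinearMap.fst ℝ V V) +
      ContinuousLinearMap.inr ℝ E E ∘L (fderiv ℝ A z.1 z.2 ∘L ContinuousLinearMap.fst ℝ V V +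
        A z.1 ∘L ContinuousLinearMap.snd ℝ V V)
    let B' : E × E → V × V →L[ℝ] V × V := fun z =>
      ContinuousLinearMap.inl ℝ V V ∘L (B z.1 ∘L ContinuousLinearMap.fst ℝ V V) +
      ContinuousLinearMap.inr ℝ V V ∘L (fderiv ℝ B z.1 z.2 ∘L ContinuousLinearMap.fst ℝ V V +
        B z.1 ∘L ContinuousLinearMap.snd ℝ V V)
    have hfst : ContDiffAt ℝ r (fun z : E × E => z.1) (x₀, 0) := contDiffAt_fst
    have hsnd : ContDiffAt ℝ r (fun z : E × E => z.2) (x₀, 0) := contDiffAt_snd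
    have lift : ∀ {G : Type} [NormedAddCommGroup G] [NormedSpace ℝ G] {g : E → G},
        ContDiffAt ℝ r g x₀ → ContDiffAt ℝ r (fun z : E × E => g z.1) (x₀, 0) :=
      fun {G} _ _ {g} hg => ContDiffAt.comp (g := g) (x₀, (0 : E)) hg hfst
    have lift' : ∀ {G : Type} [NormedAddCommGroup G] [NormedSpace ℝ G] {g : E → G},
        ContDiffAt ℝ (r + 1 : ℕ) g x₀ →
        ContDiffAt ℝ r (fun z : E × E => fderiv ℝ g z.1 z.2) (x₀, 0) :=
      fun hg => (lift (hg.fderiv_right hle')).clm_apply hsnd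
    have hF' : ContDiffAt ℝ r F' (x₀, 0) := (lift (hF.of_le hle)).prodMk (lift' hF)
    have hA' : ContDiffAt ℝ r A' (x₀, 0) :=
      (contDiffAt_const.clm_comp ((lift (hA.of_le hle)).clm_comp contDiffAt_const)).add
        (contDiffAt_const.clm_comp (((lift' hA).clm_comp contDiffAt_const).add
          ((lift (hA.of_le hle)).clm_comp contDiffAt_const)))
    have hB' : ContDiffAt ℝ r B' (x₀, 0) :=
      (contDiffAt_const.clm_comp ((lift (hB.of_le hle)).clm_comp contDiffAt_const)).add
        (contDiffAt_const.clm_comp (((lift' hB).clm_comp contDiffAt_const).add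
          ((lift (hB.of_le hle)).clm_comp contDiffAt_const)))
    have hFd : ∀ᶠ x in 𝓝 x₀, DifferentiableAt ℝ F x :=
      (hF.eventually (by simp)).mono fun x hx => hx.differentiableAt (by simp)
    have hAd : ∀ᶠ x in 𝓝 x₀, DifferentiableAt ℝ A x :=
      (hA.eventually (by simp)).mono fun x hx => hx.differentiableAt (by simp)
    have hBd : ∀ᶠ x in 𝓝 x₀, DifferentiableAt ℝ B x :=
      (hB.eventually (by simp)).mono fun x hx => hx.differentiableAt (by simp)
    have hNd : ∀ x, DifferentiableAt ℝ F x → DifferentiableAt ℝ A x →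
        HasFDerivAt N (ContinuousLinearMap.id ℝ E - ((A x).comp (fderiv ℝ F x) +
          (fderiv ℝ A x).flip (F x))) x := fun x h1 h2 =>
      (hasFDerivAt_id x).sub (h2.hasFDerivAt.clm_apply h1.hasFDerivAt)
    set T : E × E → E × E := fun z => z - A' z (F' z) with hT
    have hTN : ∀ x ξ, DifferentiableAt ℝ F x → DifferentiableAt ℝ A x →
        T (x, ξ) = (N x, fderiv ℝ N x ξ) := by
      intro x ξ h1 h2
      rw [(hNd x h1 h2).fderiv]
      simp [hT, hN, A', F', add_comm]
    have hN0 : N x₀ = x₀ := by simp [hN, hF0]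
    have hNc : ContinuousAt N x₀ := (hNd x₀ hFd.self_of_nhds hAd.self_of_nhds).continuousAt
    -- The first component is the identity `F (N x) = B x (F x)`, the second its derivative in the
    -- direction `ξ`.
    have hFB' : ∀ᶠ z in 𝓝 (x₀, (0 : E)), F' (z - A' z (F' z)) = B' z (F' z) := by
      have hev : ∀ᶠ x in 𝓝 x₀, ∀ ξ, F' (T (x, ξ)) = B' (x, ξ) (F' (x, ξ)) := by
        have hFN : ∀ᶠ x in 𝓝 x₀, DifferentiableAt ℝ F (N x) := by
          rw [ContinuousAt, hN0] at hNc; exact hNc.eventually hFd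
        filter_upwards [hFd, hAd, hBd, hFN, eventually_eventually_nhds.2 hFB]
          with x h1 h2 h3 h4 h5 ξ
        have e1 : HasFDerivAt (fun x => F (N x)) (fderiv ℝ F (N x) ∘L fderiv ℝ N x) x :=
          h4.hasFDerivAt.comp x (hNd x h1 h2).differentiableAt.hasFDerivAt
        have e2 := (h3.hasFDerivAt.clm_apply h1.hasFDerivAt).congr_of_eventuallyEq
          (h5 : (fun x => F (N x)) =ᶠ[𝓝 x] fun x => B x (F x))
        have e3 := DFunLike.congr_fun (e1.unique e2) ξ
        have e4 : F (N x) = B x (F x) := h5.self_of_nhds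
        rw [hTN x ξ h1 h2]
        simp only [ContinuousLinearMap.comp_apply] at e3
        simp [F', B', e3, e4, add_comm]
      rw [nhds_prod_eq]
      exact (hev.prod_inl _).mono fun z hz => hz z.2
    have hF'0 : F' (x₀, 0) = 0 := by simp [F', hF0]
    have hB'0 : B' (x₀, 0) = 0 := by simp [B', hB0]
    obtain ⟨U', hU', P', hP's, hP'⟩ := ih hF' hA' hB' hF'0 hB'0 hFB'
    have hP'ev : ∀ᶠ z in 𝓝 (x₀, (0 : E)), z ∈ U' ∧ ContDiffAt ℝ r P' z :=
      (eventually_mem_set.2 hU').and (hP's.eventually (by simp))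
    obtain ⟨ρ, hρ, hball⟩ := Metric.eventually_nhds_iff_ball.1 hP'ev
    rw [← ball_prod_same] at hball
    have hO : ∀ᶠ x in 𝓝 x₀, DifferentiableAt ℝ F x ∧ DifferentiableAt ℝ A x := hFd.and hAd
    obtain ⟨U₀, hUo₀, hxU₀, hUO₀, -, P, hP₀⟩ := exists_tendstoUniformlyOn_iterate hF.continuousAt
      hA.continuousAt hB.continuousAt hF0 hB0 hFB hO
    set U := U₀ ∩ Metric.ball x₀ ρ with hU
    have hUo : IsOpen U := hUo₀.inter Metric.isOpen_ball
    have hxU : x₀ ∈ U := ⟨hxU₀, Metric.mem_ball_self hρ⟩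
    have hit : ∀ x ∈ U, ∀ ξ, ∀ m : ℕ, DifferentiableAt ℝ (N^[m]) x ∧
        T^[m] (x, ξ) = (N^[m] x, fderiv ℝ (N^[m]) x ξ) := fun x hx ξ m =>
      iterate_tangentMap ξ
        (fun m => (hNd _ (hUO₀ x hx.1 m).1 (hUO₀ x hx.1 m).2).differentiableAt)
        (fun m ξ => hTN _ ξ (hUO₀ x hx.1 m).1 (hUO₀ x hx.1 m).2) m
    -- The second component of `T^[m] (x, ξ)` is the derivative of `N^[m]` applied to `ξ`. Its
    -- uniform convergence for `‖ξ‖ < ρ` makes the derivatives uniformly Cauchy in operator norm: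
    -- the bound `ε ρ / 4` on the ball becomes `ε / 2`.
    have hcauchy : UniformCauchySeqOn (fun m : ℕ => fderiv ℝ (N^[m])) atTop U := by
      rw [Metric.uniformCauchySeqOn_iff]
      intro ε hε
      obtain ⟨M, hM⟩ := Metric.uniformCauchySeqOn_iff.1 hP'.uniformCauchySeqOn
        (ε * ρ / 4) (by positivity)
      refine ⟨M, fun m hm l hl x hx => ?_⟩
      rw [dist_eq_norm]
      refine (norm_le_of_forall_ball (C := ε * ρ / 4) hρ (by positivity) fun ξ hξ => ?_).trans_lt ?_
      · have h1 := hM m hm l hl (x, ξ) (hball _ ⟨hx.2, hξ⟩).1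
        rw [(hit x hx ξ m).2, (hit x hx ξ l).2, dist_eq_norm] at h1
        exact (norm_snd_le (_ : E × E)).trans h1.le
      · rw [div_lt_iff₀ hρ]; nlinarith [mul_pos hε hρ]
    have hlim : ∀ x ∈ U, ∃ L, Tendsto (fun m : ℕ => fderiv ℝ (N^[m]) x) atTop (𝓝 L) :=
      fun x hx => cauchySeq_tendsto_of_complete (hcauchy.cauchySeq hx)
    choose! L hL using hlim
    have hLu : TendstoUniformlyOn (fun m : ℕ => fderiv ℝ (N^[m])) L atTop U :=
      hcauchy.tendstoUniformlyOn_of_tendsto hL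
    have hPd : ∀ x ∈ U, HasFDerivAt P (L x) x := fun x hx =>
      hasFDerivAt_of_tendstoUniformlyOn hUo hLu
        (fun m y hy => (hit y hy 0 m).1.hasFDerivAt)
        (fun y hy => hP₀.tendsto_at hy.1) hx
    have hLP : ∀ x ∈ U, ∀ ξ ∈ Metric.ball (0 : E) ρ, L x ξ = (P' (x, ξ)).2 := by
      intro x hx ξ hξ
      have h1 : Tendsto (fun m : ℕ => fderiv ℝ (N^[m]) x ξ) atTop (𝓝 (L x ξ)) :=
        ((ContinuousLinearMap.apply ℝ E ξ).continuous.tendsto (L x)).comp (hL x hx)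
      have h2 := (hP'.tendsto_at (hball (x, ξ) ⟨hx.2, hξ⟩).1).snd_nhds
      refine tendsto_nhds_unique h1 (h2.congr fun m => ?_)
      have := (hit x hx ξ m).2
      exact congrArg Prod.snd this
    have hLs : ContDiffOn ℝ r L U := by
      rw [contDiffOn_clm_apply]
      intro ξ
      -- The limit `P'` is controlled only for short `ξ`; as `L x` is linear, rescaling reaches
      -- every direction.
      obtain ⟨s, hs, hsξ⟩ : ∃ s : ℝ, s ≠ 0 ∧ s • ξ ∈ Metric.ball (0 : E) ρ := by
        refine ⟨ρ / (2 * (‖ξ‖ + 1)), by positivity, ?_⟩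
        rw [mem_ball_zero_iff, norm_smul, Real.norm_of_nonneg (by positivity), div_mul_eq_mul_div,
          div_lt_iff₀ (by positivity)]
        nlinarith [norm_nonneg ξ]
      have h1 : ContDiffOn ℝ r (fun x => s⁻¹ • (P' (x, s • ξ)).2) U := by
        intro x hx
        have h2 : ContDiffAt ℝ r (fun x => P' (x, s • ξ)) x :=
          ContDiffAt.comp (g := P') x (hball _ ⟨hx.2, hsξ⟩).2
            (contDiffAt_id.prodMk contDiffAt_const)
        exact (h2.snd.const_smul s⁻¹).contDiffWithinAt
      refine h1.congr fun x hx => ?_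
      rw [← hLP x hx _ hsξ, map_smul, smul_smul, inv_mul_cancel₀ hs, one_smul]
    refine ⟨U, hUo.mem_nhds hxU, P, ?_, hP₀.mono inter_subset_left⟩
    push_cast
    rw [contDiffAt_succ_iff_hasFDerivAt]
    exact ⟨L, ⟨U, hUo.mem_nhds hxU, hPd⟩, hLs.contDiffAt (hUo.mem_nhds hxU)⟩

end AttractingFixedPointsSmooth

/-! ### The fibres of a normal projection as a foliation. -/

section FibreFoliation

variable {n : ℕ}

namespace IsNormalProjection

variable {M D : Set (Eucl n)} {P : Eucl n → Eucl n} (h : IsNormalProjection M D P)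
include h

/-- Near each of its points, `M` has a neighbourhood on which the fibres of the projection are
connected and on which they are the fibres of a submersion `L ∘ P` with `L` linear. -/
theorem exists_foliationChart {d c : ℕ} (hdc : d + c = n) {k : ℕ∞} (hk : 1 ≤ k)
    (hM : IsSubmanifold k c M) {q : Eucl n} (hq : q ∈ M) :
    ∃ (V : Set (Eucl n)) (L : Eucl n →L[ℝ] Eucl d), IsOpen V ∧ q ∈ V ∧ V ⊆ D ∧ MapsTo P V V ∧
      (∀ y ∈ V, Function.Surjective (fderiv ℝ (fun x => L (P x)) y)) ∧
      (∀ y ∈ V, ∀ z ∈ V, L (P y) = L (P z) → P y = P z) ∧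
      ∀ p ∈ M, p ∈ V → IsPreconnected {x ∈ V | P x = p} := by
  obtain ⟨W, G, hW, hqW, hG, hsurj, hMW⟩ := hM q hq
  have hT := tangentSpaceAt_eq_ker_fderiv hW hG hk hsurj hMW hq hqW
  have hG0 : ∀ y ∈ M, y ∈ W → G y = 0 := fun y hy hyW =>
    (hMW.subset ⟨hy, hyW⟩ : y ∈ {y ∈ W | G y = 0}).2
  have hk1 : (1 : WithTop ℕ∞) ≤ k := WithTop.coe_le_coe.2 hk
  have hGq : HasStrictFDerivAt G (fderiv ℝ G q) q :=
    ((hG.contDiffAt (hW.mem_nhds hqW)).of_le hk1).hasStrictFDerivAt one_ne_zero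
  have hqD := h.subset hq
  have hPq : HasStrictFDerivAt P (fderiv ℝ P q) q :=
    (h.contDiffOn.contDiffAt (h.isOpen.mem_nhds hqD)).hasStrictFDerivAt two_ne_zero
  set J := fderiv ℝ G q with hJ
  have hJs : Function.Surjective J := hsurj q hqW
  -- The orthogonal projection onto the tangent space at `q`; it will equal `DP(q)`. The map `L`
  -- below is `Q` with its image identified with `ℝ^d`.
  set Q : Eucl n →L[ℝ] Eucl n := ContinuousLinearMap.id ℝ _ - rightPinv J ∘L J with hQ
  have hQa : ∀ v, Q v = v - rightPinv J (J v) := fun v => rfl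
  have hQJ : ∀ v, Q v ∈ LinearMap.ker (J : Eucl n →ₗ[ℝ] Eucl c) := fun v => by
    simp [hQa, apply_rightPinv hJs]
  have hQid : ∀ v, J v = 0 → Q v = v := fun v hv => by simp [hQa, hv]
  have hQQ : ∀ v, Q (Q v) = Q v := fun v => hQid _ (hQJ v)
  have hQp : ∀ u, Q (rightPinv J u) = 0 := fun u => by simp [hQa, apply_rightPinv hJs]
  have hfr : Module.finrank ℝ (LinearMap.ker (J : Eucl n →ₗ[ℝ] Eucl c)) =
      Module.finrank ℝ (Eucl d) := by
    have h1 := LinearMap.finrank_range_add_finrank_ker (J : Eucl n →ₗ[ℝ] Eucl c)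
    rw [LinearMap.range_eq_top.2 hJs, finrank_top] at h1
    simp only [finrank_euclideanSpace, Fintype.card_fin] at h1 ⊢
    omega
  set ι := ContinuousLinearEquiv.ofFinrankEq hfr with hι
  set L : Eucl n →L[ℝ] Eucl d := (ι : _ →L[ℝ] Eucl d) ∘L Q.codRestrict _ hQJ with hL
  have hLQ : ∀ v w, L v = L w ↔ Q v = Q w := fun v w => by
    simp [hL, Subtype.ext_iff]
  have hLs : Function.Surjective L := fun u =>
    ⟨ι.symm u, by
      have : Q.codRestrict _ hQJ (ι.symm u : Eucl n) = ι.symm u :=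
        Subtype.ext (hQid _ (ι.symm u).2)
      simp [hL, this]⟩
  -- `DΦ(q) = Q + J† J` is the identity, so `Φ` is a local coordinate system. As `G = 0` on `M`, in
  -- these coordinates `P` becomes the linear projection `Q`, and its fibres become the affine sets
  -- on which `Q` is constant.
  set Φ : Eucl n → Eucl n := fun x => Q (P x) + rightPinv J (G x) with hΦ
  have hPd : ∀ v, fderiv ℝ P q v = Q v := by
    intro v
    have e : v = Q v + rightPinv J (J v) := by simp [hQa]
    have h1 : fderiv ℝ P q (Q v) = Q v :=
      h.fderiv_apply_tangent hq (by rw [hT]; exact hQJ v)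
    have h2 : fderiv ℝ P q (rightPinv J (J v)) = 0 :=
      h.fderiv_orthogonal q hq _ (by rw [hT]; exact rightPinv_mem_orthogonal _ _)
    conv_lhs => rw [e, map_add, h1, h2, add_zero]
  have hΦd : HasStrictFDerivAt Φ
      ((ContinuousLinearEquiv.refl ℝ (Eucl n) : Eucl n ≃L[ℝ] Eucl n) : Eucl n →L[ℝ] Eucl n) q := by
    have h1 := (Q.hasStrictFDerivAt.comp q hPq).add
      ((rightPinv J).hasStrictFDerivAt.comp q hGq)
    have e : Q ∘L fderiv ℝ P q + rightPinv J ∘L J =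
        ((ContinuousLinearEquiv.refl ℝ (Eucl n) : Eucl n ≃L[ℝ] Eucl n) : Eucl n →L[ℝ] Eucl n) := by
      refine ContinuousLinearMap.ext fun v => ?_
      simp only [add_apply, ContinuousLinearMap.comp_apply, hPd, hQQ]
      simp [hQa]
    rw [e] at h1
    exact h1
  set e := hΦd.toOpenPartialHomeomorph Φ with he
  have heΦ : (e : Eucl n → Eucl n) = Φ := rfl
  have hqe : q ∈ e.source := hΦd.mem_toOpenPartialHomeomorph_source
  have hPqq := h.eq_self q hq
  have hΦq : Φ q = Q q := by simp [hΦ, hPqq, hG0 q hq hqW]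
  have hsd : ∀ y ∈ D, fderiv ℝ (fun x => L (P x)) y = L ∘L fderiv ℝ P y := fun y hy =>
    (L.hasFDerivAt.comp y (h.hasFDerivAt hy)).fderiv
  have hgood : ∀ᶠ x in 𝓝 q, x ∈ D ∧ P x ∈ e.source ∧ P x ∈ W ∧
      Function.Surjective (fderiv ℝ (fun x => L (P x)) x) := by
    have hPc : Tendsto P (𝓝 q) (𝓝 q) := by
      have := hPq.continuousAt.tendsto; rwa [hPqq] at this
    refine (h.isOpen.eventually_mem hqD).and ((hPc.eventually (e.open_source.eventually_mem hqe)).and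
      ((hPc.eventually (hW.eventually_mem hqW)).and ?_))
    have h1 : ContinuousAt (fun x => L ∘L fderiv ℝ P x) q :=
      continuousAt_const.clm_comp (h.contDiffAt_fderiv hqD).continuousAt
    have h2 : Function.Surjective (L ∘L fderiv ℝ P q) := fun u => by
      obtain ⟨v, rfl⟩ := hLs u
      refine ⟨v, ?_⟩
      rw [ContinuousLinearMap.comp_apply, hPd, hLQ, hQQ]
    filter_upwards [h1.eventually (isOpen_surjective.eventually_mem h2),
      h.isOpen.eventually_mem hqD] with x h3 h4
    rw [hsd x h4]; exact h3
  have hsymm : ∀ᶠ a in 𝓝 (Q q), a ∈ e.target ∧ (e.symm a ∈ D ∧ P (e.symm a) ∈ e.source ∧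
      P (e.symm a) ∈ W ∧ Function.Surjective (fderiv ℝ (fun x => L (P x)) (e.symm a))) := by
    have h1 : Q q ∈ e.target := by rw [← hΦq]; exact e.map_source hqe
    have h2 : Tendsto e.symm (𝓝 (Q q)) (𝓝 q) := by
      have := (e.continuousAt_symm h1).tendsto
      rwa [← hΦq, ← heΦ, e.left_inv hqe, heΦ, hΦq] at this
    exact (e.open_target.eventually_mem h1).and (h2.eventually hgood)
  obtain ⟨ρ, hρ, hball⟩ := Metric.eventually_nhds_iff_ball.1 hsymm
  -- A product of a tangential and a normal ball rather than one ball about `Q q`: it is visibly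
  -- stable under `Q`, hence `V` is stable under `P`, and its slices by fibres of `Q` are convex,
  -- hence connected.
  set box : Set (Eucl n) := Q ⁻¹' Metric.ball (Q q) (ρ / 2) ∩
    (ContinuousLinearMap.id ℝ (Eucl n) - Q) ⁻¹' Metric.ball 0 (ρ / 2) with hbox
  have hmem : ∀ a, a ∈ box ↔ ‖Q a - Q q‖ < ρ / 2 ∧ ‖a - Q a‖ < ρ / 2 := fun a => by
    simp [hbox, dist_eq_norm]
  have hboxb : box ⊆ Metric.ball (Q q) ρ := by
    intro a ha
    obtain ⟨h1, h2⟩ := (hmem a).1 ha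
    rw [mem_ball_iff_norm]
    have := norm_add_le (a - Q a) (Q a - Q q)
    rw [sub_add_sub_cancel] at this
    linarith
  have hboxo : IsOpen box := (Metric.isOpen_ball.preimage Q.continuous).inter
    (Metric.isOpen_ball.preimage (ContinuousLinearMap.continuous _))
  set V : Set (Eucl n) := e.source ∩ e ⁻¹' box with hV
  have hVgood : ∀ x ∈ V, x ∈ D ∧ P x ∈ e.source ∧ P x ∈ W ∧
      Function.Surjective (fderiv ℝ (fun x => L (P x)) x) := by
    intro x hx
    have := (hball _ (hboxb hx.2)).2
    rwa [e.left_inv hx.1] at this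
  have hQΦ : ∀ x, Q (Φ x) = Q (P x) := fun x => by simp [hΦ, hQQ, hQp]
  have hΦP : ∀ x ∈ D, P x ∈ W → Φ (P x) = Q (P x) := fun x hx hxW => by
    simp [hΦ, h.eq_self _ (h.mapsTo hx), hG0 _ (h.mapsTo hx) hxW]
  have hPmaps : MapsTo P V V := by
    intro x hx
    obtain ⟨g1, g2, g3, -⟩ := hVgood x hx
    refine ⟨g2, ?_⟩
    have hx2 : ‖Q (Φ x) - Q q‖ < ρ / 2 ∧ ‖Φ x - Q (Φ x)‖ < ρ / 2 := (hmem _).1 hx.2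
    refine (hmem (Φ (P x))).2 ?_
    rw [hQΦ] at hx2
    rw [hΦP x g1 g3, hQQ, sub_self, norm_zero]
    exact ⟨hx2.1, half_pos hρ⟩
  have hinj : ∀ y ∈ V, ∀ z ∈ V, L (P y) = L (P z) → P y = P z := by
    intro y hy z hz hyz
    obtain ⟨g1, g2, g3, -⟩ := hVgood y hy
    obtain ⟨k1, k2, k3, -⟩ := hVgood z hz
    refine e.injOn g2 k2 ?_
    rw [heΦ, hΦP y g1 g3, hΦP z k1 k3]
    exact (hLQ _ _).1 hyz
  refine ⟨V, L, e.isOpen_inter_preimage hboxo, ⟨hqe, ?_⟩, fun x hx => (hVgood x hx).1, hPmaps,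
    fun y hy => (hVgood y hy).2.2.2, hinj, fun p hp hpV => ?_⟩
  · refine (hmem (Φ q)).2 ?_
    simp [hΦq, hQQ, hρ]
  · have himg : {x ∈ V | P x = p} = e.symm '' (box ∩ {a | Q a = Q p}) := by
      ext x
      constructor
      · rintro ⟨hx, rfl⟩
        exact ⟨e x, ⟨hx.2, hQΦ x⟩, e.left_inv hx.1⟩
      · rintro ⟨a, ⟨ha, ha2⟩, rfl⟩
        have hat := (hball a (hboxb ha)).1
        have hr : Φ (e.symm a) = a := e.right_inv hat
        have hxV : e.symm a ∈ V := ⟨e.map_target hat, by rw [mem_preimage, e.right_inv hat]; exact ha⟩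
        refine ⟨hxV, ?_⟩
        rw [← h.eq_self p hp]
        refine hinj _ hxV _ hpV ((hLQ _ _).2 ?_)
        rw [← hQΦ, hr, h.eq_self p hp]
        exact ha2
    rw [himg]
    refine IsPreconnected.image (Convex.isPreconnected ?_) _ ?_
    · exact (((convex_ball _ _).linear_preimage (Q : Eucl n →ₗ[ℝ] Eucl n)).inter
        ((convex_ball _ _).linear_preimage
          ((ContinuousLinearMap.id ℝ (Eucl n) - Q : Eucl n →L[ℝ] Eucl n) : Eucl n →ₗ[ℝ] Eucl n))).inter
        ((convex_singleton (Q p)).linear_preimage (Q : Eucl n →ₗ[ℝ] Eucl n))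
    · exact e.continuousOn_symm.mono fun a ha => (hball a (hboxb ha.1)).1

/-- The fibres of a normal projection form a normal foliation of a smaller neighbourhood. -/
theorem exists_isNormalFoliation {d c : ℕ} (hdc : d + c = n) {k r : ℕ∞} (hk : 1 ≤ k)
    (hM : IsSubmanifold k c M) (hP : ContDiffOn ℝ (r : WithTop ℕ∞) P D) :
    ∃ D' ⊆ D, IsOpen D' ∧ M ⊆ D' ∧ IsNormalFoliation r d c M D' fun p => {x ∈ D' | P x = p} := by
  have hch := fun q : M => h.exists_foliationChart hdc hk hM q.2
  choose V L hVo hqV hVD hPV hsurj hinj hconn using hch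
  set D' := ⋃ q : M, V q with hD'
  have hMD' : M ⊆ D' := fun q hq => mem_iUnion.2 ⟨⟨q, hq⟩, hqV _⟩
  have hD'D : D' ⊆ D := iUnion_subset hVD
  have hcd : ∀ q : M, ContDiffOn ℝ (r : WithTop ℕ∞) (fun x => L q (P x)) (V q) := fun q =>
    (L q).contDiff.comp_contDiffOn (hP.mono (hVD q))
  have hVD' : ∀ q, V q ⊆ D' := fun q => subset_iUnion V q
  refine ⟨D', hD'D, isOpen_iUnion hVo, hMD', ?_⟩
  refine
    { isOpen := isOpen_iUnion hVo
      subset := hMD'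
      iUnion_eq := ?_
      disjoint := ?_
      connected := ?_
      submanifold := ?_
      chart := ?_
      mem_leaf := fun p hp => ⟨hMD' hp, h.eq_self p hp⟩
      orthogonal := ?_ }
  · ext x
    simp only [mem_iUnion, exists_prop]
    exact ⟨fun ⟨p, _, hx⟩ => hx.1, fun hx => ⟨P x, h.mapsTo (hD'D hx), hx, rfl⟩⟩
  · intro p _ q _ hpq
    exact Set.disjoint_left.2 fun x hx hx' => hpq (hx.2.symm.trans hx'.2)
  · intro p hp
    refine ⟨⟨p, hMD' hp, h.eq_self p hp⟩, isPreconnected_of_forall p fun x hx => ?_⟩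
    obtain ⟨q, hq⟩ := mem_iUnion.1 hx.1
    have hpV : p ∈ V q := by rw [← hx.2]; exact hPV q hq
    -- Since `P` maps `V q` to itself, the piece of the fibre in `V q` contains `p`; so the whole
    -- fibre is a union of connected pieces through `p`.
    exact ⟨{x ∈ V q | P x = p}, fun y hy => ⟨hVD' q hy.1, hy.2⟩, ⟨hpV, h.eq_self p hp⟩,
      ⟨hq, hx.2⟩, hconn q p hp hpV⟩
  · intro p hp x hx
    obtain ⟨q, hq⟩ := mem_iUnion.1 hx.1
    refine ⟨V q, fun y => L q (P y) - L q (P x), hVo q, hq, (hcd q).sub contDiffOn_const, ?_, ?_⟩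
    · intro y hy
      rw [fderiv_sub_const]
      exact hsurj q y hy
    · ext y
      constructor
      · rintro ⟨hy, hyV⟩
        exact ⟨hyV, by simp [hy.2, hx.2]⟩
      · rintro ⟨hyV, hy⟩
        exact ⟨⟨hVD' q hyV, (hinj q y hyV x hq (sub_eq_zero.1 hy)).trans hx.2⟩, hyV⟩
  · intro x hx
    obtain ⟨q, hq⟩ := mem_iUnion.1 hx
    refine ⟨V q, fun y => L q (P y), hVo q, hq, hVD' q, hcd q, hsurj q, ?_⟩
    intro y hy z hz hyz p _ hyp
    exact ⟨hVD' q hz, (hinj q y hy z hz hyz).symm.trans hyp.2⟩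
  · intro p hp
    have hpD := h.subset hp
    have hPp := h.eq_self p hp
    have hfd := h.hasFDerivAt hpD
    refine le_antisymm (fun w hw => ?_) fun w hw => ?_
    · have h0 : fderiv ℝ P p w = 0 := apply_eq_zero_of_mem_tangentSpaceAt hfd
        (Eventually.of_forall fun y (hy : y ∈ {x ∈ D' | P x = p}) => hy.2.trans hPp.symm) hw
      set T := tangentSpaceAt M p
      have e := T.starProjection_add_starProjection_orthogonal w
      have h1 : fderiv ℝ P p (T.starProjection w) = T.starProjection w :=
        h.fderiv_apply_tangent hp (Submodule.starProjection_apply_mem _ _)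
      have h2 : fderiv ℝ P p (Tᗮ.starProjection w) = 0 :=
        h.fderiv_orthogonal p hp _ (Submodule.starProjection_apply_mem _ _)
      -- `DP(p)` acts as the orthogonal projection onto `T`, so a vector it kills has no component
      -- in `T`.
      rw [← e, map_add, h1, h2, add_zero] at h0
      rw [h0, zero_add] at e
      rw [← e]
      exact Submodule.starProjection_apply_mem _ _
    · obtain ⟨q, hq⟩ := mem_iUnion.1 (hMD' hp)
      have hs : HasStrictFDerivAt (fun x => L q (P x)) (L q ∘L fderiv ℝ P p) p :=
        (L q).hasStrictFDerivAt.comp p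
          ((h.contDiffOn.contDiffAt (h.isOpen.mem_nhds hpD)).hasStrictFDerivAt two_ne_zero)
      have hss := hsurj q p hq
      rw [hs.hasFDerivAt.fderiv] at hss
      rw [tangentSpaceAt_eq_ker hs hss]
      · simp [h.fderiv_orthogonal p hp w hw]
      · filter_upwards [(hVo q).mem_nhds hq] with y hy
        refine ⟨fun hyp => by rw [hyp.2, hPp], fun hyp => ⟨hVD' q hy, ?_⟩⟩
        rw [hinj q y hy p hq hyp, hPp]

end IsNormalProjection

end FibreFoliation

theorem two_le_tsub_one {k : ℕ∞} (hk : 3 ≤ k) : 2 ≤ k - 1 := by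
  induction k with
  | top => simp
  | coe k => norm_cast at hk ⊢; omega

theorem tsub_one_add_one {k : ℕ∞} (hk : 3 ≤ k) : k - 1 + 1 = k := by
  induction k with
  | top => simp
  | coe k => norm_cast at hk ⊢; omega

/-! ### Newton's method near a regular zero set. -/

section NewtonBasin

variable {n c : ℕ} {F : Eucl n → Eucl c}

/-- The Newton map near the regular points of `F`. -/
noncomputable def regularNewtonMap (F : Eucl n → Eucl c) (x : Eucl n) : Eucl n :=
  x - rightPinv (fderiv ℝ F x) (F x)

theorem newtonMap_eq_regularNewtonMap {x : Eucl n} (hx : Function.Surjective (fderiv ℝ F x)) :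
    newtonMap F x = regularNewtonMap F x := by
  rw [newtonMap, regularNewtonMap, moorePenrose_eq_rightPinv hx]

theorem newtonMap_iterate_of_mem_zeroSet {p : Eucl n} (hp : p ∈ zeroSet F) (m : ℕ) :
    (newtonMap F)^[m] p = p := by
  refine Function.iterate_fixed ?_ m
  have : F p = 0 := hp
  simp [newtonMap, this]

theorem newtonLimit_of_mem_zeroSet {p : Eucl n} (hp : p ∈ zeroSet F) : newtonLimit F p = p := by
  refine Tendsto.limUnder_eq ?_
  simp [newtonMap_iterate_of_mem_zeroSet hp]

/-- Invariance of the limit under the iteration: it spreads smoothness from the zero set to the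
basin and determines the derivative of the limit map on the zero set. -/
theorem newtonLimit_iterate {x y : Eucl n}
    (h : Tendsto (fun m : ℕ => (newtonMap F)^[m] x) atTop (𝓝 y)) (j : ℕ) :
    newtonLimit F ((newtonMap F)^[j] x) = newtonLimit F x := by
  have h1 : newtonLimit F x = y := h.limUnder_eq
  rw [h1]
  refine Tendsto.limUnder_eq ?_
  simpa [← Function.iterate_add_apply, Function.comp_def] using h.comp (tendsto_add_atTop_nat j)

theorem isOpen_regularPoints (hF : ContDiff ℝ 1 F) :
    IsOpen {x | Function.Surjective (fderiv ℝ F x)} :=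
  isOpen_surjective.preimage (hF.continuous_fderiv one_ne_zero)

theorem contDiffAt_rightPinv_fderiv {r : ℕ} (hF : ContDiff ℝ (r + 1 : ℕ) F) {x : Eucl n}
    (hx : Function.Surjective (fderiv ℝ F x)) :
    ContDiffAt ℝ r (fun x => rightPinv (fderiv ℝ F x)) x :=
  ContDiffAt.comp (g := rightPinv) x (contDiffAt_rightPinv hx)
    (hF.fderiv_right (by simp)).contDiffAt

theorem contDiffAt_newtonMap {r : ℕ} (hF : ContDiff ℝ (r + 1 : ℕ) F) {x : Eucl n}
    (hx : Function.Surjective (fderiv ℝ F x)) : ContDiffAt ℝ r (newtonMap F) x := by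
  have hF1 : ContDiff ℝ 1 F := hF.of_le (by simp)
  have h1 : ContDiffAt ℝ r (regularNewtonMap F) x :=
    contDiffAt_id.sub ((contDiffAt_rightPinv_fderiv hF hx).clm_apply
      (hF.of_le (by exact_mod_cast Nat.le_succ r)).contDiffAt)
  refine h1.congr_of_eventuallyEq ?_
  filter_upwards [(isOpen_regularPoints hF1).mem_nhds hx] with y hy
  exact newtonMap_eq_regularNewtonMap hy

/-- The factor `B` in `F (N_F x) = B x (F x)`. -/
noncomputable def newtonFactor (F : Eucl n → Eucl c) (x : Eucl n) : Eucl c →L[ℝ] Eucl c :=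
  (∫ t in (0 : ℝ)..1, (fderiv ℝ F x - fderiv ℝ F (x - t • rightPinv (fderiv ℝ F x) (F x)))) ∘L
    rightPinv (fderiv ℝ F x)

/-- With `w = J† F(x)` one has `DF(x) w = F(x)`. Hence `t F(x) + F(x - t w)` has derivative `(DF(x)
- DF(x - t w)) w`; it runs from `F(x)` to `F(x) + F(x - w)`. -/
theorem apply_regularNewtonMap (hF : ContDiff ℝ 1 F) {x : Eucl n}
    (hx : Function.Surjective (fderiv ℝ F x)) :
    F (x - rightPinv (fderiv ℝ F x) (F x)) = newtonFactor F x (F x) := by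
  set w := rightPinv (fderiv ℝ F x) (F x) with hw
  have hc : Continuous fun t : ℝ => fderiv ℝ F x - fderiv ℝ F (x - t • w) :=
    continuous_const.sub ((hF.continuous_fderiv one_ne_zero).comp (by fun_prop))
  have hd : ∀ t : ℝ, HasDerivAt (fun t : ℝ => t • F x + F (x - t • w))
      ((fderiv ℝ F x - fderiv ℝ F (x - t • w)) w) t := by
    intro t
    have h1 : HasDerivAt (fun t : ℝ => x - t • w) (-w) t := by
      simpa using ((hasDerivAt_id t).smul_const w).const_sub x
    have h2 := ((hF.differentiable one_ne_zero) (x - t • w)).hasFDerivAt.comp_hasDerivAt t h1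
    have h3 := ((hasDerivAt_id t).smul_const (F x)).add h2
    have e : (fderiv ℝ F x - fderiv ℝ F (x - t • w)) w =
        (1 : ℝ) • F x + fderiv ℝ F (x - t • w) (-w) := by
      rw [sub_apply, hw, apply_rightPinv hx, map_neg, one_smul, sub_eq_add_neg]
    rw [e]
    exact h3
  have h4 := intervalIntegral.integral_eq_sub_of_hasDerivAt (a := 0) (b := 1)
    (fun t _ => hd t) (by
      exact (hc.clm_apply continuous_const).intervalIntegrable _ _)
  rw [newtonFactor, ContinuousLinearMap.comp_apply,
    ContinuousLinearMap.intervalIntegral_apply (hc.intervalIntegrable _ _), h4]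
  simp

theorem contDiffAt_newtonFactor {r : ℕ} (hF : ContDiff ℝ (r + 1 : ℕ) F) {x : Eucl n}
    (hx : Function.Surjective (fderiv ℝ F x)) : ContDiffAt ℝ r (newtonFactor F) x := by
  have hA := contDiffAt_rightPinv_fderiv hF hx
  have hF' : ContDiff ℝ r (fderiv ℝ F) := hF.fderiv_right (by simp)
  refine ContDiffAt.clm_comp (contDiffAt_intervalIntegral r
    (fun z : Eucl n × ℝ => fderiv ℝ F z.1 -
      fderiv ℝ F (z.1 - z.2 • rightPinv (fderiv ℝ F z.1) (F z.1))) x fun t _ => ?_) hA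
  have hfst : ContDiffAt ℝ r (fun z : Eucl n × ℝ => z.1) (x, t) := contDiffAt_fst
  have h1 : ContDiffAt ℝ r (fun z : Eucl n × ℝ => rightPinv (fderiv ℝ F z.1)) (x, t) :=
    ContDiffAt.comp (g := fun x => rightPinv (fderiv ℝ F x)) (x, t) hA hfst
  have h2 : ContDiffAt ℝ r (fun z : Eucl n × ℝ => F z.1) (x, t) :=
    ContDiffAt.comp (g := F) (x, t) (hF.of_le (by exact_mod_cast Nat.le_succ r)).contDiffAt hfst
  exact (hF'.contDiffAt.comp (x, t) hfst).sub (ContDiffAt.comp (g := fderiv ℝ F) (x, t)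
    hF'.contDiffAt (hfst.sub (contDiffAt_snd.smul (h1.clm_apply h2))))

theorem newtonFactor_of_mem_zeroSet {x : Eucl n} (hx0 : F x = 0) : newtonFactor F x = 0 := by
  simp [newtonFactor, hx0]

/-- Newton's method converges near every regular zero. -/
theorem exists_newtonBasin_at (hF : ContDiff ℝ 2 F) {x₀ : Eucl n} (h0 : F x₀ = 0)
    (hs : Function.Surjective (fderiv ℝ F x₀)) :
    ∃ U : Set (Eucl n), IsOpen U ∧ x₀ ∈ U ∧
      (∀ x ∈ U, ∀ m : ℕ, Function.Surjective (fderiv ℝ F ((newtonMap F)^[m] x)) ∧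
        (newtonMap F)^[m] x = (regularNewtonMap F)^[m] x) ∧
      ∀ x ∈ U, Tendsto (fun m : ℕ => (newtonMap F)^[m] x) atTop (𝓝 (newtonLimit F x)) ∧
        F (newtonLimit F x) = 0 := by
  have hF1 : ContDiff ℝ 1 F := hF.of_le one_le_two
  have hF11 : ContDiff ℝ (1 + 1 : ℕ) F := hF
  have hO := isOpen_regularPoints hF1
  obtain ⟨U, hUo, hxU, hUO, hUF, P, hP⟩ := exists_tendstoUniformlyOn_iterate
    hF.continuous.continuousAt (contDiffAt_rightPinv_fderiv hF11 hs).continuousAt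
    (contDiffAt_newtonFactor hF11 hs).continuousAt h0 (newtonFactor_of_mem_zeroSet h0)
    (eventually_of_mem (hO.mem_nhds hs) fun x hx => apply_regularNewtonMap hF1 hx)
    (hO.mem_nhds hs)
  have hit : ∀ x ∈ U, ∀ m : ℕ, (newtonMap F)^[m] x = (regularNewtonMap F)^[m] x := by
    intro x hx m
    induction m with
    | zero => rfl
    | succ m ih =>
      rw [Function.iterate_succ_apply', Function.iterate_succ_apply', ih]
      exact newtonMap_eq_regularNewtonMap (hUO x hx m)
  have hlim : ∀ x ∈ U, Tendsto (fun m : ℕ => (newtonMap F)^[m] x) atTop (𝓝 (P x)) := fun x hx =>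
    (hP.tendsto_at hx).congr fun m => (hit x hx m).symm
  refine ⟨U, hUo, hxU, fun x hx m => ⟨by rw [hit x hx m]; exact hUO x hx m, hit x hx m⟩,
    fun x hx => ?_⟩
  rw [show newtonLimit F x = P x from (hlim x hx).limUnder_eq]
  exact ⟨hlim x hx, tendsto_nhds_unique
    ((hF.continuous.tendsto _).comp (hP.tendsto_at hx)) (hUF x hx)⟩

theorem contDiffAt_newtonLimit_zero {r : ℕ} (hr : 1 ≤ r) (hF : ContDiff ℝ (r + 1 : ℕ) F)
    {x₀ : Eucl n} (h0 : F x₀ = 0) (hs : Function.Surjective (fderiv ℝ F x₀)) :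
    ContDiffAt ℝ r (newtonLimit F) x₀ := by
  have hF1 : ContDiff ℝ 1 F := hF.of_le (by simp)
  have hF2 : ContDiff ℝ 2 F := hF.of_le (by exact_mod_cast Nat.succ_le_succ hr)
  have hO := isOpen_regularPoints hF1
  obtain ⟨U, hU, P, hP, hPU⟩ := contDiffAt_limit_iterate r
    (hF.of_le (by exact_mod_cast Nat.le_succ r)).contDiffAt
    (contDiffAt_rightPinv_fderiv hF hs) (contDiffAt_newtonFactor hF hs) h0
    (newtonFactor_of_mem_zeroSet h0)
    (eventually_of_mem (hO.mem_nhds hs) fun x hx => apply_regularNewtonMap hF1 hx)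
  obtain ⟨U', hUo', hxU', hU', -⟩ := exists_newtonBasin_at hF2 h0 hs
  refine hP.congr_of_eventuallyEq ?_
  filter_upwards [hU, hUo'.mem_nhds hxU'] with x hx hx'
  exact ((hPU.tendsto_at hx).congr fun m => ((hU' x hx' m).2).symm).limUnder_eq

/-- A neighbourhood of the zero set on which Newton's method converges to a smooth limit map. -/
theorem exists_isNewtonDomain {k : ℕ∞} (hk : 3 ≤ k) (hF : ContDiff ℝ (k : WithTop ℕ∞) F)
    (hs : ∀ x ∈ zeroSet F, Function.Surjective (fderiv ℝ F x)) :
    ∃ D : Set (Eucl n), IsNewtonDomain (k - 1) F D := by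
  have hF2 : ContDiff ℝ 2 F := hF.of_le
    (show ((2 : ℕ∞) : WithTop ℕ∞) ≤ k from WithTop.coe_le_coe.2 (le_trans (by norm_num) hk))
  have hloc := fun q : zeroSet F => exists_newtonBasin_at hF2 q.2 (hs q q.2)
  choose U hUo hqU hreg hlim using hloc
  refine ⟨⋃ q, U q, isOpen_iUnion hUo, fun q hq => mem_iUnion.2 ⟨⟨q, hq⟩, hqU _⟩, ?_, ?_, ?_⟩
  · intro x hx
    obtain ⟨q, hq⟩ := mem_iUnion.1 hx
    exact (hlim q x hq).1
  · intro x hx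
    obtain ⟨q, hq⟩ := mem_iUnion.1 hx
    exact (hlim q x hq).2
  · rw [contDiffOn_iff_forall_nat_le]
    intro m hm x hx
    obtain ⟨q, hq⟩ := mem_iUnion.1 hx
    refine ContDiffAt.contDiffWithinAt ?_
    -- The order is raised to at least `1` because the smoothness result at zeros of `F` needs `F`
    -- to be `C²`.
    suffices hsuff : ContDiffAt ℝ (max m 1 : ℕ) (newtonLimit F) x from
      hsuff.of_le (by exact_mod_cast le_max_left m 1)
    set r := max m 1 with hr
    have hrk : ((r + 1 : ℕ) : ℕ∞) ≤ k := by
      have h1 : (r : ℕ∞) ≤ k - 1 := by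
        rcases max_choice m 1 with h | h <;> rw [hr, h]
        · exact hm
        · exact le_trans (by norm_num) (two_le_tsub_one hk)
      calc ((r + 1 : ℕ) : ℕ∞) = r + 1 := by push_cast; rfl
        _ ≤ k - 1 + 1 := by gcongr
        _ = k := tsub_one_add_one hk
    have hFr : ContDiff ℝ (r + 1 : ℕ) F := hF.of_le
      (show (((r + 1 : ℕ) : ℕ∞) : WithTop ℕ∞) ≤ k from WithTop.coe_le_coe.2 hrk)
    obtain ⟨hx1, hx2⟩ := hlim q x hq
    have hP := contDiffAt_newtonLimit_zero (le_max_right m 1) hFr hx2 (hs _ hx2)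
    -- Some iterate of `x` enters the neighbourhood of its limit where `newtonLimit F` is already
    -- smooth. Composing with that iterate of the Newton map, which preserves the limit, gives
    -- smoothness at `x`.
    obtain ⟨j, hj⟩ := (hx1.eventually (hP.eventually (by simp))).exists
    have hit : ContDiffAt ℝ r ((newtonMap F)^[j]) x :=
      contDiffAt_iterate (fun m => contDiffAt_newtonMap hFr (hreg q x hq m).1) j
    refine (ContDiffAt.comp (g := newtonLimit F) x hj hit).congr_of_eventuallyEq ?_
    filter_upwards [(hUo q).mem_nhds hq] with y hy
    exact (newtonLimit_iterate (hlim q y hy).1 j).symm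

theorem isSubmanifold_zeroSet {k : ℕ∞} (hk : 1 ≤ k) (hF : ContDiff ℝ (k : WithTop ℕ∞) F)
    (hs : ∀ x ∈ zeroSet F, Function.Surjective (fderiv ℝ F x)) :
    IsSubmanifold k c (zeroSet F) := fun x hx =>
  ⟨{x | Function.Surjective (fderiv ℝ F x)}, F,
    isOpen_regularPoints (hF.of_le (WithTop.coe_le_coe.2 hk)), hs x hx, hF.contDiffOn,
    fun _ hy => hy, by ext y; exact and_comm⟩

theorem tangentSpaceAt_zeroSet (hF : ContDiff ℝ 1 F) {p : Eucl n} (hp : p ∈ zeroSet F)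
    (hs : Function.Surjective (fderiv ℝ F p)) :
    tangentSpaceAt (zeroSet F) p = LinearMap.ker (fderiv ℝ F p : Eucl n →ₗ[ℝ] Eucl c) := by
  refine tangentSpaceAt_eq_ker (hF.contDiffAt.hasStrictFDerivAt one_ne_zero) hs
    (Eventually.of_forall fun y => ?_)
  rw [show F p = 0 from hp]
  rfl

/-- For the normal vectors, differentiate `N^∞ ∘ N = N^∞` at `p`. As `F p = 0`, the derivative of
`N` is `1 - J† J`, which kills every normal `w`; hence so does `DN^∞(p)`. -/
theorem IsNewtonDomain.isNormalProjection {k : ℕ∞} (hk : 3 ≤ k)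
    (hF : ContDiff ℝ (k : WithTop ℕ∞) F)
    (hs : ∀ x ∈ zeroSet F, Function.Surjective (fderiv ℝ F x)) {D : Set (Eucl n)}
    (hD : IsNewtonDomain (k - 1) F D) : IsNormalProjection (zeroSet F) D (newtonLimit F) where
  isOpen := hD.isOpen
  subset := hD.subset
  mapsTo := hD.mapsTo
  eq_self := fun p hp => newtonLimit_of_mem_zeroSet hp
  contDiffOn := hD.contDiffOn.of_le (show ((2 : ℕ∞) : WithTop ℕ∞) ≤ ((k - 1 : ℕ∞) : WithTop ℕ∞) from
    WithTop.coe_le_coe.2 (two_le_tsub_one hk))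
  fderiv_orthogonal := by
    intro p hp w hw
    have hFk : ∀ j : ℕ∞, j ≤ 3 → ContDiff ℝ (j : WithTop ℕ∞) F := fun j hj =>
      hF.of_le (WithTop.coe_le_coe.2 (hj.trans hk))
    have hF1 : ContDiff ℝ 1 F := hFk 1 (by norm_num)
    have hF2 : ContDiff ℝ (1 + 1 : ℕ) F := hFk 2 (by norm_num)
    have hp0 : F p = 0 := hp
    have hsp := hs p hp
    rw [tangentSpaceAt_zeroSet hF1 hp hsp] at hw
    have hPd : HasFDerivAt (newtonLimit F) (fderiv ℝ (newtonLimit F) p) p :=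
      ((hD.contDiffOn.contDiffAt (hD.isOpen.mem_nhds (hD.subset hp))).differentiableAt (by
        intro h0
        have h1 : k - 1 = 0 := by exact_mod_cast h0
        have h2 : (2 : ℕ∞) ≤ k - 1 := two_le_tsub_one hk
        rw [h1] at h2
        exact absurd h2 (by norm_num))).hasFDerivAt
    have hNd : HasFDerivAt (newtonMap F) (ContinuousLinearMap.id ℝ (Eucl n) -
        ((rightPinv (fderiv ℝ F p)).comp (fderiv ℝ F p) +
          (fderiv ℝ (fun x => rightPinv (fderiv ℝ F x)) p).flip (F p))) p := by
      have h1 := (hasFDerivAt_id p).sub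
        (((contDiffAt_rightPinv_fderiv hF2 hsp).differentiableAt (by simp)).hasFDerivAt.clm_apply
          ((hF1.differentiable one_ne_zero) p).hasFDerivAt)
      refine h1.congr_of_eventuallyEq ?_
      filter_upwards [(isOpen_regularPoints hF1).mem_nhds hsp] with y hy
      exact newtonMap_eq_regularNewtonMap hy
    have hNp : newtonMap F p = p := newtonMap_iterate_of_mem_zeroSet hp 1
    rw [← hNp] at hPd
    have hcomp := hPd.comp p hNd
    have heq : newtonLimit F ∘ newtonMap F =ᶠ[𝓝 p] newtonLimit F := by
      filter_upwards [hD.isOpen.mem_nhds (hD.subset hp)] with y hy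
      exact newtonLimit_iterate (hD.tendsto y hy) 1
    have h3 := hcomp.congr_of_eventuallyEq heq.symm
    rw [hNp] at hPd
    have h4 := DFunLike.congr_fun (hPd.unique h3) w
    rw [hNp] at h4
    simp only [ContinuousLinearMap.comp_apply, sub_apply, hp0, map_zero, add_zero, rightPinv_apply_of_mem_orthogonal hsp hw, ContinuousLinearMap.id_apply, sub_self] at h4
    exact h4

theorem IsNewtonDomain.isRetractionOfOrder {k : ℕ∞} (hk : 3 ≤ k)
    (hF : ContDiff ℝ (k : WithTop ℕ∞) F)
    (hs : ∀ x ∈ zeroSet F, Function.Surjective (fderiv ℝ F x)) {D : Set (Eucl n)}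
    (hD : IsNewtonDomain (k - 1) F D) :
    IsRetractionOfOrder k 2 (zeroSet F) (retractionDomain (zeroSet F) D) (newtonRetraction F) :=
  (hD.isNormalProjection hk hF hs).isRetractionOfOrder hk
    (isSubmanifold_zeroSet (le_trans (by norm_num) hk) hF hs) hD.contDiffOn

theorem exists_newtonFoliation {d : ℕ} (hdc : d + c = n) {k : ℕ∞} (hk : 3 ≤ k)
    (hF : ContDiff ℝ (k : WithTop ℕ∞) F)
    (hs : ∀ x ∈ zeroSet F, Function.Surjective (fderiv ℝ F x)) :
    ∃ D : Set (Eucl n), IsNewtonDomain (k - 1) F D ∧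
      IsNormalFoliation (k - 1) d c (zeroSet F) D (newtonLeaf F D) ∧
      IsCanonicalProjection (zeroSet F) D (newtonLeaf F D) (newtonLimit F) := by
  obtain ⟨D, hD⟩ := exists_isNewtonDomain hk hF hs
  have hk1 : 1 ≤ k := le_trans (by norm_num) hk
  obtain ⟨D', hD', hDo, hMD, hfol⟩ :=
    (hD.isNormalProjection hk hF hs).exists_isNormalFoliation hdc hk1
      (isSubmanifold_zeroSet hk1 hF hs) hD.contDiffOn
  exact ⟨D', ⟨hDo, hMD, fun x hx => hD.tendsto x (hD' hx), hD.mapsTo.mono_left hD',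
    hD.contDiffOn.mono hD'⟩, hfol, fun x hx => ⟨hD.mapsTo (hD' hx), hx, rfl⟩⟩

end NewtonBasin

/-! ### Local sections and comparison of fibres of submersions. -/

section Submersions

variable {E V : Type*} [NormedAddCommGroup E] [InnerProductSpace ℝ E]

/-- A submersion has local sections. -/
theorem exists_local_section [NormedAddCommGroup V] [NormedSpace ℝ V] [FiniteDimensional ℝ V]
    {m : ℕ} (hm : 1 ≤ m) {s : E → V} {y : E} (hs : ContDiffAt ℝ m s y)
    (hsurj : Function.Surjective (fderiv ℝ s y)) :
    ∃ σ : V → E, σ (s y) = y ∧ ContDiffAt ℝ m σ (s y) ∧ ∀ᶠ u in 𝓝 (s y), s (σ u) = u := by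
  have := FiniteDimensional.complete ℝ V
  obtain ⟨B, hB⟩ := (fderiv ℝ s y).exists_rightInverse_of_surjective
    (LinearMap.range_eq_top.2 hsurj)
  have hm0 : ((m : ℕ) : WithTop ℕ∞) ≠ 0 := by
    have : m ≠ 0 := by omega
    exact_mod_cast this
  have haff : ContDiffAt ℝ m (fun w => y + B w) 0 := by fun_prop
  -- Restricting `s` to the affine slice `y + B w` gives a map with derivative the identity at `0`;
  -- its local inverse provides the section.
  set f : V → V := fun w => s (y + B w) with hf
  have hf0 : f 0 = s y := by simp [hf]
  have hfs : ContDiffAt ℝ m f 0 := ContDiffAt.comp (g := s) 0 (by simpa using hs) haff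
  have hfd : HasStrictFDerivAt f
      ((ContinuousLinearEquiv.refl ℝ V : V ≃L[ℝ] V) : V →L[ℝ] V) 0 := by
    have h1 : HasStrictFDerivAt s (fderiv ℝ s y) (y + B 0) := by
      simpa using hs.hasStrictFDerivAt hm0
    have h2 : HasStrictFDerivAt (fun w => y + B w) B 0 := B.hasStrictFDerivAt.const_add y
    have h3 := h1.comp 0 h2
    rw [hB] at h3
    exact h3
  set e := hfd.toOpenPartialHomeomorph f
  have h0e : (0 : V) ∈ e.source := hfd.mem_toOpenPartialHomeomorph_source
  have hsy : s y ∈ e.target := by rw [← hf0]; exact e.map_source h0e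
  have hsymm : e.symm (s y) = 0 := by rw [← hf0]; exact e.left_inv h0e
  refine ⟨fun u => y + B (e.symm u), by simp [hsymm], ?_, ?_⟩
  · refine contDiffAt_const.add (B.contDiff.contDiffAt.comp _ (e.contDiffAt_symm hsy
      (f₀' := ContinuousLinearEquiv.refl ℝ V) ?_ ?_))
    · rw [hsymm]; exact hfd.hasFDerivAt
    · rw [hsymm]; exact hfs
  · filter_upwards [e.open_target.mem_nhds hsy] with u hu
    exact e.right_inv hu

/-- If the fibre of a submersion `s` is contained in that of a submersion `G` to a space of the same
dimension, then the two fibres agree locally. -/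
theorem eventually_eq_of_fibre_subset [CompleteSpace E] [FiniteDimensional ℝ E]
    [NormedAddCommGroup V] [InnerProductSpace ℝ V]
    [CompleteSpace V] [FiniteDimensional ℝ V] {s G : E → V}
    {s' G' : E →L[ℝ] V} {x : E} (hs : HasStrictFDerivAt s s' x) (hG : HasStrictFDerivAt G G' x)
    (hss : Function.Surjective s') (hGs : Function.Surjective G')
    (hsG : ∀ᶠ z in 𝓝 x, s z = s x → G z = G x) : ∀ᶠ y in 𝓝 x, G y = G x → s y = s x := by
  have hle : LinearMap.ker (s' : E →ₗ[ℝ] V) ≤ LinearMap.ker (G' : E →ₗ[ℝ] V) := by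
    rw [← tangentSpaceAt_eq_ker (S := {z | s z = s x}) hs hss (Eventually.of_forall fun _ => Iff.rfl)]
    exact fun v hv => apply_eq_zero_of_mem_tangentSpaceAt hG.hasFDerivAt hsG hv
  have hker : LinearMap.ker (s' : E →ₗ[ℝ] V) = LinearMap.ker (G' : E →ₗ[ℝ] V) := by
    refine Submodule.eq_of_le_of_finrank_eq hle ?_
    have h1 := LinearMap.finrank_range_add_finrank_ker (s' : E →ₗ[ℝ] V)
    have h2 := LinearMap.finrank_range_add_finrank_ker (G' : E →ₗ[ℝ] V)
    rw [LinearMap.range_eq_top.2 hss] at h1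
    rw [LinearMap.range_eq_top.2 hGs] at h2
    omega
  have hsG' : ∀ v, s' (rightPinv G' (G' v)) = s' v := by
    intro v
    have h1 : rightPinv G' (G' v) - v ∈ LinearMap.ker (s' : E →ₗ[ℝ] V) := by
      rw [hker]; simp [apply_rightPinv hGs]
    rw [← sub_eq_zero, ← map_sub]
    exact h1
  set κ : E →L[ℝ] E := ContinuousLinearMap.id ℝ E - rightPinv s' ∘L s' with hκ
  have hκa : ∀ v, κ v = v - rightPinv s' (s' v) := fun v => rfl
  -- Both kernels agree by dimension, so `Θ` and `Ψ` complete `s` and `G` to local coordinates with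
  -- the same kernel component `κ`. For `y` in the fibre of `G`, the point `z` in the fibre of `s`
  -- with `κ z = κ y` also lies in the fibre of `G`; then `Ψ z = Ψ y`, so `z = y`.
  set Θ : E → E := fun y => rightPinv s' (s y) + κ y with hΘ
  set Ψ : E → E := fun y => rightPinv s' (s' (rightPinv G' (G y))) + κ y with hΨ
  have hΘd : HasStrictFDerivAt Θ
      ((ContinuousLinearEquiv.refl ℝ E : E ≃L[ℝ] E) : E →L[ℝ] E) x := by
    have h1 := ((rightPinv s').hasStrictFDerivAt.comp x hs).add κ.hasStrictFDerivAt
    have e : rightPinv s' ∘L s' + κ =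
        ((ContinuousLinearEquiv.refl ℝ E : E ≃L[ℝ] E) : E →L[ℝ] E) := by
      refine ContinuousLinearMap.ext fun v => ?_
      simp [hκa]
    rw [e] at h1
    exact h1
  have hΨd : HasStrictFDerivAt Ψ
      ((ContinuousLinearEquiv.refl ℝ E : E ≃L[ℝ] E) : E →L[ℝ] E) x := by
    have h1 := ((rightPinv s' ∘L s' ∘L rightPinv G').hasStrictFDerivAt.comp x hG).add
      κ.hasStrictFDerivAt
    have e : (rightPinv s' ∘L s' ∘L rightPinv G') ∘L G' + κ =
        ((ContinuousLinearEquiv.refl ℝ E : E ≃L[ℝ] E) : E →L[ℝ] E) := by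
      refine ContinuousLinearMap.ext fun v => ?_
      simp [hκa, hsG']
    rw [e] at h1
    exact h1
  set e := hΘd.toOpenPartialHomeomorph Θ with he
  set e' := hΨd.toOpenPartialHomeomorph Ψ with he'
  have hxe : x ∈ e.source := hΘd.mem_toOpenPartialHomeomorph_source
  have hxe' : x ∈ e'.source := hΨd.mem_toOpenPartialHomeomorph_source
  have ht : Θ x ∈ e.target := e.map_source hxe
  have harg : Tendsto (fun y => rightPinv s' (s x) + κ y) (𝓝 x) (𝓝 (Θ x)) :=
    (κ.continuous.tendsto x).const_add _
  have hz : Tendsto (fun y => e.symm (rightPinv s' (s x) + κ y)) (𝓝 x) (𝓝 x) := by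
    have h1 : Tendsto e.symm (𝓝 (Θ x)) (𝓝 x) := by
      have h2 := (e.continuousAt_symm ht).tendsto
      have h3 : e.symm (Θ x) = x := e.left_inv hxe
      rwa [h3] at h2
    exact h1.comp harg
  filter_upwards [hz.eventually hsG, hz.eventually (e'.open_source.eventually_mem hxe'),
    e'.open_source.mem_nhds hxe', harg (e.open_target.mem_nhds ht)] with y h1 h2 h3 h4 hy
  set z := e.symm (rightPinv s' (s x) + κ y) with hzdef
  have hΘz : rightPinv s' (s z) + κ z = rightPinv s' (s x) + κ y := e.right_inv h4
  have hsz : s z = s x := by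
    have := congrArg s' hΘz
    simpa [hκa, apply_rightPinv hss] using this
  have hκz : κ z = κ y := by
    rw [hsz] at hΘz
    exact add_left_cancel hΘz
  have hzy : z = y := by
    refine e'.injOn h2 h3 ?_
    change rightPinv s' (s' (rightPinv G' (G z))) + κ z = rightPinv s' (s' (rightPinv G' (G y))) + κ y
    rw [h1 hsz, hy, hκz]
  rw [← hzy, hsz]

end Submersions

/-! ### Smoothness of the canonical projection of a normal foliation. -/

section CanonicalProjection

variable {n d c : ℕ} {r : ℕ∞} {M D : Set (Eucl n)} {leaf : Eucl n → Set (Eucl n)}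
  {P : Eucl n → Eucl n}

theorem IsNormalFoliation.projection_eq (hfol : IsNormalFoliation r d c M D leaf)
    (hP : IsCanonicalProjection M D leaf P) {x p : Eucl n} (hp : p ∈ M) (hx : x ∈ leaf p) :
    P x = p := by
  have hxD : x ∈ D := by
    rw [← hfol.iUnion_eq]; exact mem_iUnion₂.2 ⟨p, hp, hx⟩
  by_contra hne
  exact Set.disjoint_left.1 (hfol.disjoint _ (hP x hxD).1 p hp hne) (hP x hxD).2 hx

/-- On a plaque, smoothness of the canonical projection is transported along the plaque. -/
theorem IsNormalFoliation.contDiffAt_projection_of_chart {m : ℕ} (hm : 1 ≤ m)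
    (hfol : IsNormalFoliation r d c M D leaf) (hP : IsCanonicalProjection M D leaf P)
    {W : Set (Eucl n)} {s : Eucl n → Eucl d} (hW : IsOpen W) (hWD : W ⊆ D)
    (hs : ContDiffOn ℝ m s W) (hsurj : ∀ y ∈ W, Function.Surjective (fderiv ℝ s y))
    (hleaf : ∀ y ∈ W, ∀ z ∈ W, s y = s z → ∀ p ∈ M, y ∈ leaf p → z ∈ leaf p)
    {y y' : Eucl n} (hy : y ∈ W) (hy' : y' ∈ W) (hyy' : s y = s y') (h : ContDiffAt ℝ m P y) :
    ContDiffAt ℝ m P y' := by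
  obtain ⟨σ, hσy, hσ, hsσ⟩ := exists_local_section hm (hs.contDiffAt (hW.mem_nhds hy)) (hsurj y hy)
  have hs' := hs.contDiffAt (hW.mem_nhds hy')
  have hsc : Tendsto s (𝓝 y') (𝓝 (s y)) := by
    rw [hyy']; exact hs'.continuousAt
  have hσc : Tendsto (fun z => σ (s z)) (𝓝 y') (𝓝 y) := by
    have h1 := hσ.continuousAt.tendsto
    rw [hσy] at h1
    exact h1.comp hsc
  -- The point `σ (s z)` lies near `y` on the plaque of `z`, so `P z = P (σ (s z))` for `z` near
  -- `y'`.
  have h1 : ContDiffAt ℝ m (fun z => P (σ (s z))) y' := by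
    rw [hyy'] at hσ hσy
    exact ContDiffAt.comp (g := P) y' (by rw [hσy]; exact h) (hσ.comp y' hs')
  refine h1.congr_of_eventuallyEq ?_
  filter_upwards [hW.mem_nhds hy', hσc (hW.mem_nhds hy), hsc.eventually hsσ] with z h2 h3 h4
  exact (hfol.projection_eq hP (hP z (hWD h2)).1
    (hleaf z h2 _ h3 h4.symm _ (hP z (hWD h2)).1 (hP z (hWD h2)).2)).symm

/-- A plaque function `s` and a defining function `G` of `M` are jointly a local coordinate system
at `p`: the kernel of `ds` consists of normal vectors and that of `dG` of tangent vectors. The point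
`σ (s y, 0)` is then in `M` and on the plaque of `y`, so it is `P y`. -/
theorem IsNormalFoliation.contDiffAt_projection_self {k : ℕ∞} {m : ℕ} (hdc : d + c = n) (hm : 1 ≤ m)
    (hmr : m ≤ r) (hmk : m ≤ k) (hM : IsSubmanifold k c M)
    (hfol : IsNormalFoliation r d c M D leaf) (hP : IsCanonicalProjection M D leaf P)
    {p : Eucl n} (hp : p ∈ M) : ContDiffAt ℝ m P p := by
  obtain ⟨W, s, hW, hpW, hWD, hs, hsurj, hleaf⟩ := hfol.chart p (hfol.subset hp)
  obtain ⟨W', G, hW', hpW', hG, hGsurj, hMW'⟩ := hM p hp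
  have hk1 : (1 : ℕ∞) ≤ k := le_trans (by exact_mod_cast hm) hmk
  have hT := tangentSpaceAt_eq_ker_fderiv hW' hG hk1 hGsurj hMW' hp hpW'
  have hm0 : ((m : ℕ) : WithTop ℕ∞) ≠ 0 := by
    have : m ≠ 0 := by omega
    exact_mod_cast this
  have hsp : ContDiffAt ℝ m s p := (hs.contDiffAt (hW.mem_nhds hpW)).of_le
    (show ((m : ℕ∞) : WithTop ℕ∞) ≤ r from WithTop.coe_le_coe.2 hmr)
  have hGp : ContDiffAt ℝ m G p := (hG.contDiffAt (hW'.mem_nhds hpW')).of_le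
    (show ((m : ℕ∞) : WithTop ℕ∞) ≤ k from WithTop.coe_le_coe.2 hmk)
  have hsd := hsp.hasStrictFDerivAt hm0
  have hGd := hGp.hasStrictFDerivAt hm0
  have hker : ∀ w, fderiv ℝ s p w = 0 → w ∈ (tangentSpaceAt M p)ᗮ := by
    intro w hw
    rw [← hfol.orthogonal p hp]
    have h1 : w ∈ tangentSpaceAt {y ∈ W | s y = s p} p := by
      rw [tangentSpaceAt_eq_ker hsd (hsurj p hpW)]
      · exact hw
      · filter_upwards [hW.mem_nhds hpW] with y hy
        exact ⟨fun h => h.2, fun h => ⟨hy, h⟩⟩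
    refine Submodule.span_mono ?_ h1
    rintro v ⟨γ, hγ, h0, hd⟩
    exact ⟨γ, hγ.mono fun t ht => hleaf p hpW _ ht.1 ht.2.symm p hp (hfol.mem_leaf p hp), h0, hd⟩
  have hpair : HasStrictFDerivAt (fun y => (s y, G y)) ((fderiv ℝ s p).prod (fderiv ℝ G p)) p :=
    hsd.prodMk hGd
  have hinj : Function.Injective ((fderiv ℝ s p).prod (fderiv ℝ G p)) := by
    rw [injective_iff_map_eq_zero]
    intro w hw
    have h1 : fderiv ℝ s p w = 0 := congrArg Prod.fst hw
    have h2 : fderiv ℝ G p w = 0 := congrArg Prod.snd hw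
    have h3 : w ∈ tangentSpaceAt M p := by rw [hT]; exact h2
    exact inner_self_eq_zero.1 ((Submodule.mem_orthogonal _ _).1 (hker w h1) w h3)
  have hpsurj : Function.Surjective (fderiv ℝ (fun y => (s y, G y)) p) := by
    rw [hpair.hasFDerivAt.fderiv]
    exact (LinearMap.injective_iff_surjective_of_finrank_eq_finrank
      (f := (((fderiv ℝ s p).prod (fderiv ℝ G p) : Eucl n →L[ℝ] Eucl d × Eucl c) :
        Eucl n →ₗ[ℝ] Eucl d × Eucl c)) (by simp [hdc])).1 hinj
  obtain ⟨σ, hσp, hσ, hsσ⟩ := exists_local_section hm (hsp.prodMk hGp) hpsurj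
  have hGp0 : G p = 0 := (hMW'.subset ⟨hp, hpW'⟩ : p ∈ {y ∈ W' | G y = 0}).2
  rw [hGp0] at hσp hσ hsσ
  have hs0 : ContDiffAt ℝ m (fun y => (s y, (0 : Eucl c))) p := hsp.prodMk contDiffAt_const
  have h1 : ContDiffAt ℝ m (fun y => σ (s y, 0)) p := ContDiffAt.comp (g := σ) p hσ hs0
  have hc : Tendsto (fun y => σ (s y, 0)) (𝓝 p) (𝓝 p) := by
    have := h1.continuousAt.tendsto; rwa [hσp] at this
  refine h1.congr_of_eventuallyEq ?_
  filter_upwards [hW.mem_nhds hpW, hc (hW.mem_nhds hpW), hc (hW'.mem_nhds hpW'),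
    (hs0.continuousAt.tendsto).eventually hsσ] with y h2 h3 h4 h5
  have h6 : σ (s y, 0) ∈ M := (hMW'.superset
    (show σ (s y, 0) ∈ {y ∈ W' | G y = 0} from ⟨h4, congrArg Prod.snd h5⟩)).1
  exact hfol.projection_eq hP h6
    (hleaf _ h3 y h2 (congrArg Prod.fst h5) _ h6 (hfol.mem_leaf _ h6))

/-- The canonical projection of a normal foliation is as smooth as the foliation. -/
theorem IsNormalFoliation.contDiffOn_projection {k : ℕ∞} (hdc : d + c = n) (hr : 1 ≤ r)
    (hrk : r ≤ k) (hM : IsSubmanifold k c M) (hfol : IsNormalFoliation r d c M D leaf)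
    (hP : IsCanonicalProjection M D leaf P) : ContDiffOn ℝ (r : WithTop ℕ∞) P D := by
  rw [contDiffOn_iff_forall_nat_le]
  intro m₀ hm₀ x hx
  refine ContDiffAt.contDiffWithinAt ?_
  suffices hsuff : ContDiffAt ℝ (max m₀ 1 : ℕ) P x from
    hsuff.of_le (by exact_mod_cast le_max_left m₀ 1)
  have hmr : ((max m₀ 1 : ℕ) : ℕ∞) ≤ r := by
    rcases max_choice m₀ 1 with h | h <;> rw [h]
    · exact hm₀
    · exact hr
  have hm : 1 ≤ max m₀ 1 := le_max_right _ _
  generalize max m₀ 1 = m at hmr hm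
  have hm0 : ((m : ℕ) : WithTop ℕ∞) ≠ 0 := by
    have : m ≠ 0 := by omega
    exact_mod_cast this
  have hmr' : ((m : ℕ) : WithTop ℕ∞) ≤ r :=
    (show ((m : ℕ∞) : WithTop ℕ∞) ≤ r from WithTop.coe_le_coe.2 hmr)
  obtain ⟨hpM, hxp⟩ := hP x hx
  set p := P x with hp
  -- Smoothness is known at `p`; on a connected leaf it suffices to pass it between nearby points of
  -- the leaf, in both directions.
  refine (hfol.connected p hpM).isPreconnected.induction₂'
    (fun y y' => ContDiffAt ℝ m P y → ContDiffAt ℝ m P y') (fun y hy => ?_)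
    (fun _ _ _ _ _ _ h1 h2 h => h2 (h1 h)) (hfol.mem_leaf p hpM) hxp
    (hfol.contDiffAt_projection_self hdc hm hmr (hmr.trans hrk) hM hP hpM)
  have hyD : y ∈ D := by
    rw [← hfol.iUnion_eq]; exact mem_iUnion₂.2 ⟨p, hpM, hy⟩
  obtain ⟨W, s, hW, hyW, hWD, hs, hsurj, hleaf⟩ := hfol.chart y hyD
  obtain ⟨W', G, hW', hyW', hG, hGsurj, hLW'⟩ := hfol.submanifold p hpM y hy
  have hGL : ∀ z ∈ W', (z ∈ leaf p ↔ G z = 0) := by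
    intro z hz
    have := Set.ext_iff.1 hLW' z
    simpa [hz] using this
  have hG0 : G y = 0 := (hGL y hyW').1 hy
  have hsd := ((hs.contDiffAt (hW.mem_nhds hyW)).of_le hmr').hasStrictFDerivAt hm0
  have hGd := ((hG.contDiffAt (hW'.mem_nhds hyW')).of_le hmr').hasStrictFDerivAt hm0
  -- The chart says that the plaque of `y` lies in the leaf, not that nearby points of the leaf lie
  -- on this plaque. The converse follows since the leaf is itself locally a fibre of a submersion
  -- to a space of the same dimension.
  have hfib : ∀ᶠ z in 𝓝 y, G z = G y → s z = s y := by
    refine eventually_eq_of_fibre_subset hsd hGd (hsurj y hyW) (hGsurj y hyW') ?_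
    filter_upwards [hW.mem_nhds hyW, hW'.mem_nhds hyW'] with z hz hz' hsz
    rw [hG0, ← hGL z hz']
    exact hleaf y hyW z hz hsz.symm p hpM hy
  refine eventually_nhdsWithin_iff.2 ?_
  filter_upwards [hfib, hW.mem_nhds hyW, hW'.mem_nhds hyW'] with z h1 h2 h3 hz
  have hsz : s z = s y := h1 (by rw [hG0]; exact (hGL z h3).1 hz)
  exact ⟨hfol.contDiffAt_projection_of_chart hm hP hW hWD (hs.of_le hmr') hsurj hleaf hyW h2
    hsz.symm, hfol.contDiffAt_projection_of_chart hm hP hW hWD (hs.of_le hmr') hsurj hleaf h2 hyW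
    hsz⟩

/-- The retraction induced by a normal foliation has order two. -/
theorem IsNormalFoliation.isRetractionOfOrder {k : ℕ∞} (hdc : d + c = n) (hk : 3 ≤ k)
    (hM : IsSubmanifold k c M) (hfol : IsNormalFoliation (k - 1) d c M D leaf)
    (hP : IsCanonicalProjection M D leaf P) :
    IsRetractionOfOrder k 2 M (retractionDomain M D) (inducedRetraction P) := by
  have h2 := two_le_tsub_one hk
  have hPs := hfol.contDiffOn_projection hdc (le_trans (by norm_num) h2) tsub_le_self hM hP
  have hPp : ∀ p ∈ M, P p = p := fun p hp => hfol.projection_eq hP hp (hfol.mem_leaf p hp)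
  have hP2 : ContDiffOn ℝ 2 P D := hPs.of_le
    (show ((2 : ℕ∞) : WithTop ℕ∞) ≤ ((k - 1 : ℕ∞) : WithTop ℕ∞) from WithTop.coe_le_coe.2 h2)
  have h : IsNormalProjection M D P :=
    { isOpen := hfol.isOpen
      subset := hfol.subset
      mapsTo := fun x hx => (hP x hx).1
      eq_self := hPp
      contDiffOn := hP2
      fderiv_orthogonal := fun p hp w hw => by
        rw [← hfol.orthogonal p hp] at hw
        refine apply_eq_zero_of_mem_tangentSpaceAt
          ((hP2.contDiffAt (hfol.isOpen.mem_nhds (hfol.subset hp))).differentiableAt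
            two_ne_zero).hasFDerivAt (Eventually.of_forall fun y hy => ?_) hw
        rw [hPp p hp, hfol.projection_eq hP hp hy] }
  exact h.isRetractionOfOrder hk hM hPs

end CanonicalProjection

/-- A chord is no longer than an arc. This turns the ambient lower bound on the circle into a
Riemannian one. -/
theorem enorm_sub_le_riemannianDist {E : Type*} [NormedAddCommGroup E] [InnerProductSpace ℝ E]
    (S : Set E) (x y : E) : ‖y - x‖ₑ ≤ riemannianDist S x y := by
  refine le_iInf₂ fun γ hγ => ?_
  rw [← hγ.source, ← hγ.target]
  exact enorm_sub_le_lintegral_derivWithin_Icc_of_contDiffOn_Icc hγ.contDiffOn zero_le_one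

/-! ### The unit circle: Newton retraction is radial projection and has order exactly two. -/

section Circle

/-- The basis vector of the one-dimensional Euclidean space. -/
noncomputable def unitVec : Eucl 1 := !₂[1]

theorem exists_eq_smul_unitVec (u : Eucl 1) : ∃ a : ℝ, u = a • unitVec :=
  ⟨u 0, by ext i; fin_cases i; simp [unitVec]⟩

theorem unitVec_ne_zero : unitVec ≠ 0 := fun h => by
  have := congrArg (fun u : Eucl 1 => u 0) h
  simp [unitVec] at this

theorem surjective_of_apply_eq_smul_unitVec {E : Type*} [NormedAddCommGroup E] [NormedSpace ℝ E]
    (A : E →L[ℝ] Eucl 1) {v : E} {a : ℝ} (ha : a ≠ 0) (h : A v = a • unitVec) :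
    Function.Surjective A := by
  intro u
  obtain ⟨b, rfl⟩ := exists_eq_smul_unitVec u
  exact ⟨(b / a) • v, by rw [map_smul, h, smul_smul, div_mul_cancel₀ b ha]⟩

theorem circleConstraint_eq (x : Eucl 2) : circleConstraint x = (‖x‖ ^ 2 - 1) • unitVec := by
  ext i; fin_cases i; simp [circleConstraint, unitVec]

theorem mem_zeroSet_circleConstraint {x : Eucl 2} : x ∈ zeroSet circleConstraint ↔ ‖x‖ = 1 := by
  have : x ∈ zeroSet circleConstraint ↔ circleConstraint x = 0 := Iff.rfl
  rw [this, circleConstraint_eq, smul_eq_zero, or_iff_left unitVec_ne_zero, sub_eq_zero,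
    pow_eq_one_iff_of_nonneg (norm_nonneg x) two_ne_zero]

theorem contDiff_circleConstraint {r : WithTop ℕ∞} : ContDiff ℝ r circleConstraint := by
  rw [funext circleConstraint_eq]
  exact ((contDiff_norm_sq ℝ).sub contDiff_const).smul contDiff_const

theorem fderiv_circleConstraint (x v : Eucl 2) :
    fderiv ℝ circleConstraint x v = (2 * inner ℝ x v) • unitVec := by
  have h1 : HasFDerivAt circleConstraint ((2 • innerSL ℝ x).smulRight unitVec) x := by
    rw [funext circleConstraint_eq]
    exact ((hasStrictFDerivAt_norm_sq x).hasFDerivAt.sub_const 1).smul_const unitVec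
  rw [h1.fderiv]
  simp

theorem surjective_fderiv_circleConstraint {x : Eucl 2} (hx : x ≠ 0) :
    Function.Surjective (fderiv ℝ circleConstraint x) := by
  refine surjective_of_apply_eq_smul_unitVec _ (v := x) (a := 2 * inner ℝ x x) ?_
    (fderiv_circleConstraint x x)
  simpa using hx

theorem ne_zero_of_mem_circle {x : Eucl 2} (hx : x ∈ zeroSet circleConstraint) : x ≠ 0 := by
  rw [mem_zeroSet_circleConstraint] at hx
  rintro rfl
  simp at hx

theorem mem_tangentSpaceAt_circle {x v : Eucl 2} (hx : x ∈ zeroSet circleConstraint) :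
    v ∈ tangentSpaceAt (zeroSet circleConstraint) x ↔ inner ℝ x v = 0 := by
  rw [tangentSpaceAt_zeroSet contDiff_circleConstraint hx
    (surjective_fderiv_circleConstraint (ne_zero_of_mem_circle hx))]
  change fderiv ℝ circleConstraint x v = 0 ↔ _
  rw [fderiv_circleConstraint, smul_eq_zero, or_iff_left unitVec_ne_zero]
  simp

theorem newtonMap_circleConstraint {x : Eucl 2} (hx : x ≠ 0) :
    newtonMap circleConstraint x = ((‖x‖ ^ 2 + 1) / (2 * ‖x‖ ^ 2)) • x := by
  have hs := surjective_fderiv_circleConstraint hx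
  have hn : ‖x‖ ≠ 0 := norm_ne_zero_iff.2 hx
  have h1 : fderiv ℝ circleConstraint x (((‖x‖ ^ 2 - 1) / (2 * ‖x‖ ^ 2)) • x) =
      circleConstraint x := by
    rw [fderiv_circleConstraint, circleConstraint_eq, inner_smul_right, real_inner_self_eq_norm_sq]
    congr 1
    field_simp
  have h2 : ((‖x‖ ^ 2 - 1) / (2 * ‖x‖ ^ 2)) • x ∈
      (LinearMap.ker (fderiv ℝ circleConstraint x : Eucl 2 →ₗ[ℝ] Eucl 1))ᗮ := by
    refine Submodule.smul_mem _ _ ((Submodule.mem_orthogonal _ _).2 fun v hv => ?_)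
    have hv : fderiv ℝ circleConstraint x v = 0 := hv
    rw [fderiv_circleConstraint, smul_eq_zero, or_iff_left unitVec_ne_zero] at hv
    rw [real_inner_comm]
    linarith
  rw [newtonMap_eq_regularNewtonMap hs, regularNewtonMap, ← h1,
    rightPinv_apply_of_mem_orthogonal hs h2]
  nth_rewrite 1 [← one_smul ℝ x]
  rw [← sub_smul]
  congr 1
  field_simp
  ring

theorem norm_newtonMap_circleConstraint {x : Eucl 2} (hx : x ≠ 0) :
    ‖newtonMap circleConstraint x‖ = (‖x‖ ^ 2 + 1) / (2 * ‖x‖) := by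
  have hn : ‖x‖ ≠ 0 := norm_ne_zero_iff.2 hx
  rw [newtonMap_circleConstraint hx, norm_smul, Real.norm_of_nonneg (by positivity)]
  field_simp

/-- On each ray the radius follows Heron's iteration `r ↦ (r + 1/r) / 2`. After one step the radius
is at least `1`, and from then on its excess over `1` is at least halved; hence the index `m + 1`.
-/
theorem iterate_newtonMap_circleConstraint {x : Eucl 2} (hx : x ≠ 0) (m : ℕ) :
    (newtonMap circleConstraint)^[m + 1] x =
        ‖(newtonMap circleConstraint)^[m + 1] x‖ • (‖x‖⁻¹ • x) ∧
      1 ≤ ‖(newtonMap circleConstraint)^[m + 1] x‖ ∧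
      ‖(newtonMap circleConstraint)^[m + 1] x‖ - 1 ≤
        (1 / 2) ^ m * (‖newtonMap circleConstraint x‖ - 1) := by
  have hpos : ∀ {y : Eucl 2}, y ≠ 0 → 0 < ‖y‖ := norm_pos_iff.2
  have hone : ∀ {y : Eucl 2}, y ≠ 0 → 1 ≤ ‖newtonMap circleConstraint y‖ := by
    intro y hy
    have := hpos hy
    rw [norm_newtonMap_circleConstraint hy, le_div_iff₀ (by positivity)]
    nlinarith [sq_nonneg (‖y‖ - 1)]
  have hdir : ∀ {y : Eucl 2}, y ≠ 0 → newtonMap circleConstraint y =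
      ‖newtonMap circleConstraint y‖ • (‖y‖⁻¹ • y) := by
    intro y hy
    have := (hpos hy).ne'
    rw [norm_newtonMap_circleConstraint hy, newtonMap_circleConstraint hy, smul_smul]
    congr 1
    field_simp
  induction m with
  | zero => exact ⟨hdir hx, hone hx, by simp⟩
  | succ m ih =>
    obtain ⟨i1, i2, i3⟩ := ih
    set y := (newtonMap circleConstraint)^[m + 1] x with hy
    have hy0 : y ≠ 0 := norm_pos_iff.1 (by linarith)
    rw [Function.iterate_succ_apply', ← hy]
    refine ⟨?_, hone hy0, ?_⟩
    · have e : ‖y‖⁻¹ • y = ‖x‖⁻¹ • x := by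
        nth_rewrite 2 [i1]
        rw [smul_smul, inv_mul_cancel₀ (hpos hy0).ne', one_smul]
      rw [← e]
      exact hdir hy0
    · rw [norm_newtonMap_circleConstraint hy0]
      have h1 : (‖y‖ ^ 2 + 1) / (2 * ‖y‖) - 1 ≤ (‖y‖ - 1) / 2 := by
        have hyp := hpos hy0
        rw [sub_le_iff_le_add, div_le_iff₀ (by positivity)]
        nlinarith
      rw [pow_succ (1 / 2 : ℝ) m]
      linarith

theorem tendsto_newtonMap_circleConstraint {x : Eucl 2} (hx : x ≠ 0) :
    Tendsto (fun m : ℕ => (newtonMap circleConstraint)^[m] x) atTop (𝓝 (‖x‖⁻¹ • x)) := by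
  rw [← tendsto_add_atTop_iff_nat 1]
  have h1 : Tendsto (fun m : ℕ => ‖(newtonMap circleConstraint)^[m + 1] x‖) atTop (𝓝 1) := by
    have h2 : Tendsto (fun m : ℕ => 1 + (1 / 2 : ℝ) ^ m * (‖newtonMap circleConstraint x‖ - 1))
        atTop (𝓝 1) := by
      simpa using ((tendsto_pow_atTop_nhds_zero_of_lt_one (by norm_num : (0 : ℝ) ≤ 1 / 2)
        (by norm_num)).mul_const (‖newtonMap circleConstraint x‖ - 1)).const_add 1
    exact tendsto_of_tendsto_of_tendsto_of_le_of_le tendsto_const_nhds h2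
      (fun m => (iterate_newtonMap_circleConstraint hx m).2.1)
      (fun m => by linarith [(iterate_newtonMap_circleConstraint hx m).2.2])
  have h3 := h1.smul_const (‖x‖⁻¹ • x)
  rw [one_smul] at h3
  exact h3.congr fun m => (iterate_newtonMap_circleConstraint hx m).1.symm

theorem newtonLimit_circleConstraint {x : Eucl 2} (hx : x ≠ 0) :
    newtonLimit circleConstraint x = ‖x‖⁻¹ • x :=
  (tendsto_newtonMap_circleConstraint hx).limUnder_eq

theorem isNewtonDomain_circle : IsNewtonDomain ⊤ circleConstraint {0}ᶜ where
  isOpen := isOpen_compl_singleton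
  subset := fun _ hx => ne_zero_of_mem_circle hx
  tendsto := fun x hx => by
    rw [newtonLimit_circleConstraint hx]
    exact tendsto_newtonMap_circleConstraint hx
  mapsTo := fun x hx => by
    have hn : ‖x‖ ≠ 0 := norm_ne_zero_iff.2 hx
    rw [newtonLimit_circleConstraint hx, mem_zeroSet_circleConstraint, norm_smul]
    simp [hn]
  contDiffOn := by
    refine ContDiffOn.congr (f := fun x : Eucl 2 => ‖x‖⁻¹ • x) (fun x hx => ?_)
      fun x hx => newtonLimit_circleConstraint hx
    exact (((contDiffAt_norm ℝ hx).inv (norm_ne_zero_iff.2 hx)).smul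
      contDiffAt_id).contDiffWithinAt

/-- The rotation of the plane by a right angle. -/
noncomputable def rotate (p : Eucl 2) : Eucl 2 := !₂[-p 1, p 0]

theorem inner_rotate (p y : Eucl 2) : inner ℝ (rotate p) y = p 0 * y 1 - p 1 * y 0 := by
  simp [rotate, PiLp.inner_apply, Fin.sum_univ_two]
  ring

theorem inner_rotate_rotate {p : Eucl 2} (hp : ‖p‖ = 1) : inner ℝ (rotate p) (rotate p) = 1 := by
  have h : ‖p‖ ^ 2 = 1 := by rw [hp, one_pow]
  rw [EuclideanSpace.real_norm_sq_eq, Fin.sum_univ_two] at h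
  rw [inner_rotate]
  simp [rotate]
  linarith

theorem inner_self_rotate (p : Eucl 2) : inner ℝ p (rotate p) = 0 := by
  rw [real_inner_comm, inner_rotate]
  ring

theorem eq_inner_smul_add {p : Eucl 2} (hp : ‖p‖ = 1) (y : Eucl 2) :
    y = inner ℝ p y • p + inner ℝ (rotate p) y • rotate p := by
  have h : ‖p‖ ^ 2 = 1 := by rw [hp, one_pow]
  rw [EuclideanSpace.real_norm_sq_eq, Fin.sum_univ_two] at h
  rw [inner_rotate]
  ext i
  fin_cases i
  · simp [rotate, PiLp.inner_apply, Fin.sum_univ_two]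
    linear_combination (-y 0) * h
  · simp [rotate, PiLp.inner_apply, Fin.sum_univ_two]
    linear_combination (-y 1) * h

/-- The coordinate along the rotated vector. -/
noncomputable def normalCoord (p : Eucl 2) : Eucl 2 →L[ℝ] Eucl 1 :=
  (innerSL ℝ (rotate p)).smulRight unitVec

theorem normalCoord_apply (p y : Eucl 2) :
    normalCoord p y = inner ℝ (rotate p) y • unitVec := rfl

theorem surjective_normalCoord {p : Eucl 2} (hp : ‖p‖ = 1) :
    Function.Surjective (normalCoord p) :=
  surjective_of_apply_eq_smul_unitVec _ (v := rotate p) one_ne_zero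
    (by rw [normalCoord_apply, inner_rotate_rotate hp])

theorem isOpen_halfPlane (p : Eucl 2) : IsOpen {y : Eucl 2 | 0 < inner ℝ p y} :=
  isOpen_lt continuous_const (continuous_const.inner continuous_id)

theorem ne_zero_of_inner_pos {p y : Eucl 2} (h : 0 < inner ℝ p y) : y ≠ 0 := by
  rintro rfl
  simp at h

theorem mem_newtonLeaf_circle {p y : Eucl 2} (hp : ‖p‖ = 1) :
    y ∈ newtonLeaf circleConstraint {0}ᶜ p ↔ 0 < inner ℝ p y ∧ normalCoord p y = 0 := by
  rw [normalCoord_apply, smul_eq_zero, or_iff_left unitVec_ne_zero]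
  constructor
  · rintro ⟨hy, h⟩
    rw [newtonLimit_circleConstraint hy] at h
    have hn : 0 < ‖y‖ := norm_pos_iff.2 hy
    have hy' : y = ‖y‖ • p := by rw [← h, smul_smul, mul_inv_cancel₀ hn.ne', one_smul]
    rw [hy', inner_smul_right, inner_smul_right, real_inner_self_eq_norm_sq, hp,
      real_inner_comm, inner_self_rotate]
    simp [hn]
  · rintro ⟨h1, h2⟩
    have hy0 := ne_zero_of_inner_pos h1
    have e := eq_inner_smul_add hp y
    rw [h2, zero_smul, add_zero] at e
    refine ⟨hy0, ?_⟩
    rw [newtonLimit_circleConstraint hy0]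
    set a : ℝ := inner ℝ p y
    rw [e, norm_smul, hp, mul_one, Real.norm_of_nonneg h1.le, smul_smul, inv_mul_cancel₀ h1.ne',
      one_smul]

theorem newtonLimit_smul_circle {y : Eucl 2} (hy : y ≠ 0) {a : ℝ} (ha : 0 < a) :
    newtonLimit circleConstraint (a • y) = newtonLimit circleConstraint y := by
  rw [newtonLimit_circleConstraint hy, newtonLimit_circleConstraint (smul_ne_zero ha.ne' hy),
    norm_smul, Real.norm_of_nonneg ha.le, smul_smul]
  congr 1
  field_simp

theorem isNormalFoliation_circle : IsNormalFoliation ⊤ 1 1 (zeroSet circleConstraint) {0}ᶜ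
    (newtonLeaf circleConstraint {0}ᶜ) where
  isOpen := isOpen_compl_singleton
  subset := isNewtonDomain_circle.subset
  iUnion_eq := by
    ext x
    simp only [mem_iUnion, exists_prop]
    exact ⟨fun ⟨p, _, hx⟩ => hx.1, fun hx => ⟨_, isNewtonDomain_circle.mapsTo hx, hx, rfl⟩⟩
  disjoint := fun p _ q _ hpq =>
    Set.disjoint_left.2 fun x hx hx' => hpq (hx.2.symm.trans hx'.2)
  connected := fun p hp => by
    have hp1 := mem_zeroSet_circleConstraint.1 hp
    have e : newtonLeaf circleConstraint {0}ᶜ p =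
        {y : Eucl 2 | 0 < inner ℝ p y} ∩ {y | normalCoord p y = 0} := by
      ext y; exact mem_newtonLeaf_circle hp1
    refine ⟨⟨p, ne_zero_of_mem_circle hp, newtonLimit_of_mem_zeroSet hp⟩, ?_⟩
    rw [e]
    refine Convex.isPreconnected (Convex.inter ?_ ?_)
    · exact (convex_Ioi (0 : ℝ)).linear_preimage (innerSL ℝ p : Eucl 2 →ₗ[ℝ] ℝ)
    · exact (convex_singleton (0 : Eucl 1) (𝕜 := ℝ)).linear_preimage
        (normalCoord p : Eucl 2 →ₗ[ℝ] Eucl 1)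
  submanifold := fun p hp x hx => by
    have hp1 := mem_zeroSet_circleConstraint.1 hp
    refine ⟨{y | 0 < inner ℝ p y}, normalCoord p, isOpen_halfPlane p,
      ((mem_newtonLeaf_circle hp1).1 hx).1, (normalCoord p).contDiff.contDiffOn, fun y _ => ?_, ?_⟩
    · rw [ContinuousLinearMap.fderiv]
      exact surjective_normalCoord hp1
    · ext y
      rw [mem_inter_iff, mem_newtonLeaf_circle hp1]
      exact ⟨fun h => h.1, fun h => ⟨h, h.1⟩⟩
  chart := fun x hx => by
    set p := newtonLimit circleConstraint x with hp
    have hp1 : ‖p‖ = 1 := mem_zeroSet_circleConstraint.1 (isNewtonDomain_circle.mapsTo hx)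
    have hW : ∀ y ∈ {y : Eucl 2 | 0 < inner ℝ p y},
        ContDiffAt ℝ ((⊤ : ℕ∞) : WithTop ℕ∞) (fun y => (inner ℝ p y)⁻¹ • normalCoord p y) y :=
      fun y hy => ((contDiffAt_const.inner ℝ contDiffAt_id).inv (ne_of_gt hy)).smul
        (normalCoord p).contDiff.contDiffAt
    -- The slope with respect to the axis `p` parametrizes the rays in the half-plane.
    refine ⟨{y | 0 < inner ℝ p y}, fun y => (inner ℝ p y)⁻¹ • normalCoord p y, isOpen_halfPlane p,
      ((mem_newtonLeaf_circle hp1).1 ⟨hx, rfl⟩).1, fun y hy => ne_zero_of_inner_pos hy,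
      fun y hy => (hW y hy).contDiffWithinAt, fun y hy => ?_, fun y hy z hz hyz q _ hyq => ?_⟩
    · have hd := ((hW y hy).differentiableAt (by simp)).hasFDerivAt
      have hc : HasDerivAt (fun t : ℝ => y + t • rotate p) (rotate p) 0 := by
        simpa using ((hasDerivAt_id (0 : ℝ)).smul_const (rotate p)).const_add y
      -- In the direction `rotate p` the denominator `⟨p, y⟩` is constant, so the derivative of the
      -- slope there is `1 / ⟨p, y⟩ ≠ 0`.
      have h1 := hd.comp_hasDerivAt_of_eq (0 : ℝ) hc (by simp)
      have h2 : HasDerivAt (fun t : ℝ => (inner ℝ p y)⁻¹ • normalCoord p (y + t • rotate p))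
          ((inner ℝ p y)⁻¹ • normalCoord p (rotate p)) 0 := by
        have hN : HasDerivAt (fun t : ℝ => normalCoord p (y + t • rotate p))
            (normalCoord p (rotate p)) 0 :=
          (normalCoord p).hasFDerivAt.comp_hasDerivAt (0 : ℝ) hc
        exact hN.const_smul (inner ℝ p y)⁻¹
      have h3 : (fun t : ℝ => (inner ℝ p (y + t • rotate p))⁻¹ • normalCoord p (y + t • rotate p)) =
          fun t : ℝ => (inner ℝ p y)⁻¹ • normalCoord p (y + t • rotate p) := by
        funext t
        rw [inner_add_right, inner_smul_right, inner_self_rotate, mul_zero, add_zero]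
      have h4 := h1.unique (h3 ▸ h2)
      rw [normalCoord_apply, inner_rotate_rotate hp1, one_smul] at h4
      exact surjective_of_apply_eq_smul_unitVec _ (inv_ne_zero (ne_of_gt hy)) h4
    · have hy' : 0 < inner ℝ p y := hy
      have hz' : 0 < inner ℝ p z := hz
      have h1 : (inner ℝ p y)⁻¹ * inner ℝ (rotate p) y = (inner ℝ p z)⁻¹ * inner ℝ (rotate p) z := by
        simp only [normalCoord_apply, smul_smul] at hyz
        exact smul_left_injective ℝ unitVec_ne_zero hyz
      have h2 : z = (inner ℝ p z / inner ℝ p y) • y := by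
        have ey := eq_inner_smul_add hp1 y
        have ez := eq_inner_smul_add hp1 z
        set a : ℝ := inner ℝ p y
        set b : ℝ := inner ℝ p z
        have h3 : inner ℝ (rotate p) z = b / a * inner ℝ (rotate p) y := by
          field_simp at h1 ⊢
          linarith
        refine Eq.trans ?_ (congrArg (fun u => (b / a) • u) ey).symm
        rw [ez, h3, smul_add, smul_smul, smul_smul, div_mul_cancel₀ _ hy'.ne']
      refine ⟨ne_zero_of_inner_pos hz, ?_⟩
      rw [h2, newtonLimit_smul_circle (ne_zero_of_inner_pos hy) (by positivity)]
      exact hyq.2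
  mem_leaf := fun p hp => ⟨ne_zero_of_mem_circle hp, newtonLimit_of_mem_zeroSet hp⟩
  orthogonal := fun p hp => by
    have hp1 := mem_zeroSet_circleConstraint.1 hp
    have h1 : tangentSpaceAt (newtonLeaf circleConstraint {0}ᶜ p) p =
        LinearMap.ker (normalCoord p : Eucl 2 →ₗ[ℝ] Eucl 1) := by
      refine tangentSpaceAt_eq_ker (normalCoord p).hasStrictFDerivAt (surjective_normalCoord hp1) ?_
      have hpp : 0 < inner ℝ p p := by rw [real_inner_self_eq_norm_sq, hp1]; norm_num
      filter_upwards [(isOpen_halfPlane p).mem_nhds hpp] with y hy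
      rw [mem_newtonLeaf_circle hp1, normalCoord_apply p p, real_inner_comm p (rotate p), inner_self_rotate,
        zero_smul]
      exact ⟨fun h => h.2, fun h => ⟨hy, h⟩⟩
    rw [h1]
    ext w
    rw [Submodule.mem_orthogonal]
    change normalCoord p w = 0 ↔ _
    rw [normalCoord_apply, smul_eq_zero, or_iff_left unitVec_ne_zero]
    refine ⟨fun hw v hv => ?_, fun h =>
      h _ ((mem_tangentSpaceAt_circle hp).2 (inner_self_rotate p))⟩
    rw [mem_tangentSpaceAt_circle hp] at hv
    rw [eq_inner_smul_add hp1 w, hw, zero_smul, add_zero, inner_smul_right, real_inner_comm p v, hv,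
      mul_zero]

theorem norm_add_sq_of_mem_tangentBundle_circle {x v : Eucl 2}
    (h : (x, v) ∈ tangentBundleOf (zeroSet circleConstraint)) : ‖x + v‖ ^ 2 = 1 + ‖v‖ ^ 2 := by
  have h1 : inner ℝ x v = 0 := (mem_tangentSpaceAt_circle h.1).1 h.2
  have h2 := mem_zeroSet_circleConstraint.1 h.1
  rw [norm_add_sq_real, h1]
  rw [show ‖x‖ = 1 from h2]
  ring

theorem add_ne_zero_of_mem_tangentBundle_circle {x v : Eucl 2}
    (h : (x, v) ∈ tangentBundleOf (zeroSet circleConstraint)) : x + v ≠ 0 := by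
  intro h0
  have := norm_add_sq_of_mem_tangentBundle_circle h
  rw [h0, norm_zero] at this
  nlinarith [sq_nonneg ‖v‖]

theorem retractionDomain_circle : retractionDomain (zeroSet circleConstraint) {0}ᶜ =
    tangentBundleOf (zeroSet circleConstraint) := by
  ext ⟨x, v⟩
  exact ⟨fun h => h.1, fun h => ⟨h, add_ne_zero_of_mem_tangentBundle_circle h⟩⟩

theorem isRetractionOfOrder_circle : IsRetractionOfOrder ⊤ 2 (zeroSet circleConstraint)
    (tangentBundleOf (zeroSet circleConstraint)) (newtonRetraction circleConstraint) := by
  rw [← retractionDomain_circle]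
  refine IsNewtonDomain.isRetractionOfOrder (k := ⊤) le_top contDiff_circleConstraint
    (fun x hx => surjective_fderiv_circleConstraint (ne_zero_of_mem_circle hx)) ?_
  simpa using isNewtonDomain_circle

/-- The radial projection is the closest-point projection to the circle. -/
theorem closestPoints_circle {y : Eucl 2} (hy : y ≠ 0) :
    closestPoints (zeroSet circleConstraint) y = {newtonLimit circleConstraint y} := by
  have hn : 0 < ‖y‖ := norm_pos_iff.2 hy
  have hmem := isNewtonDomain_circle.mapsTo (show y ∈ ({0}ᶜ : Set (Eucl 2)) from hy)
  have hd : dist y (newtonLimit circleConstraint y) = |‖y‖ - 1| := by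
    rw [newtonLimit_circleConstraint hy, dist_eq_norm]
    nth_rewrite 1 [← one_smul ℝ y]
    rw [← sub_smul, norm_smul, Real.norm_eq_abs, ← abs_of_pos hn, ← abs_mul, abs_of_pos hn]
    congr 1
    field_simp
  have hle : ∀ q ∈ zeroSet circleConstraint, |‖y‖ - 1| ≤ dist y q := by
    intro q hq
    rw [← mem_zeroSet_circleConstraint.1 hq, dist_eq_norm]
    exact abs_norm_sub_norm_le y q
  ext q
  constructor
  · rintro ⟨hq, hmin⟩
    have h1 := hmin _ hmem
    rw [hd, dist_eq_norm] at h1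
    have hq1 := mem_zeroSet_circleConstraint.1 hq
    have h2 : ‖y - q‖ ^ 2 ≤ (‖y‖ - 1) ^ 2 := by
      rw [← sq_abs (‖y‖ - 1)]
      exact pow_le_pow_left₀ (norm_nonneg _) h1 2
    rw [norm_sub_sq_real, hq1] at h2
    -- A minimizer attains equality in the Cauchy–Schwarz inequality, hence is a positive multiple
    -- of `y`.
    have h3 : inner ℝ y q = ‖y‖ * ‖q‖ :=
      le_antisymm (real_inner_le_norm y q) (by rw [hq1]; linarith)
    rw [inner_eq_norm_mul_iff_real, hq1, one_smul] at h3
    rw [mem_singleton_iff, newtonLimit_circleConstraint hy]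
    conv_rhs => rw [h3]
    rw [norm_smul, hq1, smul_smul]
    simp [hn.ne']
  · rintro rfl
    exact ⟨hmem, fun q hq => by rw [hd]; exact hle q hq⟩

/-- The geodesics of the unit circle. -/
theorem isExp_circle {x w y : Eucl 2} (hw : w ≠ 0)
    (h : IsExp (zeroSet circleConstraint) x w y) :
    y = Real.cos ‖w‖ • x + (Real.sin ‖w‖ / ‖w‖) • w := by
  obtain ⟨γ, a, b, ha, hb, hγ, h0, h1, rfl⟩ := h
  have ha0 : ‖w‖ ≠ 0 := norm_ne_zero_iff.2 hw
  have hI0 : (0 : ℝ) ∈ Ioo a b := ⟨ha, by linarith⟩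
  have hI1 : (1 : ℝ) ∈ Ioo a b := ⟨by linarith, hb⟩
  have hn : ∀ s ∈ Ioo a b, ‖γ s‖ = 1 := fun s hs => mem_zeroSet_circleConstraint.1 (hγ.mem s hs)
  have horth : ∀ s ∈ Ioo a b, inner ℝ (γ s) (deriv γ s) = 0 := fun s hs =>
    (mem_tangentSpaceAt_circle (hγ.mem s hs)).1 (hγ.deriv_mem hs)
  -- The acceleration is radial, and differentiating `⟨γ, γ'⟩ = 0` gives `⟨γ, γ''⟩ = -‖γ'‖²`: a
  -- harmonic oscillator of frequency `‖w‖`.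
  have hacc : ∀ s ∈ Ioo a b, deriv (deriv γ) s = -(‖w‖ ^ 2) • γ s := by
    intro s hs
    have h2 : inner ℝ (rotate (γ s)) (deriv (deriv γ) s) = 0 :=
      (Submodule.mem_orthogonal _ _).1 (hγ.acceleration s hs) _
        ((mem_tangentSpaceAt_circle (hγ.mem s hs)).2 (inner_self_rotate _))
    have h3 : HasDerivAt (fun s => inner ℝ (γ s) (deriv γ s))
        (inner ℝ (γ s) (deriv (deriv γ) s) + inner ℝ (deriv γ s) (deriv γ s)) s :=
      (hγ.hasDerivAt hs).inner ℝ (hγ.hasDerivAt_deriv hs)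
    have h4 := h3.unique ((hasDerivAt_const s (0 : ℝ)).congr_of_eventuallyEq
      (eventually_of_mem (isOpen_Ioo.mem_nhds hs) horth))
    rw [real_inner_self_eq_norm_sq, hγ.norm_deriv_eq hs hI0, h1] at h4
    have h5 := eq_inner_smul_add (hn s hs) (deriv (deriv γ) s)
    rw [h2, zero_smul, add_zero] at h5
    rw [h5]
    congr 1
    linarith
  set ω := ‖w‖ with hω
  have hcos : ∀ s : ℝ, HasDerivAt (fun s => Real.cos (ω * s)) (-Real.sin (ω * s) * ω) s := fun s =>
    by simpa using ((hasDerivAt_id s).const_mul ω).cos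
  have hsin : ∀ s : ℝ, HasDerivAt (fun s => Real.sin (ω * s)) (Real.cos (ω * s) * ω) s := fun s =>
    by simpa using ((hasDerivAt_id s).const_mul ω).sin
  -- This combination and the next undo the oscillator flow, so they are constant, with the initial
  -- values `x` and `w`. Solving the two equations at time `1` yields the formula.
  have hA : ∀ s ∈ Ioo a b,
      HasDerivAt (fun s => Real.cos (ω * s) • γ s - (Real.sin (ω * s) / ω) • deriv γ s) 0 s := by
    intro s hs
    have h2 := ((hcos s).smul (hγ.hasDerivAt hs)).sub
      (((hsin s).div_const ω).smul (hγ.hasDerivAt_deriv hs))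
    rw [hacc s hs] at h2
    refine h2.congr_deriv ?_
    rw [mul_div_cancel_right₀ _ ha0, smul_smul]
    have : Real.sin (ω * s) / ω * -ω ^ 2 = -Real.sin (ω * s) * ω := by field_simp
    rw [this]
    abel
  have hB : ∀ s ∈ Ioo a b,
      HasDerivAt (fun s => (Real.sin (ω * s) * ω) • γ s + Real.cos (ω * s) • deriv γ s) 0 s := by
    intro s hs
    have h2 := (((hsin s).mul_const ω).smul (hγ.hasDerivAt hs)).add
      ((hcos s).smul (hγ.hasDerivAt_deriv hs))
    rw [hacc s hs] at h2
    refine h2.congr_deriv ?_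
    rw [smul_smul, show Real.cos (ω * s) * -ω ^ 2 = -(Real.cos (ω * s) * ω * ω) by ring]
    simp only [neg_smul, neg_mul]
    abel
  have eA := isOpen_Ioo.is_const_of_deriv_eq_zero isPreconnected_Ioo
    (fun u hu => (hA u hu).differentiableAt.differentiableWithinAt)
    (fun u hu => (hA u hu).deriv) hI1 hI0
  have eB := isOpen_Ioo.is_const_of_deriv_eq_zero isPreconnected_Ioo
    (fun u hu => (hB u hu).differentiableAt.differentiableWithinAt)
    (fun u hu => (hB u hu).deriv) hI1 hI0
  simp only [mul_one, mul_zero, Real.cos_zero, Real.sin_zero, zero_div, zero_smul, one_smul,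
    sub_zero, zero_mul, zero_add, h0, h1] at eA eB
  rw [← eA, ← eB, smul_sub, smul_add]
  simp only [smul_smul]
  have e1 : Real.sin ω / ω * (Real.sin ω * ω) = Real.sin ω * Real.sin ω := by field_simp
  have e2 : Real.sin ω / ω * Real.cos ω = Real.cos ω * (Real.sin ω / ω) := mul_comm _ _
  rw [e1, e2, add_comm ((Real.sin ω * Real.sin ω) • γ 1), ← add_assoc, sub_add_cancel, ← add_smul,
    ← sq, ← sq, Real.cos_sq_add_sin_sq, one_smul]

/-- The expansions `τ - τ³/6` and `τ - τ³/2` differ by `τ³/3`; the constant `1/8` leaves room for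
the error terms. In particular `1/2` is weakened to `3/8`, which is valid for `τ² ≤ 1/4`. -/
theorem cube_div_eight_le {τ : ℝ} (h0 : 0 < τ) (h1 : τ ≤ 1 / 2) :
    τ ^ 3 / 8 ≤ Real.sin τ - (Real.sqrt (1 + τ ^ 2))⁻¹ * τ := by
  have h2 := Real.sin_gt_sub_cube h0
  have hq : τ ^ 2 ≤ 1 / 4 := by nlinarith
  have hs : 0 < Real.sqrt (1 + τ ^ 2) := Real.sqrt_pos.2 (by positivity)
  have h3 : (Real.sqrt (1 + τ ^ 2))⁻¹ ≤ 1 - 3 / 8 * τ ^ 2 := by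
    rw [inv_le_iff_one_le_mul₀ hs]
    refine one_le_sq_iff_one_le_abs _ |>.1 ?_ |>.trans_eq (abs_of_nonneg ?_)
    · rw [mul_pow, Real.sq_sqrt (by positivity)]
      nlinarith [mul_nonneg (sq_nonneg τ) (sub_nonneg.2 hq), pow_nonneg (sq_nonneg τ) 3]
    · exact mul_nonneg (by linarith) hs.le
  have h4 := mul_le_mul_of_nonneg_right h3 h0.le
  nlinarith [pow_pos h0 3]

theorem not_agreesWithExp_circle {x v : Eucl 2}
    (h : (x, v) ∈ tangentBundleOf (zeroSet circleConstraint)) (hv : v ≠ 0) :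
    ¬ AgreesWithExp (zeroSet circleConstraint) (newtonRetraction circleConstraint) 3 x v := by
  intro hagree
  have hv0 : 0 < ‖v‖ := norm_pos_iff.2 hv
  have hxv : inner ℝ x v = 0 := (mem_tangentSpaceAt_circle h.1).1 h.2
  have hle : (𝓝[>] (0 : ℝ)) ≤ 𝓝[≠] 0 := nhdsWithin_mono _ fun t ht => ne_of_gt ht
  have hev := (hagree.mono_left hle).eventually_lt_const
    (show 0 < ENNReal.ofReal (‖v‖ ^ 3 / 8) by
      rw [ENNReal.ofReal_pos]; positivity)
  have hexp : ∀ᶠ t in 𝓝[>] (0 : ℝ), (x, t • v) ∈ expDomain (zeroSet circleConstraint) :=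
    eventually_nhdsWithin_of_eventually_nhds (isRetractionOfOrder_circle.exp_defined x h.1 v h.2)
  have hsmall : ∀ᶠ t in 𝓝[>] (0 : ℝ), t * ‖v‖ < 1 / 2 := by
    refine eventually_nhdsWithin_of_eventually_nhds ?_
    have hc : ContinuousAt (fun t : ℝ => t * ‖v‖) 0 := by fun_prop
    exact hc.eventually_lt_const (by norm_num)
  obtain ⟨t, h1, h2, h3, ht⟩ :=
    (hev.and (hexp.and (hsmall.and eventually_mem_nhdsWithin))).exists
  have ht : 0 < t := ht
  have htv : t • v ≠ 0 := smul_ne_zero ht.ne' hv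
  have hnt : ‖t • v‖ = t * ‖v‖ := by rw [norm_smul, Real.norm_of_nonneg ht.le]
  have hmem : (x, t • v) ∈ tangentBundleOf (zeroSet circleConstraint) := h2.1
  have hE : expMap (zeroSet circleConstraint) (x, t • v) = _ := isExp_circle htv (isExp_expMap h2)
  have hR : newtonRetraction circleConstraint (x, t • v) = ‖x + t • v‖⁻¹ • (x + t • v) :=
    newtonLimit_circleConstraint (add_ne_zero_of_mem_tangentBundle_circle hmem)
  have hns : ‖x + t • v‖ = Real.sqrt (1 + (t * ‖v‖) ^ 2) := by
    rw [← hnt, ← norm_add_sq_of_mem_tangentBundle_circle hmem, Real.sqrt_sq (norm_nonneg _)]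
  set τ := t * ‖v‖ with hτ
  have hτ0 : 0 < τ := by positivity
  have hcube := cube_div_eight_le hτ0 h3.le
  -- Pairing with `v` removes the components along `x` and leaves a difference of two scalar
  -- functions of `τ`.
  have hin : inner ℝ (expMap (zeroSet circleConstraint) (x, t • v) -
      newtonRetraction circleConstraint (x, t • v)) v =
      (Real.sin τ - (Real.sqrt (1 + τ ^ 2))⁻¹ * τ) * ‖v‖ := by
    rw [hE, hR, hns, hnt]
    simp only [inner_sub_left, inner_add_left, inner_smul_left, hxv, real_inner_self_eq_norm_sq,
      RCLike.conj_to_real]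
    have e : t = τ / ‖v‖ := by rw [hτ]; field_simp
    rw [e]
    field_simp
    ring
  have hnorm : τ ^ 3 / 8 ≤ ‖expMap (zeroSet circleConstraint) (x, t • v) -
      newtonRetraction circleConstraint (x, t • v)‖ := by
    have h4 := real_inner_le_norm (expMap (zeroSet circleConstraint) (x, t • v) -
      newtonRetraction circleConstraint (x, t • v)) v
    rw [hin] at h4
    exact hcube.trans (le_of_mul_le_mul_right h4 hv0)
  refine absurd h1 (not_lt.2 ?_)
  rw [ENNReal.le_div_iff_mul_le (Or.inl (by simpa using ht.ne')) (Or.inl ENNReal.ofReal_ne_top),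
    ← ENNReal.ofReal_mul (by positivity)]
  refine le_trans ?_ (enorm_sub_le_riemannianDist _ _ _)
  rw [← ofReal_norm]
  refine ENNReal.ofReal_le_ofReal (le_trans (le_of_eq ?_) hnorm)
  rw [abs_of_pos ht, hτ]
  ring

end Circle

end SubmanifoldRetraction

theorem mainTheorem1 :
    -- every retraction induced by a normal foliation is a second-order retraction
    (∀ (n d c : ℕ) (_ : d + c = n) (k : ℕ∞) (_ : 3 ≤ k)
      (M D : Set (Eucl n)) (leaf : Eucl n → Set (Eucl n)) (P : Eucl n → Eucl n),
      IsSubmanifold k c M →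
      IsNormalFoliation (k - 1) d c M D leaf →
      IsCanonicalProjection M D leaf P →
      IsRetractionOfOrder k 2 M (retractionDomain M D) (inducedRetraction P)) ∧
    -- this includes Newton retraction
    (∀ (n d c : ℕ) (_ : d + c = n) (k : ℕ∞) (_ : 3 ≤ k) (F : Eucl n → Eucl c),
      ContDiff ℝ (k : WithTop ℕ∞) F →
      (∀ x ∈ zeroSet F, Function.Surjective (fderiv ℝ F x)) →
      (∃ D : Set (Eucl n), IsNewtonDomain (k - 1) F D ∧
        IsNormalFoliation (k - 1) d c (zeroSet F) D (newtonLeaf F D) ∧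
        IsCanonicalProjection (zeroSet F) D (newtonLeaf F D) (newtonLimit F)) ∧
      (∀ D : Set (Eucl n), IsNewtonDomain (k - 1) F D →
        IsRetractionOfOrder k 2 (zeroSet F) (retractionDomain (zeroSet F) D)
          (newtonRetraction F))) ∧
    -- the order is sharp: the unit circle
    (zeroSet circleConstraint = Metric.sphere (0 : Eucl 2) 1 ∧
      IsNewtonDomain ⊤ circleConstraint {0}ᶜ ∧
      IsNormalFoliation ⊤ 1 1 (zeroSet circleConstraint) {0}ᶜ
        (newtonLeaf circleConstraint {0}ᶜ) ∧
      retractionDomain (zeroSet circleConstraint) {0}ᶜ =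
        tangentBundleOf (zeroSet circleConstraint) ∧
      IsRetractionOfOrder ⊤ 2 (zeroSet circleConstraint)
        (tangentBundleOf (zeroSet circleConstraint)) (newtonRetraction circleConstraint) ∧
      (∀ x v : Eucl 2, (x, v) ∈ tangentBundleOf (zeroSet circleConstraint) →
        closestPoints (zeroSet circleConstraint) (x + v) =
          {newtonRetraction circleConstraint (x, v)}) ∧
      (∀ x v : Eucl 2, (x, v) ∈ tangentBundleOf (zeroSet circleConstraint) → v ≠ 0 →
        ¬ AgreesWithExp (zeroSet circleConstraint)
            (newtonRetraction circleConstraint) 3 x v)) := by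
  refine ⟨fun n d c hdc k hk M D leaf P hM hfol hP => hfol.isRetractionOfOrder hdc hk hM hP,
    fun n d c hdc k hk F hF hs => ⟨exists_newtonFoliation hdc hk hF hs,
      fun D hD => hD.isRetractionOfOrder hk hF hs⟩, ?_, isNewtonDomain_circle,
    isNormalFoliation_circle, retractionDomain_circle, isRetractionOfOrder_circle,
    fun x v h => closestPoints_circle (add_ne_zero_of_mem_tangentBundle_circle h),
    fun x v h hv => not_agreesWithExp_circle h hv⟩
  ext x
  rw [mem_zeroSet_circleConstraint, mem_sphere_zero_iff_norm]
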